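/- Let $n\ge 1$, $\beta>0$, and $\mathbf C=\operatorname{diag}(c_1,\dots,c_n)$ with $0<c_1\le\dots\le c_n$. Let $\omega(x)=\sum_{i=1}^n\cosh(\beta x_i)$, and let $\mathcal H=L^2(\mathbb R^n;\omega)$ be the space of complex-valued functions with the norm $\|f\|_\omega=(\int_{\mathbb R^n}|f|^2\omega\,dx)^{1/2}$. Let $\mathcal L$ be the closure in $\mathcal H$ of the operator $Lf=\Delta f+x^T\mathbf C\nabla f+(\operatorname{tr}\mathbf C)f$ with domain $C_0^\infty(\mathbb R^n)$. Write $\hat f(\xi)=\int f(x)e^{-ix\cdot\xi}\,dx$ for the Fourier transform (extended to tempered distributions), $\Omega_{\beta/2}=\{z\in\mathbb C^n:\sum_i|\operatorname{Im}z_i|<\beta/2\}$, and $s^{\mathbf C}z=(s^{c_1}z_1,\dots,s^{c_n}z_n)$. Let $\vartheta$ be a real-valued function, or more generally a real tempered distribution, on $\mathbb R^n$ such that (i) $\hat\vartheta$ extends to a bounded analytic function on $\Omega_{\beta/2}$ (still denoted by $\hat\vartheta$); (ii) $\hat\vartheta(0)=0$; (iii) the function $z\mapsto\int_0^1\frac1s\,\hat\vartheta(s^{\mathbf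 C}z)\,ds$ is analytic on $\Omega_{\beta/2}$ and its real part is bounded there. Then $\Theta f:=\vartheta*f$ defines a bounded operator on $\mathcal H$, and $\mathcal L+\Theta$ (with domain $D(\mathcal L)$) generates a $C_0$-semigroup $(e^{t(\mathcal L+\Theta)})_{t\ge0}$ of bounded operators on $\mathcal H$. There is exactly one $f_0\in D(\mathcal L)$ with $(\mathcal L+\Theta)f_0=0$ and $\int_{\mathbb R^n}f_0\,dx=1$; it is given by $\hat f_0=\hat\psi\,\hat\mu_0$, where $\hat\psi(\xi)=\exp\big(\int_0^1\frac1s\hat\vartheta(s^{\mathbf C}\xi)\,ds\big)$ and $\mu_0(x)=\det(\mathbf C/(2\pi))^{1/2}\exp(-\tfrac12x^T\mathbf Cx)$. Moreover, there is a constant $C>0$ such that for every $\varphi\in\mathcal H$, with $m=\int_{\mathbb R^n}\varphi\,dx$ and $f(t)=e^{t(\mathcal L+\Theta)}\varphi$, $$\|f(t)-m f_0\|_\omega\le C\,\|\varphi-m f_0\|_\omega\,e^{-c_1t}\qquad\text{for all }t\ge0 .$$ -/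

import Mathlib

open MeasureTheory Filter Topology
open scoped SchwartzMap FourierTransform NNReal ContDiff Laplacian

noncomputable section

namespace NonlocalFP

/-- The Euclidean space `ℝⁿ`. -/
abbrev E (n : ℕ) : Type := EuclideanSpace ℝ (Fin n)

/-- The weight `ω(x) = ∑ᵢ cosh (β xᵢ)`. -/
def weight {n : ℕ} (β : ℝ) (x : E n) : ℝ := ∑ i, Real.cosh (β * x i)

/-- The measure `ω(x) dx`. -/
def weightMeasure (n : ℕ) (β : ℝ) : Measure (E n) :=
  volume.withDensity fun x => ENNReal.ofReal (weight β x)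

/-- The weighted space `𝓗 = L²(ω)` of complex valued functions, with
`‖f‖_ω = (∫ |f|² ω dx)^{1/2}`. -/
abbrev WSpace (n : ℕ) (β : ℝ) : Type := Lp ℂ 2 (weightMeasure n β)

/-- The differential expression `L φ = Δφ + xᵀC∇φ + (tr C) φ`, with `C = diag c`. -/
def fpExpr {n : ℕ} (c : Fin n → ℝ) (φ : E n → ℂ) (x : E n) : ℂ :=
  (Δ φ) x + ∑ i, ((c i * x i : ℝ) : ℂ) * fderiv ℝ φ x (EuclideanSpace.single i 1)
    + ((∑ i, c i : ℝ) : ℂ) * φ x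

/-- The space `C₀^∞(ℝⁿ)` of complex valued smooth functions with compact support. -/
def testFun (n : ℕ) : Submodule ℂ (E n → ℂ) where
  carrier := {φ | ContDiff ℝ ∞ φ ∧ HasCompactSupport φ}
  add_mem' ha hb := ⟨ha.1.add hb.1, ha.2.add hb.2⟩
  zero_mem' := ⟨contDiff_const, HasCompactSupport.zero⟩
  smul_mem' a _ hf := ⟨contDiff_const.smul hf.1, hf.2.smul_left (f := fun _ => a)⟩

lemma two_le_smooth : (2 : WithTop ℕ∞) ≤ ∞ := by
  exact ENat.LEInfty.out

lemma continuous_weight {n : ℕ} (β : ℝ) : Continuous (weight (n := n) β) := by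
  unfold weight
  fun_prop

instance instIsLocallyFiniteMeasure (n : ℕ) (β : ℝ) :
    IsLocallyFiniteMeasure (weightMeasure n β) :=
  IsLocallyFiniteMeasure.withDensity_ofReal (continuous_weight β)

lemma weight_pos {n : ℕ} [NeZero n] (β : ℝ) (x : E n) : 0 < weight β x :=
  Finset.sum_pos (fun _ _ => Real.cosh_pos _) Finset.univ_nonempty

/-- The Lebesgue measure and `ω(x) dx` have the same null sets. -/
lemma volume_absolutelyContinuous {n : ℕ} [NeZero n] (β : ℝ) :
    (volume : Measure (E n)) ≪ weightMeasure n β :=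
  withDensity_absolutelyContinuous'
    (continuous_weight β).measurable.ennreal_ofReal.aemeasurable
    (Eventually.of_forall fun x => by
      simpa using weight_pos β x)

lemma memLp_of_testFun {n : ℕ} (β : ℝ) {φ : E n → ℂ} (hφ : φ ∈ testFun n) :
    MemLp φ 2 (weightMeasure n β) :=
  hφ.1.continuous.memLp_of_hasCompactSupport hφ.2

lemma continuous_fpExpr {n : ℕ} (c : Fin n → ℝ) {φ : E n → ℂ} (hφ : φ ∈ testFun n) :
    Continuous (fpExpr c φ) := by
  have h1 : Continuous (Δ φ) := by
    rw [InnerProductSpace.laplacian_eq_iteratedFDeriv_stdOrthonormalBasis]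
    have h2 : Continuous (iteratedFDeriv ℝ 2 φ) :=
      hφ.1.continuous_iteratedFDeriv (m := 2) two_le_smooth
    fun_prop
  have h3 : Continuous (fderiv ℝ φ) := hφ.1.continuous_fderiv (by simp)
  have h4 : Continuous φ := hφ.1.continuous
  unfold fpExpr
  fun_prop

lemma hasCompactSupport_fpExpr {n : ℕ} (c : Fin n → ℝ) {φ : E n → ℂ} (hφ : φ ∈ testFun n) :
    HasCompactSupport (fpExpr c φ) := by
  refine HasCompactSupport.intro hφ.2 fun x hx => ?_
  have h0 : φ =ᶠ[𝓝 x] fun _ => (0 : ℂ) := notMem_tsupport_iff_eventuallyEq.mp hx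
  have h1 : (Δ φ) x = 0 := by
    rw [(InnerProductSpace.laplacian_congr_nhds h0).eq_of_nhds]
    simp
  have h2 : fderiv ℝ φ x = 0 := by
    rw [h0.fderiv_eq]
    simp
  simp [fpExpr, h1, h2, h0.eq_of_nhds]

lemma memLp_fpExpr {n : ℕ} (β : ℝ) (c : Fin n → ℝ) {φ : E n → ℂ} (hφ : φ ∈ testFun n) :
    MemLp (fpExpr c φ) 2 (weightMeasure n β) :=
  (continuous_fpExpr c hφ).memLp_of_hasCompactSupport (hasCompactSupport_fpExpr c hφ)

/-- The inclusion of `C₀^∞(ℝⁿ)` in `𝓗`. -/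
def testIncl (n : ℕ) (β : ℝ) : testFun n →ₗ[ℂ] WSpace n β where
  toFun φ := (memLp_of_testFun β φ.2).toLp φ.1
  map_add' φ ψ := MemLp.toLp_add (memLp_of_testFun β φ.2) (memLp_of_testFun β ψ.2)
  map_smul' a φ := MemLp.toLp_const_smul a (memLp_of_testFun β φ.2)

/-- `φ ↦ L φ` as a linear map from `C₀^∞(ℝⁿ)` to `𝓗`. -/
def fpTest {n : ℕ} (β : ℝ) (c : Fin n → ℝ) : testFun n →ₗ[ℂ] WSpace n β where
  toFun φ := (memLp_fpExpr β c φ.2).toLp (fpExpr c φ.1)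
  map_add' φ ψ := by
    rw [← MemLp.toLp_add]
    refine MemLp.toLp_congr _ _ (Eventually.of_forall fun x => ?_)
    have hp : ContDiffAt ℝ 2 φ.1 x := (φ.2.1.of_le two_le_smooth).contDiffAt
    have hq : ContDiffAt ℝ 2 ψ.1 x := (ψ.2.1.of_le two_le_smooth).contDiffAt
    have hf : fderiv ℝ (φ.1 + ψ.1) x = fderiv ℝ φ.1 x + fderiv ℝ ψ.1 x :=
      fderiv_add (hp.differentiableAt (by simp)) (hq.differentiableAt (by simp))
    simp only [fpExpr, Submodule.coe_add, Pi.add_apply, hp.laplacian_add hq, hf,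
      add_apply, mul_add, Finset.sum_add_distrib]
    ring
  map_smul' a φ := by
    simp only [RingHom.id_apply]
    rw [← MemLp.toLp_const_smul]
    refine MemLp.toLp_congr _ _ (Eventually.of_forall fun x => ?_)
    have hp : ContDiffAt ℝ 2 φ.1 x := (φ.2.1.of_le two_le_smooth).contDiffAt
    have hf : fderiv ℝ (a • φ.1) x = a • fderiv ℝ φ.1 x :=
      fderiv_const_smul (hp.differentiableAt (by simp)) a
    simp only [fpExpr, Submodule.coe_smul, Pi.smul_apply, smul_eq_mul,
      InnerProductSpace.laplacian_smul a hp, hf, smul_apply]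
    rw [mul_add, mul_add, Finset.mul_sum]
    congr 1
    · congr 1
      exact Finset.sum_congr rfl fun i _ => by ring
    · ring

lemma testIncl_injective (n : ℕ) [NeZero n] (β : ℝ) : Function.Injective (testIncl n β) := by
  intro φ ψ h
  have h1 : φ.1 =ᵐ[weightMeasure n β] ψ.1 :=
    (MemLp.toLp_eq_toLp_iff (memLp_of_testFun β φ.2) (memLp_of_testFun β ψ.2)).mp h
  have h2 : φ.1 =ᵐ[volume] ψ.1 := (volume_absolutelyContinuous β).ae_le h1
  exact Subtype.ext
    (Measure.eq_of_ae_eq h2 φ.2.1.continuous ψ.2.1.continuous)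

/-- The Fokker-Planck operator with domain `C₀^∞(ℝⁿ)`, as an unbounded operator in `𝓗`. -/
def fpMin {n : ℕ} [NeZero n] (β : ℝ) (c : Fin n → ℝ) : WSpace n β →ₗ.[ℂ] WSpace n β where
  domain := LinearMap.range (testIncl n β)
  toFun := fpTest β c ∘ₗ
    (LinearEquiv.ofInjective (testIncl n β) (testIncl_injective n β)).symm.toLinearMap

/-- The Fokker-Planck operator `𝓛` in `𝓗`: the closure in `𝓗` of `L` on `C₀^∞(ℝⁿ)`. -/
def fpOp {n : ℕ} [NeZero n] (β : ℝ) (c : Fin n → ℝ) : WSpace n β →ₗ.[ℂ] WSpace n β :=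
  (fpMin β c).closure

/-- `𝓛 + Θ` for a bounded operator `Θ`, with domain `D(𝓛)`. -/
def perturbedOp {n : ℕ} [NeZero n] (β : ℝ) (c : Fin n → ℝ)
    (Θ : WSpace n β →L[ℂ] WSpace n β) : WSpace n β →ₗ.[ℂ] WSpace n β :=
  fpOp β c + (Θ : WSpace n β →ₗ[ℂ] WSpace n β).toPMap ⊤

/-- The tube `Ω_{β/2} = {z ∈ ℂⁿ : |Im z|₁ < β/2}`. -/
def tube (n : ℕ) (β : ℝ) : Set (Fin n → ℂ) := {z | ∑ i, |(z i).im| < β / 2}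

/-- `z ↦ ∫₀¹ (1/s) ϑ̂(s^C z) ds`, with `s^C z = (s^{c₁} z₁, …, s^{cₙ} zₙ)`. -/
def logPsi {n : ℕ} (c : Fin n → ℝ) (ϑhat : (Fin n → ℂ) → ℂ) (z : Fin n → ℂ) : ℂ :=
  ∫ s in (0 : ℝ)..1, ((1 / s : ℝ) : ℂ) * ϑhat fun i => ((s ^ c i : ℝ) : ℂ) * z i

/-- `ψ̂(z) = exp (∫₀¹ (1/s) ϑ̂(s^C z) ds)`. -/
def psiHat {n : ℕ} (c : Fin n → ℝ) (ϑhat : (Fin n → ℂ) → ℂ) (z : Fin n → ℂ) : ℂ :=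
  Complex.exp (logPsi c ϑhat z)

/-- The conditions on the convolution kernel `ϑ`, a real valued tempered distribution, and on the
analytic continuation `ϑhat` to the tube of its Fourier transform. The Fourier transform is
normalized as `ϑ̂(ξ) = ∫ ϑ(x) e^{-i x·ξ} dx`; the transform `𝓕` of Mathlib uses `e^{-2πi x·ξ}`,
so that `𝓕 ϑ (ξ) = ϑ̂(2πξ)`. -/
structure KernelConditions {n : ℕ} (β : ℝ) (c : Fin n → ℝ) (ϑ : 𝓢'(E n, ℂ))
    (ϑhat : (Fin n → ℂ) → ℂ) : Prop where
  real : ∀ φ : 𝓢(E n, ℂ), (∀ x, (φ x).im = 0) → (ϑ φ).im = 0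
  fourier : ∀ φ : 𝓢(E n, ℂ),
    (𝓕 ϑ) φ = ∫ ξ : E n, ϑhat (fun i => ((2 * Real.pi * ξ i : ℝ) : ℂ)) * φ ξ
  analytic : AnalyticOnNhd ℂ ϑhat (tube n β)
  bounded : ∃ M : ℝ, ∀ z ∈ tube n β, ‖ϑhat z‖ ≤ M
  massless : ϑhat 0 = 0
  logPsi_analytic : AnalyticOnNhd ℂ (logPsi c ϑhat) (tube n β)
  logPsi_re_bounded : ∃ M : ℝ, ∀ z ∈ tube n β, |(logPsi c ϑhat z).re| ≤ M

/-- `g = ϑ * f` for a tempered distribution `ϑ` and `f, g ∈ 𝓗`, in the sense of distributions: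
`⟨ϑ * f, φ⟩ = ∫ f(y) ⟨ϑ, φ(· + y)⟩ dy` for all Schwartz functions `φ`. -/
def IsConvolution {n : ℕ} {β : ℝ} (ϑ : 𝓢'(E n, ℂ)) (f g : WSpace n β) : Prop :=
  ∀ φ : 𝓢(E n, ℂ),
    ∫ x : E n, g x * φ x = ∫ y : E n, f y * ϑ (φ.compSubConstCLM ℂ (-y))

/-- The mass `∫ f(x) dx` (with respect to the Lebesgue measure). -/
def mass {n : ℕ} {β : ℝ} (f : WSpace n β) : ℂ := ∫ x : E n, f x

/-- The Fourier transform `f̂(ξ) = ∫ f(x) e^{-i x·ξ} dx`. -/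
def fourierInt {n : ℕ} (f : E n → ℂ) (ξ : E n) : ℂ :=
  ∫ x : E n, f x * Complex.exp (-(Complex.I * ((inner ℝ x ξ : ℝ) : ℂ)))

/-- The Gaussian `μ₀(x) = det(C/(2π))^{1/2} exp(-½ xᵀCx)`. -/
def gaussian {n : ℕ} (c : Fin n → ℝ) (x : E n) : ℂ :=
  ((Real.sqrt (∏ i, c i / (2 * Real.pi)) * Real.exp (-(1 / 2) * ∑ i, c i * x i ^ 2) : ℝ) : ℂ)

/-- `f₀ = Ψ μ₀ = ψ * μ₀`, i.e. `f̂₀ = ψ̂ μ̂₀`. -/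
def IsPsiGaussian {n : ℕ} {β : ℝ} (c : Fin n → ℝ) (ϑhat : (Fin n → ℂ) → ℂ)
    (f₀ : WSpace n β) : Prop :=
  ∀ ξ : E n, fourierInt f₀ ξ =
    psiHat c ϑhat (fun i => ((ξ i : ℝ) : ℂ)) * fourierInt (gaussian c) ξ

/-- `C₀`-semigroups of bounded operators on a complex normed space. -/
structure IsC0Semigroup {X : Type*} [NormedAddCommGroup X] [NormedSpace ℂ X]
    (S : ℝ≥0 → X →L[ℂ] X) : Prop where
  zero : S 0 = ContinuousLinearMap.id ℂ X
  add : ∀ s t, S (s + t) = (S s).comp (S t)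
  continuous : ∀ f, Tendsto (fun t => S t f) (𝓝 0) (𝓝 f)

/-- `A` is the infinitesimal generator of `S`: `f ∈ D(A)` and `A f = g` iff
`(S t f - f) / t → g` as `t ↘ 0`. -/
def IsGenerator {X : Type*} [NormedAddCommGroup X] [NormedSpace ℂ X]
    (A : X →ₗ.[ℂ] X) (S : ℝ≥0 → X →L[ℂ] X) : Prop :=
  ∀ f g : X, (f, g) ∈ A.graph ↔
    Tendsto (fun t : ℝ≥0 => (((t : ℝ)⁻¹ : ℝ) : ℂ) • (S t f - f)) (𝓝[>] 0) (𝓝 g)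

end NonlocalFP

end

open NonlocalFP

/-! On the Fourier side everything is explicit. Since ω grows like exp(β|x|_∞), an element of L²(ω)
has a transform `fl f` that is holomorphic in the tube. By Plancherel on the lines 2πξ ± iσe_i, the
sum over i of the two squared L² norms is ∫ |f|² ∑ 2cosh(2σx_i), which tends to 2‖f‖² as σ ↑ β/2.
Conversely, `exists_of_lineEnergy`, a Paley-Wiener theorem for this weight, recovers an element of
L²(ω) from a holomorphic function with Gaussian decay and bounded line energies; Cauchy's theorem
moves the contour. Elements and operators are therefore built from transforms and compared at real
frequencies by `ext_of_fl`. The lack of Gaussian decay is repaired by a factor exp(-δ∑z_i²) and a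
weak limit δ → 0.

The trace term puts 𝓛 in divergence form, so its symbol is -|ξ|² - Cξ·∇, a first order operator.
Integrating along characteristics gives the semigroup (e^{t𝓛}f)^(z) = exp(-∑ τ_i(t) z_i²)
f̂(e^{-tC}z), with τ_i(t) = (1 - e^{-2c_i t})/(2c_i). `exists_semi` shows that it acts boundedly on
L²(ω). Its generator is the relation `FPRel`, the operator defined by the symbol on its maximal
domain. `mem_graph_fpOp` identifies this with the closure from C₀^∞: the relation is closed, and in
the other direction e^{ε𝓛}f is smooth with derivatives in L²(ω), can be cut off, and tends to f as ε
→ 0.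

Decay requires no spectral theory. If f has mass zero then f̂(0) = 0, and the mean value theorem
bounds f̂(e^{-tC}z) by a multiple of e^{-c_1 t}|z|. The Gaussian factor, uniformly nondegenerate for
t ≥ 1, absorbs |z|; this is `exists_norm_fpSemi_le_exp`.

The nonlocal term is removed by conjugation. Differentiating the integral that defines log ψ̂ along
s ↦ s^C ξ gives Cξ·∇ log ψ̂ = ϑ̂. Hence the multiplier Ψ by ψ̂, bounded with bounded inverse because
Re log ψ̂ is bounded, satisfies 𝓛 + Θ = Ψ𝓛Ψ⁻¹ (`KernelConditions.exists_psi`,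
`KernelConditions.fpSymbol_psi_inv`). Moreover ψ̂(0) = 1, so Ψ preserves mass. The semigroup is
Ψe^{t𝓛}Ψ⁻¹, the stationary state is Ψμ₀, and uniqueness and convergence transfer from 𝓛. -/

noncomputable section

namespace NonlocalFP

/-! ### Exponential growth in the maximum norm -/

/-- The maximum norm of `x`. -/
def supNorm {n : ℕ} (x : E n) : ℝ := ‖WithLp.ofLp x‖

lemma abs_apply_le_supNorm {n : ℕ} (x : E n) (i : Fin n) : |x i| ≤ supNorm x := by
  exact norm_le_pi_norm (WithLp.ofLp x) i

lemma supNorm_nonneg {n : ℕ} (x : E n) : 0 ≤ supNorm x := norm_nonneg _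

lemma continuous_supNorm {n : ℕ} : Continuous (supNorm (n := n)) := by
  unfold supNorm
  fun_prop

lemma exists_supNorm_eq {n : ℕ} [NeZero n] (x : E n) : ∃ i, supNorm x = |x i| := by
  obtain ⟨i, -, hi⟩ := Finset.exists_mem_eq_sup (Finset.univ : Finset (Fin n))
    Finset.univ_nonempty (fun b => ‖x b‖₊)
  refine ⟨i, ?_⟩
  unfold supNorm
  rw [Pi.norm_def, hi]
  simp

lemma norm_le_mul_supNorm {n : ℕ} (x : E n) : ‖x‖ ≤ n * supNorm x := by
  calc ‖x‖ = ‖∑ i, x i • EuclideanSpace.single i (1 : ℝ)‖ := by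
        congr 1
        ext j
        simp [Pi.single_apply]
    _ ≤ ∑ i : Fin n, ‖x i • EuclideanSpace.single i (1 : ℝ)‖ := norm_sum_le _ _
    _ ≤ ∑ _i : Fin n, supNorm x := Finset.sum_le_sum fun i _ => by
        simpa [norm_smul] using abs_apply_le_supNorm x i
    _ = n * supNorm x := by simp

/-- A coordinate of maximal modulus already contributes half of the exponential through its
hyperbolic cosine. -/
lemma exp_supNorm_le_weight {n : ℕ} [NeZero n] {β : ℝ} (hβ : 0 ≤ β) (x : E n) :
    Real.exp (β * supNorm x) ≤ 2 * weight β x := by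
  obtain ⟨i, hi⟩ := exists_supNorm_eq x
  have h1 : Real.cosh (β * x i) ≤ weight β x :=
    Finset.single_le_sum (f := fun i => Real.cosh (β * x i))
      (fun _ _ => (Real.cosh_pos _).le) (Finset.mem_univ i)
  have h2 : Real.cosh (β * x i) = Real.cosh (β * |x i|) := by
    rw [← Real.cosh_abs, abs_mul, abs_of_nonneg hβ]
  rw [hi]
  have h3 := Real.cosh_eq (β * |x i|)
  have h4 := Real.exp_pos (-(β * |x i|))
  linarith

lemma pow_le_const_mul_exp (k : ℕ) {ε : ℝ} (hε : 0 < ε) :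
    ∃ K : ℝ, 0 < K ∧ ∀ t : ℝ, 0 ≤ t → (1 + t) ^ k ≤ K * Real.exp (ε * t) := by
  -- The constant comes from y^k / k! ≤ e^y at y = ε(1 + t).
  refine ⟨k.factorial * Real.exp ε / ε ^ k, by positivity, fun t ht => ?_⟩
  have h := Real.pow_div_factorial_le_exp (x := ε * (1 + t)) (by positivity) k
  rw [div_le_iff₀ (by positivity), mul_pow, mul_add, mul_one, Real.exp_add] at h
  rw [div_mul_eq_mul_div, le_div_iff₀ (by positivity)]
  nlinarith

/-- Polynomial times exponential growth. -/
def growth {n : ℕ} (s : ℝ) (k : ℕ) (x : E n) : ℝ := (1 + ‖x‖) ^ k * Real.exp (s * supNorm x)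

lemma growth_pos {n : ℕ} (s : ℝ) (k : ℕ) (x : E n) : 0 < growth s k x := by
  unfold growth; positivity

lemma continuous_growth {n : ℕ} (s : ℝ) (k : ℕ) : Continuous (growth (n := n) s k) := by
  have := continuous_supNorm (n := n)
  unfold growth
  fun_prop

lemma growth_le {n : ℕ} {s s' : ℝ} (h : s < s') (k : ℕ) :
    ∃ K : ℝ, 0 < K ∧ ∀ x : E n, growth s k x ≤ K * Real.exp (s' * supNorm x) := by
  -- The denominator n + 1 outweighs the factor n in ‖x‖ ≤ n|x|_∞ and stays nonzero for n = 0.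
  obtain ⟨K, hK, hb⟩ := pow_le_const_mul_exp k (ε := (s' - s) / (n + 1))
    (div_pos (by linarith) (by positivity))
  refine ⟨K, hK, fun x => ?_⟩
  have h1 := hb ‖x‖ (norm_nonneg x)
  have h2 : (s' - s) / (n + 1) * ‖x‖ ≤ (s' - s) * supNorm x := by
    have h3 := norm_le_mul_supNorm x
    have h4 := supNorm_nonneg x
    rw [div_mul_eq_mul_div, div_le_iff₀ (by positivity), mul_assoc]
    refine mul_le_mul_of_nonneg_left ?_ (by linarith)
    linarith
  calc growth s k x ≤ K * Real.exp ((s' - s) / (n + 1) * ‖x‖) * Real.exp (s * supNorm x) :=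
        mul_le_mul_of_nonneg_right h1 (Real.exp_pos _).le
    _ ≤ K * Real.exp ((s' - s) * supNorm x) * Real.exp (s * supNorm x) := by gcongr
    _ = K * Real.exp (s' * supNorm x) := by
        rw [mul_assoc, ← Real.exp_add]
        ring_nf

lemma integrable_growth {n : ℕ} {s : ℝ} (hs : s < 0) (k : ℕ) :
    Integrable (growth (n := n) s k) := by
  -- The n + 1 extra powers, paid for by s < 0, leave the integrable tail (1 + ‖x‖)^{-(n+1)}.
  obtain ⟨K, hK, hb⟩ := growth_le (n := n) (s := s) (s' := 0) hs (k + (n + 1))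
  have h1 : Integrable (fun x : E n => K * (1 + ‖x‖) ^ (-((n : ℝ) + 1))) :=
    (integrable_one_add_norm (by simp)).const_mul K
  refine h1.mono' (continuous_growth s k).aestronglyMeasurable (Eventually.of_forall fun x => ?_)
  rw [Real.norm_of_nonneg (growth_pos s k x).le]
  have h2 := hb x
  have h0 : (0 : ℝ) < 1 + ‖x‖ := by positivity
  rw [Real.rpow_neg h0.le, ← div_eq_mul_inv, le_div_iff₀ (Real.rpow_pos_of_pos h0 _)]
  have h3 : (1 + ‖x‖) ^ ((n : ℝ) + 1) = (1 + ‖x‖) ^ (n + 1) := by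
    exact_mod_cast Real.rpow_natCast (1 + ‖x‖) (n + 1)
  rw [h3]
  simp only [zero_mul, Real.exp_zero, mul_one] at h2
  refine le_trans (le_of_eq ?_) h2
  unfold growth
  rw [pow_add]
  ring

/-! ### Integration against the weight and bounded pairings -/

lemma measurable_weight {n : ℕ} (β : ℝ) : Measurable (weight (n := n) β) :=
  (continuous_weight β).measurable

lemma weightMeasure_absolutelyContinuous {n : ℕ} (β : ℝ) :
    weightMeasure n β ≪ (volume : Measure (E n)) :=
  withDensity_absolutelyContinuous _ _

lemma ae_weight_iff {n : ℕ} [NeZero n] (β : ℝ) {p : E n → Prop} :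
    (∀ᵐ x ∂(weightMeasure n β), p x) ↔ ∀ᵐ x, p x :=
  ⟨fun h => (volume_absolutelyContinuous β).ae_le h,
    fun h => (weightMeasure_absolutelyContinuous β).ae_le h⟩

lemma aesm_weight_iff {n : ℕ} [NeZero n] (β : ℝ) {f : E n → ℂ} :
    AEStronglyMeasurable f (weightMeasure n β) ↔ AEStronglyMeasurable f volume :=
  ⟨fun h => h.mono_ac (volume_absolutelyContinuous β),
    fun h => h.mono_ac (weightMeasure_absolutelyContinuous β)⟩

lemma lintegral_weightMeasure {n : ℕ} (β : ℝ) (f : E n → ENNReal) :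
    ∫⁻ x, f x ∂(weightMeasure n β) = ∫⁻ x, ENNReal.ofReal (weight β x) * f x :=
  lintegral_withDensity_eq_lintegral_mul_non_measurable _
    (measurable_weight β).ennreal_ofReal (Eventually.of_forall fun _ => ENNReal.ofReal_lt_top) f

lemma eLpNorm_two_sq {α F : Type*} [MeasurableSpace α] {μ : Measure α} [NormedAddCommGroup F]
    (f : α → F) : eLpNorm f 2 μ ^ 2 = ∫⁻ x, ‖f x‖ₑ ^ 2 ∂μ := by
  have := eLpNorm_nnreal_pow_eq_lintegral (μ := μ) (f := f) (p := 2) two_ne_zero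
  simpa using this

lemma memLp_two_iff {α F : Type*} [MeasurableSpace α] {μ : Measure α} [NormedAddCommGroup F]
    {f : α → F} (hf : AEStronglyMeasurable f μ) :
    MemLp f 2 μ ↔ ∫⁻ x, ‖f x‖ₑ ^ 2 ∂μ < ⊤ := by
  rw [← eLpNorm_two_sq, MemLp, and_iff_right hf]
  simp

lemma enorm_sq_Lp {α F : Type*} [MeasurableSpace α] {μ : Measure α} [NormedAddCommGroup F]
    (f : Lp F 2 μ) : ‖f‖ₑ ^ 2 = ∫⁻ x, ‖f x‖ₑ ^ 2 ∂μ := by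
  rw [← eLpNorm_two_sq, Lp.enorm_def]

lemma integrable_withDensity_weight {n : ℕ} [NeZero n] (β : ℝ) {F : Type*} [NormedAddCommGroup F]
    [NormedSpace ℝ F] {f : E n → F} :
    Integrable f (weightMeasure n β) ↔ Integrable (fun x => weight β x • f x) := by
  unfold weightMeasure
  rw [integrable_withDensity_iff_integrable_smul' (measurable_weight β).ennreal_ofReal
    (Eventually.of_forall fun _ => ENNReal.ofReal_lt_top)]
  refine integrable_congr (Eventually.of_forall fun x => ?_)
  simp only [ENNReal.toReal_ofReal (weight_pos β x).le]

lemma integral_weight {n : ℕ} [NeZero n] (β : ℝ) {F : Type*} [NormedAddCommGroup F]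
    [NormedSpace ℝ F] (f : E n → F) :
    ∫ x, f x ∂(weightMeasure n β) = ∫ x, weight β x • f x := by
  unfold weightMeasure
  rw [integral_withDensity_eq_integral_toReal_smul (measurable_weight β).ennreal_ofReal
    (Eventually.of_forall fun _ => ENNReal.ofReal_lt_top)]
  refine integral_congr_ae (Eventually.of_forall fun x => ?_)
  simp only [ENNReal.toReal_ofReal (weight_pos β x).le]

/-- The square of the quotient times ω is growth²/ω, at most twice a growth function of rate 2s - β
< 0. This is the origin of the half-width β/2: by Cauchy-Schwarz, L²(ω) pairs with functions of
exponential rate below β/2. -/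
lemma memLp_growth_div_weight {n : ℕ} [NeZero n] {β s : ℝ} (hβ : 0 < β) (hs : s < β / 2) (k : ℕ) :
    MemLp (fun x : E n => growth s k x / weight β x) 2 (weightMeasure n β) := by
  have hc : Continuous (fun x : E n => growth s k x / weight β x) :=
    (continuous_growth s k).div (continuous_weight β) fun x => (weight_pos β x).ne'
  rw [memLp_two_iff_integrable_sq hc.aestronglyMeasurable, integrable_withDensity_weight]
  have h1 := (integrable_growth (n := n) (s := 2 * s - β) (by linarith) (2 * k)).const_mul 2
  have hw := fun x : E n => (weight_pos β x).ne'
  refine h1.mono' (Continuous.aestronglyMeasurable ?_) (Eventually.of_forall fun x => ?_)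
  · exact (continuous_weight β).smul (hc.pow 2)
  · have h2 := exp_supNorm_le_weight hβ.le x
    have h3 := weight_pos β x
    have h4 : weight β x • (growth s k x / weight β x) ^ 2 = growth s k x ^ 2 / weight β x := by
      rw [smul_eq_mul]
      field_simp
    rw [h4, Real.norm_of_nonneg (by positivity), div_le_iff₀ h3]
    have h5 : growth s k x ^ 2
        = growth (2 * s - β) (2 * k) x * Real.exp (β * supNorm x) := by
      unfold growth
      rw [mul_pow, ← pow_mul, mul_comm k 2, mul_assoc, ← Real.exp_add, ← Real.exp_nat_mul]
      congr 2
      push_cast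
      ring
    rw [h5]
    nlinarith [growth_pos (2 * s - β) (2 * k) x]

lemma integrable_growth_mul {n : ℕ} [NeZero n] {β s : ℝ} (hβ : 0 < β) (hs : s < β / 2) (k : ℕ)
    {f : E n → ℂ} (hf : MemLp f 2 (weightMeasure n β)) :
    Integrable (fun x => growth s k x * ‖f x‖) := by
  have h1 := (memLp_growth_div_weight hβ hs k).integrable_mul hf.norm
  rw [integrable_withDensity_weight] at h1
  refine h1.congr (Eventually.of_forall fun x => ?_)
  have := (weight_pos β x).ne'
  simp only [Pi.mul_apply, smul_eq_mul]
  field_simp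

/-- The norm of `x ↦ (1 + |x|)^k exp (s |x|_∞) / ω(x)` in `L²(ω)`. -/
def growthConst (n : ℕ) (β s : ℝ) (k : ℕ) : ℝ :=
  (eLpNorm (fun x : E n => growth s k x / weight β x) 2 (weightMeasure n β)).toReal

lemma growthConst_nonneg (n : ℕ) (β s : ℝ) (k : ℕ) : 0 ≤ growthConst n β s k :=
  ENNReal.toReal_nonneg

lemma integral_growth_mul_le {n : ℕ} [NeZero n] {β s : ℝ} (hβ : 0 < β) (hs : s < β / 2) (k : ℕ)
    (f : WSpace n β) :
    ∫ x, growth s k x * ‖f x‖ ≤ growthConst n β s k * ‖f‖ := by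
  have h0 := memLp_growth_div_weight (n := n) hβ hs k
  have h1 : MemLp (fun x => ‖f x‖) 2 (weightMeasure n β) := (Lp.memLp f).norm
  have h2 := real_inner_le_norm (h1.toLp _) (h0.toLp _)
  rw [L2.inner_def, Lp.norm_toLp, Lp.norm_toLp, eLpNorm_norm, mul_comm, ← Lp.norm_def] at h2
  refine le_trans (le_of_eq ?_) h2
  rw [integral_weight]
  refine integral_congr_ae ?_
  filter_upwards [(ae_weight_iff β).1 h0.coeFn_toLp, (ae_weight_iff β).1 h1.coeFn_toLp] with x h3 h4
  rw [h3, h4]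
  have := (weight_pos β x).ne'
  simp only [smul_eq_mul, inner, star_trivial, RCLike.re_to_real]
  field_simp

/-- Continuous functions that pair with `L²(ω)`. -/
def HasGrowth {n : ℕ} (β : ℝ) (h : E n → ℂ) : Prop :=
  Continuous h ∧ ∃ s < β / 2, ∃ (k : ℕ) (K : ℝ), 0 ≤ K ∧ ∀ x, ‖h x‖ ≤ K * growth s k x

lemma integrable_mul_of_growth {n : ℕ} [NeZero n] {β : ℝ} (hβ : 0 < β) {h : E n → ℂ}
    (hh : HasGrowth β h) {f : E n → ℂ} (hf : MemLp f 2 (weightMeasure n β)) :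
    Integrable (fun x => f x * h x) := by
  obtain ⟨hc, s, hs, k, K, -, hK⟩ := hh
  refine ((integrable_growth_mul hβ hs k hf).const_mul K).mono'
    (((aesm_weight_iff β).1 hf.1).mul hc.aestronglyMeasurable) (Eventually.of_forall fun x => ?_)
  rw [norm_mul]
  nlinarith [hK x, norm_nonneg (f x)]

lemma norm_integral_mul_le {n : ℕ} [NeZero n] {β s : ℝ} (hβ : 0 < β) (hs : s < β / 2) {k : ℕ}
    {K : ℝ} (hK0 : 0 ≤ K) {h : E n → ℂ} (hK : ∀ x, ‖h x‖ ≤ K * growth s k x) (f : WSpace n β) :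
    ‖∫ x, f x * h x‖ ≤ K * growthConst n β s k * ‖f‖ := by
  calc ‖∫ x, f x * h x‖ ≤ ∫ x, K * (growth s k x * ‖f x‖) := by
        refine norm_integral_le_of_norm_le
          ((integrable_growth_mul hβ hs k (Lp.memLp f)).const_mul K)
          (Eventually.of_forall fun x => ?_)
        rw [norm_mul]
        nlinarith [hK x, norm_nonneg (f x)]
    _ = K * ∫ x, growth s k x * ‖f x‖ := integral_const_mul _ _
    _ ≤ K * (growthConst n β s k * ‖f‖) :=
        mul_le_mul_of_nonneg_left (integral_growth_mul_le hβ hs k f) hK0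
    _ = _ := by ring

/-- The bounded functional `f ↦ ∫ f h dx` on `L²(ω)`. -/
def pairCLM {n : ℕ} [NeZero n] {β : ℝ} (hβ : 0 < β) {h : E n → ℂ} (hh : HasGrowth β h) :
    WSpace n β →L[ℂ] ℂ :=
  LinearMap.mkContinuousOfExistsBound
    { toFun := fun f => ∫ x, f x * h x
      map_add' := fun f g => by
        rw [← integral_add (integrable_mul_of_growth hβ hh (Lp.memLp f))
          (integrable_mul_of_growth hβ hh (Lp.memLp g))]
        refine integral_congr_ae ?_
        filter_upwards [(ae_weight_iff β).1 (Lp.coeFn_add f g)] with x hx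
        rw [hx, Pi.add_apply, add_mul]
      map_smul' := fun a f => by
        rw [RingHom.id_apply, smul_eq_mul, ← integral_const_mul]
        refine integral_congr_ae ?_
        filter_upwards [(ae_weight_iff β).1 (Lp.coeFn_smul a f)] with x hx
        rw [hx, Pi.smul_apply, smul_eq_mul, mul_assoc] }
    (by
      obtain ⟨hc, s, hs, k, K, hK0, hK⟩ := hh
      exact ⟨_, fun f => norm_integral_mul_le hβ hs hK0 hK f⟩)

/-! ### The Fourier-Laplace transform on the tube -/

/-- The `ℓ¹` norm of the imaginary part. -/
def im1 {n : ℕ} (z : Fin n → ℂ) : ℝ := ∑ i, |(z i).im|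

lemma continuous_im1 {n : ℕ} : Continuous (im1 (n := n)) := by
  unfold im1
  fun_prop

lemma mem_tube {n : ℕ} {β : ℝ} {z : Fin n → ℂ} : z ∈ tube n β ↔ im1 z < β / 2 := Iff.rfl

lemma isOpen_tube (n : ℕ) (β : ℝ) : IsOpen (tube n β) :=
  isOpen_lt continuous_im1 continuous_const

lemma im1_nonneg {n : ℕ} (z : Fin n → ℂ) : 0 ≤ im1 z := Finset.sum_nonneg fun _ _ => abs_nonneg _

/-- A real point as a point of `ℂⁿ`. -/
def toC {n : ℕ} (ξ : E n) : Fin n → ℂ := fun i => ((ξ i : ℝ) : ℂ)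

lemma im1_toC {n : ℕ} (ξ : E n) : im1 (toC ξ) = 0 := by simp [im1, toC]

lemma toC_mem_tube {n : ℕ} {β : ℝ} (hβ : 0 < β) (ξ : E n) : toC ξ ∈ tube n β := by
  rw [mem_tube, im1_toC]; linarith

/-- The exponential `exp (-i x·z)`. -/
def kern {n : ℕ} (z : Fin n → ℂ) (x : E n) : ℂ := Complex.exp (-(Complex.I * ∑ i, (x i : ℂ) * z i))

lemma continuous_kern {n : ℕ} (z : Fin n → ℂ) : Continuous (kern z) := by
  unfold kern
  fun_prop

lemma norm_kern {n : ℕ} (z : Fin n → ℂ) (x : E n) :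
    ‖kern z x‖ = Real.exp (∑ i, x i * (z i).im) := by
  unfold kern
  rw [Complex.norm_exp]
  simp [Complex.mul_re, Complex.re_sum, Complex.im_sum]

lemma sum_mul_im_le {n : ℕ} (z : Fin n → ℂ) (x : E n) :
    ∑ i, x i * (z i).im ≤ im1 z * supNorm x := by
  unfold im1
  rw [Finset.sum_mul]
  refine Finset.sum_le_sum fun i _ => ?_
  calc x i * (z i).im ≤ |x i| * |(z i).im| := by rw [← abs_mul]; exact le_abs_self _
    _ ≤ |(z i).im| * supNorm x := by
      rw [mul_comm]; exact mul_le_mul_of_nonneg_left (abs_apply_le_supNorm x i) (abs_nonneg _)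

lemma norm_kern_le {n : ℕ} {z : Fin n → ℂ} {s : ℝ} (hz : im1 z ≤ s) (x : E n) :
    ‖kern z x‖ ≤ growth s 0 x := by
  rw [norm_kern]
  unfold growth
  rw [pow_zero, one_mul, Real.exp_le_exp]
  exact (sum_mul_im_le z x).trans (mul_le_mul_of_nonneg_right hz (supNorm_nonneg x))

lemma hasGrowth_kern {n : ℕ} {β : ℝ} {z : Fin n → ℂ} (hz : z ∈ tube n β) : HasGrowth β (kern z) :=
  ⟨continuous_kern z, im1 z, hz, 0, 1, zero_le_one, fun x => by
    rw [one_mul]; exact norm_kern_le le_rfl x⟩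

/-- The Fourier-Laplace transform `f̂(z) = ∫ f(x) exp (-i x·z) dx`. -/
def fl {n : ℕ} (f : E n → ℂ) (z : Fin n → ℂ) : ℂ := ∫ x, f x * kern z x

lemma fl_congr {n : ℕ} {f g : E n → ℂ} (h : f =ᵐ[volume] g) (z : Fin n → ℂ) : fl f z = fl g z :=
  integral_congr_ae (h.mono fun x hx => by simp only [hx])

/-- The functional `f ↦ f̂(z)`. -/
def flCLM {n : ℕ} [NeZero n] {β : ℝ} (hβ : 0 < β) {z : Fin n → ℂ} (hz : z ∈ tube n β) :
    WSpace n β →L[ℂ] ℂ := pairCLM hβ (hasGrowth_kern hz)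

lemma flCLM_apply {n : ℕ} [NeZero n] {β : ℝ} (hβ : 0 < β) {z : Fin n → ℂ} (hz : z ∈ tube n β)
    (f : WSpace n β) : flCLM hβ hz f = fl f z := rfl

lemma norm_fl_le {n : ℕ} [NeZero n] {β s : ℝ} (hβ : 0 < β) (hs : s < β / 2) {z : Fin n → ℂ}
    (hz : im1 z ≤ s) (f : WSpace n β) : ‖fl f z‖ ≤ growthConst n β s 0 * ‖f‖ := by
  have := norm_integral_mul_le hβ hs zero_le_one (h := kern z) (k := 0)
    (fun x => by rw [one_mul]; exact norm_kern_le hz x) f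
  rwa [one_mul] at this

/-- The kernel of the derivative of `fl f` at `z` in the direction `v`. -/
def dkern {n : ℕ} (z v : Fin n → ℂ) (x : E n) : ℂ :=
  kern z x * (-(Complex.I * ∑ i, (x i : ℂ) * v i))

lemma continuous_dkern {n : ℕ} (z v : Fin n → ℂ) : Continuous (dkern z v) := by
  have := continuous_kern z
  unfold dkern
  fun_prop

lemma norm_sum_mul_le {n : ℕ} (v : Fin n → ℂ) (x : E n) :
    ‖-(Complex.I * ∑ i, (x i : ℂ) * v i)‖ ≤ (∑ i, ‖v i‖) * (1 + ‖x‖) := by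
  rw [norm_neg, norm_mul, Complex.norm_I, one_mul, Finset.sum_mul]
  refine (norm_sum_le _ _).trans (Finset.sum_le_sum fun i _ => ?_)
  rw [norm_mul, mul_comm, Complex.norm_real]
  refine mul_le_mul_of_nonneg_left ?_ (norm_nonneg _)
  have := PiLp.norm_apply_le x i
  linarith

lemma norm_dkern_le {n : ℕ} {z v : Fin n → ℂ} {s : ℝ} (hz : im1 z ≤ s) (x : E n) :
    ‖dkern z v x‖ ≤ (∑ i, ‖v i‖) * growth s 1 x := by
  have h1 := norm_kern_le hz x
  have h2 := norm_sum_mul_le v x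
  unfold dkern
  rw [norm_mul]
  calc _ ≤ growth s 0 x * ((∑ i, ‖v i‖) * (1 + ‖x‖)) :=
        mul_le_mul h1 h2 (norm_nonneg _) (growth_pos _ _ _).le
    _ = _ := by unfold growth; ring

lemma hasGrowth_dkern {n : ℕ} {β : ℝ} {z : Fin n → ℂ} (hz : z ∈ tube n β) (v : Fin n → ℂ) :
    HasGrowth β (dkern z v) :=
  ⟨continuous_dkern z v, im1 z, hz, 1, _, Finset.sum_nonneg fun _ _ => norm_nonneg _, fun x =>
    norm_dkern_le le_rfl x⟩

/-- The derivative of `fl f` at `z` in the direction `v`. -/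
def dfl {n : ℕ} (f : E n → ℂ) (z v : Fin n → ℂ) : ℂ := ∫ x, f x * dkern z v x

/-- The functional `f ↦ (∂_v f̂)(z)`. -/
def dflCLM {n : ℕ} [NeZero n] {β : ℝ} (hβ : 0 < β) {z : Fin n → ℂ} (hz : z ∈ tube n β)
    (v : Fin n → ℂ) : WSpace n β →L[ℂ] ℂ := pairCLM hβ (hasGrowth_dkern hz v)

lemma dflCLM_apply {n : ℕ} [NeZero n] {β : ℝ} (hβ : 0 < β) {z : Fin n → ℂ} (hz : z ∈ tube n β)
    (v : Fin n → ℂ) (f : WSpace n β) : dflCLM hβ hz v f = dfl f z v := rfl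

lemma norm_dfl_le {n : ℕ} [NeZero n] {β s : ℝ} (hβ : 0 < β) (hs : s < β / 2) {z : Fin n → ℂ}
    (hz : im1 z ≤ s) (v : Fin n → ℂ) (f : WSpace n β) :
    ‖dfl f z v‖ ≤ (∑ i, ‖v i‖) * growthConst n β s 1 * ‖f‖ := by
  have h0 : 0 ≤ ∑ i, ‖v i‖ := Finset.sum_nonneg fun _ _ => norm_nonneg _
  have h1 := norm_integral_mul_le hβ hs h0 (h := dkern z v) (k := 1)
    (fun x => norm_dkern_le hz x) f
  rw [dfl]
  exact h1

/-- `v ↦ -i x·v` as a complex linear form. -/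
def phaseForm {n : ℕ} (x : E n) : (Fin n → ℂ) →L[ℂ] ℂ :=
  -(Complex.I • ∑ i, (x i : ℂ) • (ContinuousLinearMap.proj i : (Fin n → ℂ) →L[ℂ] ℂ))

lemma phaseForm_apply {n : ℕ} (x : E n) (v : Fin n → ℂ) :
    phaseForm x v = -(Complex.I * ∑ i, (x i : ℂ) * v i) := by
  unfold phaseForm
  rw [neg_apply, smul_apply, sum_apply]
  rfl

lemma norm_phaseForm_le {n : ℕ} (x : E n) : ‖phaseForm x‖ ≤ n * (1 + ‖x‖) := by
  refine ContinuousLinearMap.opNorm_le_bound _ (by positivity) fun v => ?_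
  rw [phaseForm_apply]
  refine (norm_sum_mul_le v x).trans ?_
  have : ∑ i, ‖v i‖ ≤ n * ‖v‖ := by
    calc ∑ i, ‖v i‖ ≤ ∑ _i : Fin n, ‖v‖ := Finset.sum_le_sum fun i _ => norm_le_pi_norm v i
      _ = n * ‖v‖ := by simp
  calc _ ≤ n * ‖v‖ * (1 + ‖x‖) := by gcongr
    _ = _ := by ring

lemma hasFDerivAt_kern {n : ℕ} (z : Fin n → ℂ) (x : E n) :
    HasFDerivAt (fun z => kern z x) (kern z x • phaseForm x) z := by
  have h : (fun z => kern z x) = fun z => Complex.exp (phaseForm x z) := by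
    ext z
    rw [phaseForm_apply]
    rfl
  rw [h]
  have := (phaseForm x).hasFDerivAt (x := z) |>.cexp
  rw [phaseForm_apply] at this
  exact this

lemma continuous_phaseForm {n : ℕ} : Continuous (phaseForm (n := n)) := by
  unfold phaseForm
  fun_prop

/-- Differentiation under the integral. An s strictly between |Im z|₁ and β/2 gives a neighbourhood
of z on which one growth function of rate s dominates; the phase costs one power of 1 + ‖x‖. -/
lemma hasFDerivAt_fl {n : ℕ} [NeZero n] {β : ℝ} (hβ : 0 < β) {f : E n → ℂ}
    (hf : MemLp f 2 (weightMeasure n β)) {z : Fin n → ℂ} (hz : z ∈ tube n β) :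
    ∃ D : (Fin n → ℂ) →L[ℂ] ℂ, HasFDerivAt (fl f) D z ∧ ∀ v, D v = dfl f z v := by
  obtain ⟨s, hs1, hs2⟩ := exists_between (mem_tube.1 hz)
  have hfm := (aesm_weight_iff β).1 hf.1
  have hU : {w : Fin n → ℂ | im1 w < s} ∈ 𝓝 z :=
    (isOpen_lt continuous_im1 continuous_const).mem_nhds hs1
  have hbd : ∀ w ∈ {w : Fin n → ℂ | im1 w < s}, ∀ x,
      ‖f x • (kern w x • phaseForm x)‖ ≤ n * (growth s 1 x * ‖f x‖) := fun w hw x => by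
    rw [norm_smul, norm_smul]
    calc ‖f x‖ * (‖kern w x‖ * ‖phaseForm x‖) ≤ ‖f x‖ * (growth s 0 x * (n * (1 + ‖x‖))) := by
          gcongr
          · exact (growth_pos s 0 x).le
          · exact norm_kern_le (le_of_lt hw) x
          · exact norm_phaseForm_le x
      _ = _ := by unfold growth; ring
  have hm' : AEStronglyMeasurable (fun x => f x • (kern z x • phaseForm x)) volume :=
    hfm.smul ((continuous_kern z).smul continuous_phaseForm).aestronglyMeasurable
  have hint := (integrable_growth_mul hβ hs2 1 hf).const_mul (n : ℝ)
  have key := hasFDerivAt_integral_of_dominated_of_fderiv_le (𝕜 := ℂ) (μ := volume)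
    (F := fun z x => f x * kern z x) (F' := fun z x => f x • (kern z x • phaseForm x)) (x₀ := z)
    (bound := fun x => n * (growth s 1 x * ‖f x‖)) hU
    (Eventually.of_forall fun w => hfm.mul (continuous_kern w).aestronglyMeasurable)
    (integrable_mul_of_growth hβ (hasGrowth_kern hz) hf) hm'
    (Eventually.of_forall fun x w hw => hbd w hw x) hint
    (Eventually.of_forall fun x w _ => (hasFDerivAt_kern w x).const_mul (f x))
  refine ⟨_, key, fun v => ?_⟩
  refine (ContinuousLinearMap.integral_apply
    (hint.mono' hm' (Eventually.of_forall fun x => hbd z hs1 x)) v).trans ?_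
  refine integral_congr_ae (Eventually.of_forall fun x => ?_)
  simp only [smul_apply, phaseForm_apply, smul_eq_mul, dkern]

lemma differentiableOn_fl {n : ℕ} [NeZero n] {β : ℝ} (hβ : 0 < β) {f : E n → ℂ}
    (hf : MemLp f 2 (weightMeasure n β)) : DifferentiableOn ℂ (fl f) (tube n β) := fun z hz => by
  obtain ⟨D, hD, -⟩ := hasFDerivAt_fl hβ hf hz
  exact hD.differentiableAt.differentiableWithinAt

/-! ### Moment problems in a Hilbert space -/

section Functionals

variable {H : Type*} [NormedAddCommGroup H] [InnerProductSpace ℂ H] [CompleteSpace H]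

/-- Reflexivity from the Riesz theorem: `toDual` is conjugate linear, so conjugating Λ ∘ `toDual`
gives a linear functional, whose representing vector is g. -/
lemma exists_eval_of_bidual (Λ : StrongDual ℂ (StrongDual ℂ H)) :
    ∃ g : H, ‖g‖ ≤ ‖Λ‖ ∧ ∀ ℓ : StrongDual ℂ H, ℓ g = Λ ℓ := by
  let T : H →ₗ[ℂ] ℂ :=
    { toFun := fun y => star (Λ (InnerProductSpace.toDual ℂ H y))
      map_add' := fun x y => by simp
      map_smul' := fun a y => by
        rw [LinearIsometryEquiv.map_smulₛₗ, map_smul]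
        simp }
  have hT : ∀ y, ‖T y‖ ≤ ‖Λ‖ * ‖y‖ := fun y => by
    change ‖star (Λ (InnerProductSpace.toDual ℂ H y))‖ ≤ _
    rw [norm_star]
    simpa using Λ.le_opNorm (InnerProductSpace.toDual ℂ H y)
  let T' : H →L[ℂ] ℂ := T.mkContinuous ‖Λ‖ hT
  refine ⟨(InnerProductSpace.toDual ℂ H).symm T', ?_, fun ℓ => ?_⟩
  · rw [LinearIsometryEquiv.norm_map]
    exact T.mkContinuous_norm_le (norm_nonneg Λ) hT
  · obtain ⟨y, rfl⟩ := (InnerProductSpace.toDual ℂ H).surjective ℓ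
    have h1 : inner ℂ ((InnerProductSpace.toDual ℂ H).symm T') y = T' y :=
      InnerProductSpace.toDual_symm_apply
    have h2 : T' y = star (Λ (InnerProductSpace.toDual ℂ H y)) := rfl
    rw [InnerProductSpace.toDual_apply_apply, ← inner_conj_symm, h1, h2]
    simp

/-- The bound makes V vanish on ker L, so V factors through the range of L; Hahn-Banach extends the
factor without increasing its norm. -/
lemma exists_dual_of_bound {W X : Type*} [AddCommGroup W] [Module ℂ W] [NormedAddCommGroup X]
    [NormedSpace ℂ X] (L : W →ₗ[ℂ] X) (V : W →ₗ[ℂ] ℂ) {A : ℝ} (hA : 0 ≤ A)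
    (h : ∀ a, ‖V a‖ ≤ A * ‖L a‖) : ∃ Λ : StrongDual ℂ X, ‖Λ‖ ≤ A ∧ ∀ a, Λ (L a) = V a := by
  have hk : ∀ a b, L a = L b → V a = V b := fun a b hab => by
    rw [← sub_eq_zero, ← map_sub, ← norm_le_zero_iff]
    refine (h _).trans ?_
    rw [map_sub, hab, sub_self, norm_zero, mul_zero]
  choose s hs using fun y : LinearMap.range L => y.2
  let T : LinearMap.range L →ₗ[ℂ] ℂ :=
    { toFun := fun y => V (s y)
      map_add' := fun x y => by
        rw [← map_add]
        refine hk _ _ ?_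
        rw [map_add, hs, hs, hs, Submodule.coe_add]
      map_smul' := fun c y => by
        rw [RingHom.id_apply, ← map_smul]
        refine hk _ _ ?_
        rw [map_smul, hs, hs, Submodule.coe_smul] }
  have hT : ∀ y, ‖T y‖ ≤ A * ‖y‖ := fun y => by
    have := h (s y)
    rw [hs] at this
    exact this
  obtain ⟨Λ, hΛ, hn⟩ := exists_extension_norm_eq (LinearMap.range L) (T.mkContinuous A hT)
  refine ⟨Λ, hn.le.trans (T.mkContinuous_norm_le hA hT), fun a => ?_⟩
  rw [hΛ ⟨L a, LinearMap.mem_range_self L _⟩]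
  exact hk _ _ (hs _)

/-- A moment problem with bounded data on a Hilbert space is solvable. -/
lemma exists_of_functional_bound {ι : Type*} (ℓ : ι → StrongDual ℂ H) (v : ι → ℂ) {A : ℝ}
    (hA : 0 ≤ A) (h : ∀ a : ι →₀ ℂ,
      ‖Finsupp.linearCombination ℂ v a‖ ≤ A * ‖Finsupp.linearCombination ℂ ℓ a‖) :
    ∃ g : H, ‖g‖ ≤ A ∧ ∀ i, ℓ i g = v i := by
  obtain ⟨Λ, hΛ, hn⟩ := exists_dual_of_bound (Finsupp.linearCombination ℂ ℓ)
    (Finsupp.linearCombination ℂ v) hA h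
  obtain ⟨g, hg, hgl⟩ := exists_eval_of_bidual Λ
  refine ⟨g, hg.trans hΛ, fun i => ?_⟩
  have h2 := hn (Finsupp.single i 1)
  rw [Finsupp.linearCombination_single, Finsupp.linearCombination_single, one_smul, one_smul] at h2
  rw [hgl, h2]

/-- A substitute for weak compactness: the norm bound passes to the limit in each finite linear
combination of the functionals, which is all that the moment problem requires. -/
lemma exists_of_tendsto_functionals {ι κ : Type*} {F : Filter κ} [F.NeBot]
    (ℓ : ι → StrongDual ℂ H) (v : ι → ℂ) {A : ℝ} (g : κ → H) (hg : ∀ᶠ k in F, ‖g k‖ ≤ A)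
    (hlim : ∀ i, Tendsto (fun k => ℓ i (g k)) F (𝓝 (v i))) :
    ∃ f : H, ‖f‖ ≤ A ∧ ∀ i, ℓ i f = v i := by
  have hA : 0 ≤ A := by
    obtain ⟨k, hk⟩ := hg.exists
    exact (norm_nonneg _).trans hk
  refine exists_of_functional_bound ℓ v hA fun a => ?_
  have h1 : Tendsto (fun k => Finsupp.linearCombination ℂ ℓ a (g k)) F
      (𝓝 (Finsupp.linearCombination ℂ v a)) := by
    simp only [Finsupp.linearCombination_apply, Finsupp.sum, sum_apply, smul_apply]
    exact tendsto_finsetSum _ fun i _ => (hlim i).const_smul _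
  refine le_of_tendsto h1.norm ?_
  filter_upwards [hg] with k hk
  rw [mul_comm]
  exact ((Finsupp.linearCombination ℂ ℓ a).le_opNorm _).trans
    (mul_le_mul_of_nonneg_left hk (norm_nonneg _))

/-- A weak integral of w over [0, t]. Only the scalar functions ℓ i ∘ w need to be continuous; no
strong measurability of w enters. -/
lemma exists_of_integral_functionals {ι : Type*} (ℓ : ι → StrongDual ℂ H) {t A : ℝ} (ht : 0 ≤ t)
    (w : ℝ → H) (hw : ∀ r ∈ Set.Icc 0 t, ‖w r‖ ≤ A)
    (hc : ∀ i, ContinuousOn (fun r => ℓ i (w r)) (Set.Icc 0 t)) :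
    ∃ f : H, ‖f‖ ≤ t * A ∧ ∀ i, ℓ i f = ∫ r in (0 : ℝ)..t, ℓ i (w r) := by
  have hA : 0 ≤ A := (norm_nonneg _).trans (hw 0 ⟨le_rfl, ht⟩)
  refine exists_of_functional_bound ℓ _ (mul_nonneg ht hA) fun a => ?_
  have h1 : Finsupp.linearCombination ℂ (fun i => ∫ r in (0 : ℝ)..t, ℓ i (w r)) a
      = ∫ r in (0 : ℝ)..t, Finsupp.linearCombination ℂ ℓ a (w r) := by
    simp only [Finsupp.linearCombination_apply, Finsupp.sum, sum_apply, smul_apply]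
    rw [intervalIntegral.integral_finsetSum]
    · simp only [intervalIntegral.integral_smul]
    · intro i _
      refine ContinuousOn.intervalIntegrable ?_
      rw [Set.uIcc_of_le ht]
      exact (hc i).const_smul (a i)
  rw [h1]
  refine (intervalIntegral.norm_integral_le_of_norm_le_const
    (C := A * ‖Finsupp.linearCombination ℂ ℓ a‖) fun r hr => ?_).trans (le_of_eq ?_)
  · rw [Set.uIoc_of_le ht] at hr
    rw [mul_comm]
    exact ((Finsupp.linearCombination ℂ ℓ a).le_opNorm _).trans
      (mul_le_mul_of_nonneg_left (hw r ⟨hr.1.le, hr.2⟩) (norm_nonneg _))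
  · rw [sub_zero, abs_of_nonneg ht]
    ring

end Functionals

/-! ### Plancherel's theorem for the Fourier integral -/

section Plancherel

variable {V : Type*} [NormedAddCommGroup V] [InnerProductSpace ℝ V] [FiniteDimensional ℝ V]
  [MeasurableSpace V] [BorelSpace V]

lemma integral_fourier_mul_of_integrable {f g : V → ℂ} (hf : Integrable f) (hg : Integrable g) :
    ∫ x, 𝓕 f x * g x = ∫ x, f x * 𝓕 g x := by
  have := VectorFourier.integral_fourierIntegral_smul_eq_flip (L := innerₗ V) (μ := volume)
    (ν := volume) Real.continuous_fourierChar (by exact continuous_inner) hf hg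
  rw [flip_innerₗ] at this
  exact this

lemma continuous_fourier_of_integrable {f : V → ℂ} (hf : Integrable f) : Continuous (𝓕 f) :=
  VectorFourier.fourierIntegral_continuous Real.continuous_fourierChar
    (by exact continuous_inner) hf

/-- The L² transform agrees with the distributional one. Pairing both sides with real test functions
and moving the transform onto the test function identifies it with the integral. -/
lemma fourier_toLp_ae_eq {f : V → ℂ} (hf : Integrable f) (hf2 : MemLp f 2) :
    (𝓕 (hf2.toLp f) : Lp ℂ 2 (volume : Measure V)) =ᵐ[volume] 𝓕 f := by
  have hw : LocallyIntegrable (𝓕 (hf2.toLp f) : Lp ℂ 2 (volume : Measure V)) volume :=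
    (Lp.memLp (𝓕 (hf2.toLp f))).locallyIntegrable (by norm_num)
  refine ae_eq_of_integral_contDiff_smul_eq hw
    (continuous_fourier_of_integrable hf).locallyIntegrable fun φ hφ hφc => ?_
  have hψ1 : ContDiff ℝ ∞ fun x => ((φ x : ℝ) : ℂ) := Complex.ofRealCLM.contDiff.comp hφ
  have hψ2 : HasCompactSupport fun x => ((φ x : ℝ) : ℂ) :=
    hφc.comp_left (g := fun t : ℝ => (t : ℂ)) Complex.ofReal_zero
  let ψ : 𝓢(V, ℂ) := hψ2.toSchwartzMap hψ1
  have hψ : ∀ x, ψ x = (φ x : ℂ) := fun x => rfl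
  have h1 := congrArg (fun T : 𝓢'(V, ℂ) => T ψ)
    (Lp.fourier_toTemperedDistribution_eq (hf2.toLp f))
  simp only [TemperedDistribution.fourier_apply, Lp.toTemperedDistribution_apply] at h1
  have h2 : ∫ x, φ x • (𝓕 (hf2.toLp f) : Lp ℂ 2 (volume : Measure V)) x
      = ∫ x, ψ x • (𝓕 (hf2.toLp f) : Lp ℂ 2 (volume : Measure V)) x :=
    integral_congr_ae (Eventually.of_forall fun x => by simp [hψ])
  rw [h2, ← h1]
  have h3 := integral_fourier_mul_of_integrable hf ψ.integrable
  calc ∫ x, (𝓕 ψ) x • (hf2.toLp f) x = ∫ x, f x * 𝓕 (ψ : V → ℂ) x := by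
        refine integral_congr_ae ?_
        filter_upwards [hf2.coeFn_toLp] with x hx
        rw [hx, smul_eq_mul, mul_comm, SchwartzMap.fourier_coe]
    _ = ∫ x, φ x • 𝓕 f x := by
        rw [← h3]
        refine integral_congr_ae (Eventually.of_forall fun x => ?_)
        simp [hψ, mul_comm]

/-- Plancherel's theorem on `L¹ ∩ L²`. -/
lemma lintegral_fourier_sq {f : V → ℂ} (hf : Integrable f) (hf2 : MemLp f 2) :
    ∫⁻ x, ‖𝓕 f x‖ₑ ^ 2 = ∫⁻ x, ‖f x‖ₑ ^ 2 := by
  have h1 := enorm_sq_Lp (𝓕 (hf2.toLp f) : Lp ℂ 2 (volume : Measure V))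
  have h2 := enorm_sq_Lp (hf2.toLp f)
  have h3 : ‖(𝓕 (hf2.toLp f) : Lp ℂ 2 (volume : Measure V))‖ₑ = ‖hf2.toLp f‖ₑ := by
    rw [← ofReal_norm, ← ofReal_norm, Lp.norm_fourier_eq]
  rw [h3, h2] at h1
  calc ∫⁻ x, ‖𝓕 f x‖ₑ ^ 2
      = ∫⁻ x, ‖(𝓕 (hf2.toLp f) : Lp ℂ 2 (volume : Measure V)) x‖ₑ ^ 2 :=
        lintegral_congr_ae ((fourier_toLp_ae_eq hf hf2).mono fun x hx => by simp only [hx])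
    _ = ∫⁻ x, ‖(hf2.toLp f) x‖ₑ ^ 2 := h1.symm
    _ = _ := lintegral_congr_ae (hf2.coeFn_toLp.mono fun x hx => by simp only [hx])

lemma lintegral_fourierInv_sq {f : V → ℂ} (hf : Integrable f) (hf2 : MemLp f 2) :
    ∫⁻ x, ‖𝓕⁻ f x‖ₑ ^ 2 = ∫⁻ x, ‖f x‖ₑ ^ 2 := by
  rw [← lintegral_fourier_sq hf hf2]
  simp_rw [Real.fourierInv_eq_fourier_neg]
  exact lintegral_neg_eq_self (μ := volume) (fun x => ‖𝓕 f x‖ₑ ^ 2)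

lemma ae_eq_zero_of_fourier_eq_zero {f : V → ℂ} (hf : Integrable f) (hf2 : MemLp f 2)
    (h : ∀ ξ, 𝓕 f ξ = 0) : f =ᵐ[volume] 0 := by
  have h1 := lintegral_fourier_sq hf hf2
  simp only [h, enorm_zero, ne_eq, OfNat.ofNat_ne_zero, not_false_eq_true, zero_pow,
    lintegral_zero] at h1
  rw [eq_comm, lintegral_eq_zero_iff' (hf.1.enorm.pow_const 2)] at h1
  filter_upwards [h1] with x hx
  simpa using hx

end Plancherel

/-! ### Horizontal lines in the tube and uniqueness of transforms -/

/-- The point `2πξ` as a point of `ℂⁿ`. -/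
def sc {n : ℕ} (ξ : E n) : Fin n → ℂ := fun i => ((2 * Real.pi * ξ i : ℝ) : ℂ)

/-- The point `2πξ + ζ eᵢ` of `ℂⁿ`. -/
def line {n : ℕ} (i : Fin n) (ζ : ℂ) (ξ : E n) : Fin n → ℂ := sc ξ + Pi.single i ζ

lemma line_zero {n : ℕ} (i : Fin n) (ξ : E n) : line i 0 ξ = sc ξ := by simp [line]

lemma im1_line {n : ℕ} (i : Fin n) (ζ : ℂ) (ξ : E n) : im1 (line i ζ ξ) = |ζ.im| := by
  unfold im1
  rw [Finset.sum_eq_single i]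
  · simp [line, sc]
  · intro j _ hj
    simp [line, sc, hj]
  · simp

lemma sc_eq_toC {n : ℕ} (ξ : E n) : sc ξ = toC ((2 * Real.pi) • ξ) := by
  ext i
  simp [sc, toC]

lemma continuous_line {n : ℕ} (i : Fin n) (ζ : ℂ) : Continuous (line i ζ) := by
  unfold line sc
  fun_prop

lemma sum_re_sq_line_ge {n : ℕ} (i : Fin n) (ζ : ℂ) (ξ : E n) :
    2 * Real.pi ^ 2 * ‖ξ‖ ^ 2 - ζ.re ^ 2 ≤ ∑ j, (line i ζ ξ j).re ^ 2 := by
  have h1 : ∀ j, 2 * Real.pi ^ 2 * (ξ j) ^ 2 - (if j = i then ζ.re ^ 2 else 0)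
      ≤ (line i ζ ξ j).re ^ 2 := fun j => by
    by_cases h : j = i
    · subst h
      simp only [line, sc, Pi.add_apply, Pi.single_eq_same, Complex.add_re, Complex.ofReal_re,
        if_true]
      nlinarith [sq_nonneg (2 * Real.pi * ξ j + 2 * ζ.re)]
    · simp only [line, sc, Pi.add_apply, Pi.single_eq_of_ne h, add_zero, Complex.ofReal_re, h,
        if_false]
      nlinarith [sq_nonneg (2 * Real.pi * ξ j)]
  have h2 := Finset.sum_le_sum fun j (_ : j ∈ Finset.univ) => h1 j
  rw [Finset.sum_sub_distrib, ← Finset.mul_sum] at h2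
  simpa [EuclideanSpace.norm_sq_eq] using h2

lemma inner_eq_sum {n : ℕ} (x ξ : E n) : inner ℝ x ξ = ∑ i, x i * ξ i := by
  simp [PiLp.inner_apply, mul_comm]

lemma kern_line {n : ℕ} (i : Fin n) (ζ : ℂ) (ξ x : E n) :
    kern (line i ζ ξ) x
      = Complex.exp (((-2 * Real.pi * inner ℝ x ξ : ℝ) : ℂ) * Complex.I)
        * Complex.exp (-(Complex.I * (x i * ζ))) := by
  unfold kern
  rw [← Complex.exp_add]
  congr 1
  have h1 : ∑ j, (x j : ℂ) * line i ζ ξ j = 2 * Real.pi * ∑ j, (x j : ℂ) * ξ j + x i * ζ := by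
    simp only [line, Pi.add_apply, mul_add, Finset.sum_add_distrib]
    congr 1
    · rw [Finset.mul_sum]
      refine Finset.sum_congr rfl fun j _ => ?_
      simp only [sc]
      push_cast
      ring
    · rw [Finset.sum_eq_single i]
      · simp
      · intro j _ hj
        simp [hj]
      · simp
  rw [h1, inner_eq_sum]
  push_cast
  ring

/-- Restricting the transform to a shifted line is the same as tilting f by an exponential in x_i,
so Plancherel on the line yields exponentially weighted norms of f. -/
lemma fl_line {n : ℕ} (f : E n → ℂ) (i : Fin n) (ζ : ℂ) (ξ : E n) :
    fl f (line i ζ ξ) = 𝓕 (fun x => Complex.exp (-(Complex.I * (x i * ζ))) * f x) ξ := by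
  rw [Real.fourier_eq']
  refine integral_congr_ae (Eventually.of_forall fun x => ?_)
  simp only [kern_line, smul_eq_mul, neg_mul]
  ring

lemma fl_sc {n : ℕ} (f : E n → ℂ) (ξ : E n) : fl f (sc ξ) = 𝓕 f ξ := by
  rcases n with _ | n
  · rw [Real.fourier_eq']
    refine integral_congr_ae (Eventually.of_forall fun x => ?_)
    simp [kern, PiLp.inner_apply]
  · rw [← line_zero 0, fl_line]
    simp

lemma integrable_of_memLp_weight {n : ℕ} [NeZero n] {β : ℝ} (hβ : 0 < β) {f : E n → ℂ}
    (hf : MemLp f 2 (weightMeasure n β)) : Integrable f := by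
  have h := integrable_mul_of_growth hβ
    (hasGrowth_kern (β := β) (z := 0) (by rw [mem_tube]; simp [im1, hβ])) hf
  simpa [kern] using h

lemma one_le_weight {n : ℕ} [NeZero n] (β : ℝ) (x : E n) : 1 ≤ weight β x := by
  calc (1 : ℝ) ≤ Real.cosh (β * x 0) := Real.one_le_cosh _
    _ ≤ weight β x := Finset.single_le_sum (f := fun i => Real.cosh (β * x i))
      (fun _ _ => (Real.cosh_pos _).le) (Finset.mem_univ 0)

lemma memLp_volume_of_memLp_weight {n : ℕ} [NeZero n] {β : ℝ} {f : E n → ℂ}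
    (hf : MemLp f 2 (weightMeasure n β)) : MemLp f 2 volume := by
  rw [memLp_two_iff ((aesm_weight_iff β).1 hf.1)]
  refine lt_of_le_of_lt ?_ ((memLp_two_iff hf.1).1 hf)
  rw [lintegral_weightMeasure]
  refine lintegral_mono fun x => ?_
  calc ‖f x‖ₑ ^ 2 = 1 * ‖f x‖ₑ ^ 2 := (one_mul _).symm
    _ ≤ ENNReal.ofReal (weight β x) * ‖f x‖ₑ ^ 2 := by
      gcongr
      rw [← ENNReal.ofReal_one]
      exact ENNReal.ofReal_le_ofReal (one_le_weight β x)

lemma ae_eq_zero_of_fl_eq_zero {n : ℕ} {f : E n → ℂ} (hf : Integrable f) (hf2 : MemLp f 2)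
    (h : ∀ ξ : E n, fl f (toC ξ) = 0) : f =ᵐ[volume] 0 :=
  ae_eq_zero_of_fourier_eq_zero hf hf2 fun ξ => by rw [← fl_sc, sc_eq_toC, h]

lemma fl_sub {n : ℕ} [NeZero n] {β : ℝ} (hβ : 0 < β) (f g : WSpace n β) {z : Fin n → ℂ}
    (hz : z ∈ tube n β) : fl (f - g : WSpace n β) z = fl f z - fl g z := by
  rw [← flCLM_apply hβ hz, map_sub]
  rfl

/-- An element of `L²(ω)` is determined by its Fourier transform. -/
lemma ext_of_fl {n : ℕ} [NeZero n] {β : ℝ} (hβ : 0 < β) {f g : WSpace n β}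
    (h : ∀ ξ : E n, fl f (toC ξ) = fl g (toC ξ)) : f = g := by
  rw [← sub_eq_zero, Lp.eq_zero_iff_ae_eq_zero, EventuallyEq, ae_weight_iff]
  refine ae_eq_zero_of_fl_eq_zero (integrable_of_memLp_weight hβ (Lp.memLp _))
    (memLp_volume_of_memLp_weight (Lp.memLp _)) fun ξ => ?_
  rw [fl_sub hβ f g (toC_mem_tube hβ ξ), h, sub_self]

/-! ### Gaussian decay and shift of contours -/

/-- Gaussian decay in the real directions, uniformly on closed subtubes. -/
def GaussDecay {n : ℕ} (β : ℝ) (u : (Fin n → ℂ) → ℂ) : Prop :=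
  ∀ s < β / 2, ∃ K κ : ℝ, 0 ≤ K ∧ 0 < κ ∧
    ∀ z, im1 z ≤ s → ‖u z‖ ≤ K * Real.exp (-κ * ∑ i, (z i).re ^ 2)

/-- Growth in the real directions slower than any Gaussian, uniformly on closed subtubes. -/
def SubGauss {n : ℕ} (β : ℝ) (u : (Fin n → ℂ) → ℂ) : Prop :=
  ∀ s < β / 2, ∀ κ > 0, ∃ K : ℝ, 0 ≤ K ∧
    ∀ z, im1 z ≤ s → ‖u z‖ ≤ K * Real.exp (κ * ∑ i, (z i).re ^ 2)

lemma GaussDecay.mul_subGauss {n : ℕ} {β : ℝ} {u m : (Fin n → ℂ) → ℂ} (hu : GaussDecay β u)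
    (hm : SubGauss β m) : GaussDecay β (fun z => m z * u z) := fun s hs => by
  obtain ⟨K, κ, hK, hκ, h1⟩ := hu s hs
  obtain ⟨K', hK', h2⟩ := hm s hs (κ / 2) (by positivity)
  refine ⟨K' * K, κ / 2, by positivity, by positivity, fun z hz => ?_⟩
  rw [norm_mul]
  calc ‖m z‖ * ‖u z‖ ≤ (K' * Real.exp (κ / 2 * ∑ i, (z i).re ^ 2)) *
        (K * Real.exp (-κ * ∑ i, (z i).re ^ 2)) :=
        mul_le_mul (h2 z hz) (h1 z hz) (norm_nonneg _) (by positivity)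
    _ = K' * K * (Real.exp (κ / 2 * ∑ i, (z i).re ^ 2) *
        Real.exp (-κ * ∑ i, (z i).re ^ 2)) := by ring
    _ = _ := by
      rw [← Real.exp_add]
      ring_nf

lemma subGauss_of_bounded {n : ℕ} {β : ℝ} {m : (Fin n → ℂ) → ℂ}
    (h : ∀ s < β / 2, ∃ K : ℝ, ∀ z, im1 z ≤ s → ‖m z‖ ≤ K) : SubGauss β m := fun s hs κ hκ => by
  obtain ⟨K, hK⟩ := h s hs
  refine ⟨|K|, abs_nonneg _, fun z hz => ((hK z hz).trans (le_abs_self K)).trans ?_⟩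
  have h1 : 0 ≤ κ * ∑ i, (z i).re ^ 2 := by positivity
  have h2 := Real.one_le_exp h1
  nlinarith [abs_nonneg K]

lemma GaussDecay.line {n : ℕ} {β : ℝ} {u : (Fin n → ℂ) → ℂ} (hu : GaussDecay β u) {s : ℝ}
    (hs : s < β / 2) (R : ℝ) : ∃ K κ : ℝ, 0 ≤ K ∧ 0 < κ ∧ ∀ i ζ, |ζ.im| ≤ s → |ζ.re| ≤ R →
      ∀ ξ, ‖u (line i ζ ξ)‖ ≤ K * Real.exp (-κ * ‖ξ‖ ^ 2) := by
  obtain ⟨K, κ, hK, hκ, h⟩ := hu s hs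
  refine ⟨K * Real.exp (κ * R ^ 2), κ * (2 * Real.pi ^ 2), by positivity, by positivity,
    fun i ζ hζ hR ξ => (h _ (by rwa [im1_line])).trans ?_⟩
  rw [mul_assoc, ← Real.exp_add]
  refine mul_le_mul_of_nonneg_left (Real.exp_le_exp.2 ?_) hK
  have h1 := sum_re_sq_line_ge i ζ ξ
  have h2 : ζ.re ^ 2 ≤ R ^ 2 := sq_le_sq' (neg_le_of_abs_le hR) (le_of_abs_le hR)
  nlinarith

lemma supNorm_le_norm {n : ℕ} (x : E n) : supNorm x ≤ ‖x‖ :=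
  (pi_norm_le_iff_of_nonneg (norm_nonneg x)).2 fun i => PiLp.norm_apply_le x i

lemma integrable_exp_neg_sq {n : ℕ} {κ : ℝ} (hκ : 0 < κ) :
    Integrable (fun x : E n => Real.exp (-κ * ‖x‖ ^ 2)) := by
  refine ((integrable_growth (n := n) (s := -1) (by norm_num) 0).const_mul
    (Real.exp (1 / (4 * κ)))).mono' (by fun_prop) (Eventually.of_forall fun x => ?_)
  rw [Real.norm_of_nonneg (Real.exp_pos _).le]
  unfold growth
  rw [pow_zero, one_mul, ← Real.exp_add, Real.exp_le_exp]
  have h1 := supNorm_le_norm x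
  have h2 : 1 / (4 * κ) + -1 * ‖x‖ + κ * ‖x‖ ^ 2 = κ * (‖x‖ - 1 / (2 * κ)) ^ 2 := by
    field_simp
    ring
  have h3 : 0 ≤ κ * (‖x‖ - 1 / (2 * κ)) ^ 2 := by positivity
  linarith

lemma integrable_of_gauss {n : ℕ} {v : E n → ℂ} (hv : Continuous v) {K κ : ℝ} (hκ : 0 < κ)
    (h : ∀ ξ, ‖v ξ‖ ≤ K * Real.exp (-κ * ‖ξ‖ ^ 2)) : Integrable v :=
  ((integrable_exp_neg_sq hκ).const_mul K).mono' hv.aestronglyMeasurable (Eventually.of_forall h)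

lemma memLp_of_gauss {n : ℕ} {v : E n → ℂ} (hv : Continuous v) {K κ : ℝ} (hκ : 0 < κ)
    (h : ∀ ξ, ‖v ξ‖ ≤ K * Real.exp (-κ * ‖ξ‖ ^ 2)) : MemLp v 2 volume := by
  rw [memLp_two_iff_integrable_sq_norm hv.aestronglyMeasurable]
  refine ((integrable_exp_neg_sq (n := n) (κ := 2 * κ) (by positivity)).const_mul (K ^ 2)).mono'
    (hv.norm.pow 2).aestronglyMeasurable (Eventually.of_forall fun ξ => ?_)
  rw [Real.norm_of_nonneg (by positivity)]
  calc ‖v ξ‖ ^ 2 ≤ (K * Real.exp (-κ * ‖ξ‖ ^ 2)) ^ 2 :=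
        pow_le_pow_left₀ (norm_nonneg _) (h ξ) 2
    _ = _ := by
      rw [mul_pow, ← Real.exp_nat_mul]
      congr 2
      push_cast
      ring

lemma continuous_comp_line {n : ℕ} {β : ℝ} {u : (Fin n → ℂ) → ℂ} (hu : ContinuousOn u (tube n β))
    (i : Fin n) {ζ : ℂ} (hζ : |ζ.im| < β / 2) : Continuous fun ξ => u (line i ζ ξ) :=
  hu.comp_continuous (continuous_line i ζ) fun ξ => by rwa [mem_tube, im1_line]

lemma differentiableAt_line {n : ℕ} (i : Fin n) (ζ : ℂ) (ξ : E n) :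
    DifferentiableAt ℂ (fun ζ => line i ζ ξ) ζ := by
  unfold line
  refine (differentiableAt_pi.2 fun j => ?_).const_add _
  by_cases h : j = i
  · subst h
    simp
  · simp [h]

lemma differentiableAt_comp_line {n : ℕ} {β : ℝ} {u : (Fin n → ℂ) → ℂ}
    (hu : DifferentiableOn ℂ u (tube n β)) (i : Fin n) {ζ : ℂ} (hζ : |ζ.im| < β / 2) (ξ : E n) :
    DifferentiableAt ℂ (fun ζ => u (line i ζ ξ)) ζ := by
  have h : DifferentiableAt ℂ u (line i ζ ξ) :=
    hu.differentiableAt ((isOpen_tube n β).mem_nhds (by rwa [mem_tube, im1_line]))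
  exact h.comp ζ (differentiableAt_line i ζ ξ)

/-- Cauchy's estimate on circles of radius r converts the Gaussian bound on u into a Gaussian bound
on its derivative in ζ, locally uniformly, which justifies differentiating under the integral. -/
lemma differentiableAt_integral_line {n : ℕ} {β : ℝ} {u : (Fin n → ℂ) → ℂ}
    (hu : DifferentiableOn ℂ u (tube n β)) (hd : GaussDecay β u) (i : Fin n) {ζ₀ : ℂ}
    (hζ : |ζ₀.im| < β / 2) : DifferentiableAt ℂ (fun ζ => ∫ ξ, u (line i ζ ξ)) ζ₀ := by
  obtain ⟨s, hs1, hs2⟩ := exists_between hζ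
  -- Half of the available room: a circle of radius r about a point of the ball of radius r stays
  -- within 2r of ζ₀, hence in the strip |Im| ≤ s.
  set r := (s - |ζ₀.im|) / 2
  have hr : 0 < r := by simp only [r]; linarith
  have hball : ∀ w, dist w ζ₀ ≤ 2 * r → |w.im| ≤ s ∧ |w.re| ≤ |ζ₀.re| + 2 * r := fun w hw => by
    rw [Complex.dist_eq] at hw
    have h1 := (Complex.abs_im_le_norm (w - ζ₀)).trans hw
    have h2 := (Complex.abs_re_le_norm (w - ζ₀)).trans hw
    rw [Complex.sub_im] at h1
    rw [Complex.sub_re] at h2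
    have h3 := abs_sub_abs_le_abs_sub w.im ζ₀.im
    have h4 := abs_sub_abs_le_abs_sub w.re ζ₀.re
    constructor
    · simp only [r] at h1; linarith
    · linarith
  obtain ⟨K, κ, hK, hκ, hb⟩ := hd.line hs2 (|ζ₀.re| + 2 * r)
  have hcont : ∀ w, dist w ζ₀ ≤ 2 * r → Continuous fun ξ => u (line i w ξ) := fun w hw =>
    continuous_comp_line hu.continuousOn i ((hball w hw).1.trans_lt hs2)
  have hdiff : ∀ w, dist w ζ₀ ≤ 2 * r → ∀ ξ, DifferentiableAt ℂ (fun ζ => u (line i ζ ξ)) w :=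
    fun w hw ξ => differentiableAt_comp_line hu i ((hball w hw).1.trans_lt hs2) ξ
  -- The derivative is measurable in ξ as a pointwise limit of continuous difference quotients with
  -- steps r/(k+1).
  have hm' : AEStronglyMeasurable (fun ξ => deriv (fun ζ => u (line i ζ ξ)) ζ₀) volume := by
    have hζk : ∀ k : ℕ, dist (ζ₀ + (r / (k + 1) : ℝ)) ζ₀ ≤ 2 * r := fun k => by
      rw [dist_eq_norm, add_sub_cancel_left, Complex.norm_real, Real.norm_of_nonneg (by positivity),
        div_le_iff₀ (by positivity)]
      nlinarith [(Nat.cast_nonneg k : (0 : ℝ) ≤ k)]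
    refine aestronglyMeasurable_of_tendsto_ae atTop
      (f := fun (k : ℕ) ξ => ((r / (k + 1) : ℝ) : ℂ)⁻¹ •
        (u (line i (ζ₀ + (r / (k + 1) : ℝ)) ξ) - u (line i ζ₀ ξ))) (fun k => ?_)
      (Eventually.of_forall fun ξ => ?_)
    · exact (((hcont _ (hζk k)).sub (hcont ζ₀ (by rw [dist_self]; positivity))).const_smul
        ((r / (k + 1) : ℝ) : ℂ)⁻¹).aestronglyMeasurable
    · have h1 := (hdiff ζ₀ (by rw [dist_self]; positivity) ξ).hasDerivAt.tendsto_slope_zero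
      refine h1.comp (tendsto_nhdsWithin_iff.2 ⟨?_, Eventually.of_forall fun k => ?_⟩)
      · have h2 : Tendsto (fun k : ℕ => r * (1 / ((k : ℝ) + 1))) atTop (𝓝 (r * 0)) :=
          tendsto_one_div_add_atTop_nhds_zero_nat.const_mul r
        rw [mul_zero] at h2
        have h3 := (Complex.continuous_ofReal.tendsto 0).comp h2
        refine h3.congr fun k => ?_
        simp only [Function.comp_apply, mul_one_div]
      · have : r / ((k : ℝ) + 1) ≠ 0 := by positivity
        exact Complex.ofReal_ne_zero.2 this
  have key := hasDerivAt_integral_of_dominated_loc_of_deriv_le (𝕜 := ℂ) (μ := volume)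
    (F := fun ζ ξ => u (line i ζ ξ)) (F' := fun ζ ξ => deriv (fun ζ => u (line i ζ ξ)) ζ)
    (x₀ := ζ₀) (bound := fun ξ => K * Real.exp (-κ * ‖ξ‖ ^ 2) / r) (s := Metric.ball ζ₀ r)
    (Metric.ball_mem_nhds _ hr) ?_ ?_ hm' ?_ ?_ ?_
  · exact key.2.differentiableAt
  · filter_upwards [Metric.ball_mem_nhds ζ₀ hr] with w hw
    exact (hcont w (by rw [Metric.mem_ball] at hw; linarith)).aestronglyMeasurable
  · have h0 : dist ζ₀ ζ₀ ≤ 2 * r := by rw [dist_self]; positivity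
    exact integrable_of_gauss (hcont _ h0) hκ
      fun ξ => hb i _ (hball _ h0).1 (hball _ h0).2 ξ
  · refine Eventually.of_forall fun ξ w hw => ?_
    rw [Metric.mem_ball] at hw
    refine Complex.norm_deriv_le_of_forall_mem_sphere_norm_le hr ?_ fun y hy => ?_
    · refine DifferentiableOn.diffContOnCl fun y hy => ?_
      rw [closure_ball _ hr.ne', Metric.mem_closedBall] at hy
      exact (hdiff y (by linarith [dist_triangle y w ζ₀]) ξ).differentiableWithinAt
    · rw [mem_sphere_iff_norm, ← dist_eq_norm] at hy
      have h1 : dist y ζ₀ ≤ 2 * r := by linarith [dist_triangle y w ζ₀]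
      exact hb i y (hball y h1).1 (hball y h1).2 ξ
  · exact ((integrable_exp_neg_sq hκ).const_mul K).div_const r
  · refine Eventually.of_forall fun ξ w hw => ?_
    rw [Metric.mem_ball] at hw
    exact (hdiff w (by linarith) ξ).hasDerivAt

/-- A real shift of ζ is the translation of ξ by a/(2π) in direction e_i, which Lebesgue measure
ignores. -/
lemma integral_line_add_real {n : ℕ} (u : (Fin n → ℂ) → ℂ) (i : Fin n) (ζ : ℂ) (a : ℝ) :
    ∫ ξ, u (line i (ζ + a) ξ) = ∫ ξ, u (line i ζ ξ) := by
  rw [← integral_add_right_eq_self (fun ξ => u (line i ζ ξ))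
    (EuclideanSpace.single i (a / (2 * Real.pi)))]
  refine integral_congr_ae (Eventually.of_forall fun ξ => ?_)
  simp only
  congr 1
  ext j
  by_cases h : j = i
  · subst h
    simp only [line, sc, Pi.add_apply, Pi.single_eq_same, PiLp.add_apply, PiLp.single_apply,
      if_true]
    have : Real.pi ≠ 0 := Real.pi_ne_zero
    have h2 : 2 * Real.pi * (ξ j + a / (2 * Real.pi)) = 2 * Real.pi * ξ j + a := by field_simp
    rw [h2]
    push_cast
    ring
  · simp [line, sc, h]

/-- Shift of the contour of integration inside the tube. -/
lemma integral_line_eq {n : ℕ} {β : ℝ} {u : (Fin n → ℂ) → ℂ}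
    (hu : DifferentiableOn ℂ u (tube n β)) (hd : GaussDecay β u) (i : Fin n) {σ : ℝ}
    (hσ : |σ| < β / 2) :
    ∫ ξ, u (line i (σ * Complex.I) ξ) = ∫ ξ, u (sc ξ) := by
  set U : Set ℂ := Complex.im ⁻¹' Set.Ioo (-(β / 2)) (β / 2)
  have hU : ∀ ζ : ℂ, ζ ∈ U ↔ |ζ.im| < β / 2 := fun ζ => abs_lt.symm
  have hUo : IsOpen U := isOpen_Ioo.preimage Complex.continuous_im
  have hUc : IsPreconnected U :=
    ((convex_Ioo (-(β / 2)) (β / 2)).linear_preimage Complex.imLm).isPreconnected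
  have h1 : DifferentiableOn ℂ (fun ζ => ∫ ξ, u (line i ζ ξ)) U := fun ζ hζ =>
    (differentiableAt_integral_line hu hd i ((hU ζ).1 hζ)).differentiableWithinAt
  -- The integral is holomorphic in ζ and constant in real directions, so its complex derivative
  -- vanishes on the strip.
  have h2 : U.EqOn (deriv fun ζ => ∫ ξ, u (line i ζ ξ)) 0 := fun ζ hζ => by
    have h3 := (differentiableAt_integral_line hu hd i ((hU ζ).1 hζ)).hasDerivAt
    have h4 : HasDerivAt (fun a : ℝ => ζ + a) 1 0 := by
      simpa using (Complex.ofRealCLM.hasDerivAt (x := (0 : ℝ))).const_add ζ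
    have h5 := HasDerivAt.scomp_of_eq (𝕜' := ℂ) (0 : ℝ) h3 h4 (by simp)
    have h6 : ((fun ζ => ∫ ξ, u (line i ζ ξ)) ∘ fun a : ℝ => ζ + a)
        = fun _ => ∫ ξ, u (line i ζ ξ) := by
      ext a
      exact integral_line_add_real u i ζ a
    rw [h6] at h5
    simpa using h5.unique (hasDerivAt_const _ _)
  have h3 := hUo.is_const_of_deriv_eq_zero hUc h1 h2 (x := σ * Complex.I) (y := 0)
    ((hU _).2 (by simpa using hσ))
    ((hU _).2 (by simpa using (abs_nonneg σ).trans_lt hσ))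
  simpa [line_zero] using h3

/-! ### Line energies and a Paley-Wiener theorem -/

lemma enorm_exp_mul_sq {y σ : ℝ} (w : ℂ) :
    ‖Complex.exp (-(Complex.I * (y * (σ * Complex.I)))) * w‖ₑ ^ 2
      = ENNReal.ofReal (Real.exp (2 * σ * y)) * ‖w‖ₑ ^ 2 := by
  have h : -(Complex.I * (y * (σ * Complex.I))) = ((σ * y : ℝ) : ℂ) := by
    push_cast
    linear_combination (-(y * σ : ℂ)) * Complex.I_mul_I
  rw [h, enorm_mul, mul_pow, ← Complex.ofReal_exp, ← ofReal_norm, Complex.norm_real,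
    Real.norm_of_nonneg (Real.exp_pos _).le, ← ENNReal.ofReal_pow (Real.exp_pos _).le,
    ← Real.exp_nat_mul]
  congr 3
  push_cast
  ring

lemma ofReal_two_mul_cosh (y : ℝ) :
    ENNReal.ofReal (2 * Real.cosh y)
      = ENNReal.ofReal (Real.exp y) + ENNReal.ofReal (Real.exp (-y)) := by
  rw [← ENNReal.ofReal_add (Real.exp_pos _).le (Real.exp_pos _).le, Real.cosh_eq]
  congr 1
  ring

/-- `∫ |u(2πξ + iσ eᵢ)|² dξ + ∫ |u(2πξ - iσ eᵢ)|² dξ`. -/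
def lineEnergy {n : ℕ} (u : (Fin n → ℂ) → ℂ) (i : Fin n) (σ : ℝ) : ENNReal :=
  (∫⁻ ξ, ‖u (line i (σ * Complex.I) ξ)‖ₑ ^ 2) + ∫⁻ ξ, ‖u (line i ((-σ : ℝ) * Complex.I) ξ)‖ₑ ^ 2

/-- The tilts by e^{σx_i} and e^{-σx_i} have squares that add up to 2cosh(2σx_i); this is why an
energy pairs the heights σ and -σ. -/
lemma lintegral_two_cosh_mul {n : ℕ} {g : E n → ℂ} (hg : AEStronglyMeasurable g volume)
    (i : Fin n) (σ : ℝ) :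
    ∫⁻ x, ENNReal.ofReal (2 * Real.cosh (2 * σ * x i)) * ‖g x‖ₑ ^ 2
      = (∫⁻ x, ‖Complex.exp (-(Complex.I * (x i * (σ * Complex.I)))) * g x‖ₑ ^ 2)
        + ∫⁻ x, ‖Complex.exp (-(Complex.I * (x i * ((-σ : ℝ) * Complex.I)))) * g x‖ₑ ^ 2 := by
  have hm : AEMeasurable (fun x : E n =>
      ENNReal.ofReal (Real.exp (2 * σ * x i)) * ‖g x‖ₑ ^ 2) volume := by
    refine AEMeasurable.mul ?_ (hg.enorm.pow_const 2)
    exact (Continuous.measurable (by fun_prop)).ennreal_ofReal.aemeasurable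
  simp_rw [enorm_exp_mul_sq]
  rw [← lintegral_add_left' hm]
  refine lintegral_congr fun x => ?_
  rw [ofReal_two_mul_cosh, add_mul]
  congr 4
  ring

lemma lintegral_weight_mul {n : ℕ} {g : E n → ℂ} (hg : AEStronglyMeasurable g volume) (b : ℝ) :
    ∫⁻ x, ENNReal.ofReal (2 * weight b x) * ‖g x‖ₑ ^ 2
      = ∑ i, ∫⁻ x, ENNReal.ofReal (2 * Real.cosh (b * x i)) * ‖g x‖ₑ ^ 2 := by
  rw [← lintegral_finsetSum' _ fun i _ => ?_]
  · refine lintegral_congr fun x => ?_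
    rw [← Finset.sum_mul, weight, Finset.mul_sum, ENNReal.ofReal_sum_of_nonneg]
    intro i _
    have := Real.cosh_pos (b * x i)
    positivity
  · refine AEMeasurable.mul ?_ (hg.enorm.pow_const 2)
    exact (Continuous.measurable (by fun_prop)).ennreal_ofReal.aemeasurable

lemma lintegral_two_weight {n : ℕ} {β : ℝ} (f : WSpace n β) :
    ∫⁻ x, ENNReal.ofReal (2 * weight β x) * ‖f x‖ₑ ^ 2 = ENNReal.ofReal (2 * ‖f‖ ^ 2) := by
  rw [ENNReal.ofReal_mul zero_le_two, ENNReal.ofReal_pow (norm_nonneg _), ofReal_norm,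
    enorm_sq_Lp, lintegral_weightMeasure, ← lintegral_const_mul' _ _ ENNReal.ofReal_ne_top]
  refine lintegral_congr fun x => ?_
  rw [ENNReal.ofReal_mul zero_le_two, mul_assoc]

lemma exp_le_two_mul_weight {n : ℕ} {β σ : ℝ} (hσ : |σ| ≤ β / 2) (i : Fin n) (x : E n) :
    Real.exp (2 * σ * x i) ≤ 2 * weight β x := by
  have h1 : Real.cosh (β * x i) ≤ weight β x :=
    Finset.single_le_sum (f := fun i => Real.cosh (β * x i))
      (fun _ _ => (Real.cosh_pos _).le) (Finset.mem_univ i)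
  have h2 : Real.cosh (2 * σ * x i) ≤ Real.cosh (β * x i) := by
    rw [Real.cosh_le_cosh, abs_mul, abs_mul, abs_mul, abs_two]
    refine mul_le_mul_of_nonneg_right ?_ (abs_nonneg _)
    exact (by linarith : 2 * |σ| ≤ β).trans (le_abs_self β)
  have h3 := Real.cosh_eq (2 * σ * x i)
  have h4 := Real.exp_pos (-(2 * σ * x i))
  linarith

lemma exp_mul_integrable {n : ℕ} [NeZero n] {β : ℝ} (hβ : 0 < β) {f : E n → ℂ}
    (hf : MemLp f 2 (weightMeasure n β)) (i : Fin n) {σ : ℝ} (hσ : |σ| < β / 2) :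
    Integrable fun x => Complex.exp (-(Complex.I * (x i * (σ * Complex.I)))) * f x := by
  have h0 : Pi.single i (σ * Complex.I) ∈ tube n β := by
    have h := im1_line i (σ * Complex.I) (0 : E n)
    have h2 : line i (σ * Complex.I) (0 : E n) = Pi.single i (σ * Complex.I) := by
      ext j
      simp [line, sc]
    rw [mem_tube, ← h2, h]
    simpa using hσ
  refine (integrable_mul_of_growth hβ (hasGrowth_kern h0) hf).congr
    (Eventually.of_forall fun x => ?_)
  simp only [kern]
  rw [mul_comm, Finset.sum_eq_single i]
  · simp
  · intro j _ hj
    simp [hj]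
  · simp

lemma exp_mul_memLp {n : ℕ} [NeZero n] {β : ℝ} {f : E n → ℂ}
    (hf : MemLp f 2 (weightMeasure n β)) (i : Fin n) {σ : ℝ} (hσ : |σ| ≤ β / 2) :
    MemLp (fun x => Complex.exp (-(Complex.I * (x i * (σ * Complex.I)))) * f x) 2 volume := by
  have hm := (aesm_weight_iff β).1 hf.1
  have hm2 : AEStronglyMeasurable
      (fun x : E n => Complex.exp (-(Complex.I * (x i * (σ * Complex.I)))) * f x) volume :=
    (Continuous.aestronglyMeasurable (by fun_prop)).mul hm
  rw [memLp_two_iff hm2]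
  refine lt_of_le_of_lt (b := 2 * ∫⁻ x, ‖f x‖ₑ ^ 2 ∂(weightMeasure n β)) ?_
    (ENNReal.mul_lt_top ENNReal.ofNat_lt_top ((memLp_two_iff hf.1).1 hf))
  rw [lintegral_weightMeasure, ← lintegral_const_mul' _ _ ENNReal.ofNat_ne_top]
  refine lintegral_mono fun x => ?_
  rw [enorm_exp_mul_sq, ← mul_assoc]
  refine mul_le_mul_left ?_ _
  refine (ENNReal.ofReal_le_ofReal (exp_le_two_mul_weight hσ i x)).trans (le_of_eq ?_)
  rw [ENNReal.ofReal_mul zero_le_two, ENNReal.ofReal_ofNat]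

lemma lineEnergy_fl {n : ℕ} [NeZero n] {β : ℝ} (hβ : 0 < β) {f : E n → ℂ}
    (hf : MemLp f 2 (weightMeasure n β)) (i : Fin n) {σ : ℝ} (hσ : |σ| < β / 2) :
    lineEnergy (fl f) i σ
      = ∫⁻ x, ENNReal.ofReal (2 * Real.cosh (2 * σ * x i)) * ‖f x‖ₑ ^ 2 := by
  have hσ' : |-σ| < β / 2 := by rwa [abs_neg]
  rw [lintegral_two_cosh_mul ((aesm_weight_iff β).1 hf.1), lineEnergy]
  simp_rw [fl_line]
  rw [lintegral_fourier_sq (exp_mul_integrable hβ hf i hσ) (exp_mul_memLp hf i hσ.le),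
    lintegral_fourier_sq (exp_mul_integrable hβ hf i hσ') (exp_mul_memLp hf i hσ'.le)]

/-- Monotonicity of cosh in |2σ_i| ≤ β. The heights may depend on the direction, because the
dilation e^{-tC} shrinks them at different rates. -/
lemma sum_lineEnergy_fl_le {n : ℕ} [NeZero n] {β : ℝ} (hβ : 0 < β) (f : WSpace n β)
    (σ : Fin n → ℝ) (hσ : ∀ i, |σ i| < β / 2) :
    ∑ i, lineEnergy (fl f) i (σ i) ≤ ENNReal.ofReal (2 * ‖f‖ ^ 2) := by
  rw [← lintegral_two_weight, lintegral_weight_mul ((aesm_weight_iff β).1 (Lp.memLp f).1)]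
  refine Finset.sum_le_sum fun i _ => ?_
  rw [lineEnergy_fl hβ (Lp.memLp f) i (hσ i)]
  refine lintegral_mono fun x => ?_
  gcongr
  rw [Real.cosh_le_cosh, abs_mul, abs_mul, abs_mul, abs_two]
  refine mul_le_mul_of_nonneg_right ?_ (abs_nonneg _)
  exact (by linarith [hσ i] : 2 * |σ i| ≤ β).trans (le_abs_self β)

lemma lineEnergy_mono {n : ℕ} {β : ℝ} {u v : (Fin n → ℂ) → ℂ} {B : ℝ}
    (h : ∀ z ∈ tube n β, ‖u z‖ ≤ B * ‖v z‖) (i : Fin n) {σ : ℝ} (hσ : |σ| < β / 2) :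
    lineEnergy u i σ ≤ ENNReal.ofReal (B ^ 2) * lineEnergy v i σ := by
  unfold lineEnergy
  rw [mul_add, ← lintegral_const_mul' _ _ ENNReal.ofReal_ne_top,
    ← lintegral_const_mul' _ _ ENNReal.ofReal_ne_top]
  have key : ∀ z ∈ tube n β, ‖u z‖ₑ ^ 2 ≤ ENNReal.ofReal (B ^ 2) * ‖v z‖ₑ ^ 2 := fun z hz => by
    rw [← ofReal_norm, ← ofReal_norm, ← ENNReal.ofReal_pow (norm_nonneg _),
      ← ENNReal.ofReal_pow (norm_nonneg _), ← ENNReal.ofReal_mul (by positivity), ← mul_pow]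
    exact ENNReal.ofReal_le_ofReal (pow_le_pow_left₀ (norm_nonneg _) (h z hz) 2)
  refine add_le_add (lintegral_mono fun ξ => key _ ?_) (lintegral_mono fun ξ => key _ ?_) <;>
  · rw [mem_tube, im1_line]
    simpa using hσ

lemma differentiableOn_kern {n : ℕ} (x : E n) (U : Set (Fin n → ℂ)) :
    DifferentiableOn ℂ (fun z => kern z x) U := fun z _ =>
  (hasFDerivAt_kern z x).differentiableAt.differentiableWithinAt

lemma subGauss_kern {n : ℕ} (β : ℝ) (x : E n) : SubGauss β (fun z => kern z x) :=
  subGauss_of_bounded fun s _ => ⟨growth s 0 x, fun _ hz => norm_kern_le hz x⟩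

/-- Contour shift applied to z ↦ e^{ix·z}u(z), which inherits the Gaussian decay since the
exponential is bounded on closed subtubes. -/
lemma fourierInv_line {n : ℕ} {β : ℝ} {u : (Fin n → ℂ) → ℂ}
    (hu : DifferentiableOn ℂ u (tube n β)) (hd : GaussDecay β u) (i : Fin n) {σ : ℝ}
    (hσ : |σ| < β / 2) (x : E n) :
    𝓕⁻ (fun ξ => u (line i (σ * Complex.I) ξ)) x
      = Complex.exp (-(Complex.I * (x i * (σ * Complex.I)))) * 𝓕⁻ (fun ξ => u (sc ξ)) x := by
  have h1 := integral_line_eq ((differentiableOn_kern (-x) (tube n β)).mul hu)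
    (hd.mul_subGauss (subGauss_kern β (-x))) i hσ
  have h2 : ∀ ζ : ℂ, ∫ ξ, kern (line i ζ ξ) (-x) * u (line i ζ ξ)
      = Complex.exp (Complex.I * (x i * ζ)) * 𝓕⁻ (fun ξ => u (line i ζ ξ)) x := fun ζ => by
    rw [Real.fourierInv_eq', ← integral_const_mul]
    refine integral_congr_ae (Eventually.of_forall fun ξ => ?_)
    simp only [kern_line, inner_neg_left, PiLp.neg_apply, smul_eq_mul, real_inner_comm ξ x]
    have e1 : -(Complex.I * (((-x i : ℝ) : ℂ) * ζ)) = Complex.I * (x i * ζ) := by push_cast; ring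
    have e2 : -2 * Real.pi * -inner ℝ ξ x = 2 * Real.pi * inner ℝ ξ x := by ring
    rw [e1, e2]
    ring
  have h3 := h2 0
  simp only [line_zero, mul_zero, Complex.exp_zero, one_mul] at h3
  have h4 := h2 (σ * Complex.I)
  simp only [Pi.mul_apply] at h1
  rw [h1, h3] at h4
  rw [h4, ← mul_assoc, ← Complex.exp_add, neg_add_cancel, Complex.exp_zero, one_mul]

lemma weight_tendsto {n : ℕ} (β : ℝ) (x : E n) {b : ℕ → ℝ} (hb : Tendsto b atTop (𝓝 β)) :
    Tendsto (fun k => weight (b k) x) atTop (𝓝 (weight β x)) := by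
  have h : Continuous fun b => weight b x := by
    unfold weight
    fun_prop
  exact (h.tendsto β).comp hb

/-- A function on the tube with Gaussian decay and bounded energy on the boundary is the Fourier
transform of an element of `L²(ω)`. -/
lemma exists_of_lineEnergy {n : ℕ} [NeZero n] {β : ℝ} (hβ : 0 < β) {u : (Fin n → ℂ) → ℂ}
    (hu : DifferentiableOn ℂ u (tube n β)) (hd : GaussDecay β u) {A : ℝ} (hA : 0 ≤ A)
    (hE : ∀ σ, 0 < σ → σ < β / 2 → ∑ i, lineEnergy u i σ ≤ ENNReal.ofReal (2 * A ^ 2)) :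
    ∃ g : WSpace n β, ‖g‖ ≤ A ∧ (∀ ξ, fl g (toC ξ) = u (toC ξ)) ∧
      g =ᵐ[volume] 𝓕⁻ (fun ξ => u (sc ξ)) := by
  have hcont : ∀ i (σ : ℝ), |σ| < β / 2 → Continuous fun ξ => u (line i (σ * Complex.I) ξ) :=
    fun i σ hσ => continuous_comp_line hu.continuousOn i (by simpa using hσ)
  have hint : ∀ i (σ : ℝ), |σ| < β / 2 → Integrable (fun ξ => u (line i (σ * Complex.I) ξ)) ∧
      MemLp (fun ξ => u (line i (σ * Complex.I) ξ)) 2 volume := fun i σ hσ => by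
    obtain ⟨K, κ, -, hκ, h⟩ := hd.line hσ 0
    have h' := h i (σ * Complex.I) (by simp) (by simp)
    exact ⟨integrable_of_gauss (hcont i σ hσ) hκ h', memLp_of_gauss (hcont i σ hσ) hκ h'⟩
  have hv0 : |(0 : ℝ)| < β / 2 := by simpa using hβ
  have hvc : Continuous fun ξ : E n => u (sc ξ) := by simpa [line_zero] using hcont 0 0 hv0
  have hvi : Integrable fun ξ : E n => u (sc ξ) := by simpa [line_zero] using (hint 0 0 hv0).1
  set g₀ := 𝓕⁻ (fun ξ : E n => u (sc ξ)) with hg₀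
  have hgF : ∀ x, g₀ x = 𝓕 (fun ξ : E n => u (sc ξ)) (-x) := fun x =>
    Real.fourierInv_eq_fourier_neg _ _
  have hgc : Continuous g₀ := by
    have h : g₀ = fun x => 𝓕 (fun ξ : E n => u (sc ξ)) (-x) := funext hgF
    rw [h]
    exact (continuous_fourier_of_integrable hvi).comp continuous_neg
  -- Plancherel on each line, read backwards: the energies of u at height σ are the norm of g₀ with
  -- weight parameter 2σ in place of β.
  have hEg : ∀ σ, 0 < σ → σ < β / 2 →
      ∫⁻ x, ENNReal.ofReal (2 * weight (2 * σ) x) * ‖g₀ x‖ₑ ^ 2 ≤ ENNReal.ofReal (2 * A ^ 2) := by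
    intro σ h0 hσ
    have h1 : |σ| < β / 2 := by rwa [abs_of_pos h0]
    have h2 : |-σ| < β / 2 := by rwa [abs_neg]
    refine le_trans (le_of_eq ?_) (hE σ h0 hσ)
    rw [lintegral_weight_mul hgc.aestronglyMeasurable]
    refine Finset.sum_congr rfl fun i _ => ?_
    rw [lintegral_two_cosh_mul hgc.aestronglyMeasurable, lineEnergy]
    rw [← lintegral_fourierInv_sq (hint i σ h1).1 (hint i σ h1).2,
      ← lintegral_fourierInv_sq (hint i (-σ) h2).1 (hint i (-σ) h2).2]
    simp_rw [fourierInv_line hu hd i h1, fourierInv_line hu hd i h2, ← hg₀]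
  -- Fatou's lemma along heights increasing to β/2 reaches the full weight without any boundary
  -- values of u.
  have hfin : ∫⁻ x, ENNReal.ofReal (2 * weight β x) * ‖g₀ x‖ₑ ^ 2 ≤ ENNReal.ofReal (2 * A ^ 2) := by
    set s : ℕ → ℝ := fun k => β / 2 * (1 - 1 / ((k : ℝ) + 2)) with hs
    have hs0 : ∀ k, 0 < s k := fun k => by
      have : 1 / ((k : ℝ) + 2) < 1 := by
        rw [div_lt_one (by positivity)]; linarith [(Nat.cast_nonneg k : (0 : ℝ) ≤ k)]
      exact mul_pos (by linarith) (by linarith)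
    have hs1 : ∀ k, s k < β / 2 := fun k => by
      have : 0 < 1 / ((k : ℝ) + 2) := by positivity
      simp only [hs]
      nlinarith
    have hlim : Tendsto (fun k => 2 * s k) atTop (𝓝 β) := by
      have h1 : Tendsto (fun k : ℕ => 1 / ((k : ℝ) + 2)) atTop (𝓝 0) :=
        tendsto_const_nhds.div_atTop
          (tendsto_atTop_add_const_right _ _ tendsto_natCast_atTop_atTop)
      have h2 : Tendsto (fun k : ℕ => 2 * (β / 2 * (1 - 1 / ((k : ℝ) + 2)))) atTop
          (𝓝 (2 * (β / 2 * (1 - 0)))) := ((h1.const_sub 1).const_mul _).const_mul _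
      convert h2 using 2
      ring
    have hpt : ∀ x, ENNReal.ofReal (2 * weight β x) * ‖g₀ x‖ₑ ^ 2
        = liminf (fun k => ENNReal.ofReal (2 * weight (2 * s k) x) * ‖g₀ x‖ₑ ^ 2) atTop := by
      intro x
      refine (Tendsto.liminf_eq ?_).symm
      refine ENNReal.Tendsto.mul_const ?_ (Or.inr (by simp))
      exact ENNReal.tendsto_ofReal ((weight_tendsto β x hlim).const_mul 2)
    calc ∫⁻ x, ENNReal.ofReal (2 * weight β x) * ‖g₀ x‖ₑ ^ 2
        = ∫⁻ x, liminf (fun k => ENNReal.ofReal (2 * weight (2 * s k) x) * ‖g₀ x‖ₑ ^ 2) atTop :=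
          lintegral_congr hpt
      _ ≤ liminf (fun k => ∫⁻ x, ENNReal.ofReal (2 * weight (2 * s k) x) * ‖g₀ x‖ₑ ^ 2) atTop := by
          refine lintegral_liminf_le fun k => ?_
          exact ((measurable_weight _).const_mul 2).ennreal_ofReal.mul (hgc.measurable.enorm.pow_const 2)
      _ ≤ ENNReal.ofReal (2 * A ^ 2) := by
          refine liminf_le_of_frequently_le' (Frequently.of_forall fun k => ?_)
          exact hEg (s k) (hs0 k) (hs1 k)
  have hmem : MemLp g₀ 2 (weightMeasure n β) := by
    rw [memLp_two_iff hgc.aestronglyMeasurable, lintegral_weightMeasure]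
    refine lt_of_le_of_lt (lintegral_mono fun x => ?_) (hfin.trans_lt ENNReal.ofReal_lt_top)
    gcongr
    linarith [weight_pos β x]
  have hae : (hmem.toLp g₀ : WSpace n β) =ᵐ[volume] g₀ := (ae_weight_iff β).1 hmem.coeFn_toLp
  refine ⟨hmem.toLp g₀, ?_, fun ξ => ?_, hae⟩
  · have h1 := lintegral_two_weight (hmem.toLp g₀)
    rw [lintegral_congr_ae (g := fun x => ENNReal.ofReal (2 * weight β x) * ‖g₀ x‖ₑ ^ 2)
      (hae.mono fun x hx => by simp only [hx])] at h1
    rw [h1, ENNReal.ofReal_le_ofReal_iff (by positivity)] at hfin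
    exact le_of_sq_le_sq (by linarith) hA
  · have h1 : toC ξ = sc ((2 * Real.pi)⁻¹ • ξ) := by
      rw [sc_eq_toC, smul_smul, mul_inv_cancel₀ Real.two_pi_pos.ne', one_smul]
    -- Fourier inversion needs an integrable transform; this holds because g₀ lies in L²(ω), which
    -- is contained in L¹.
    have h2 : Integrable (𝓕 fun ξ : E n => u (sc ξ)) := by
      have h3 := (integrable_of_memLp_weight hβ hmem).comp_neg
      simpa [hgF] using h3
    rw [h1, fl_sc, Real.fourier_congr_ae hae, hg₀, hvc.fourier_fourierInv_eq hvi h2]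

/-! ### Complex Gaussians and Fourier multipliers -/

/-- The Gaussian `exp (-∑ᵢ τᵢ zᵢ²)`. -/
def gs {n : ℕ} (τ : Fin n → ℝ) (z : Fin n → ℂ) : ℂ := Complex.exp (-∑ i, (τ i : ℂ) * z i ^ 2)

lemma differentiable_gs {n : ℕ} (τ : Fin n → ℝ) : Differentiable ℂ (gs τ) := by
  unfold gs
  fun_prop

lemma sum_im_sq_le {n : ℕ} (z : Fin n → ℂ) : ∑ i, (z i).im ^ 2 ≤ im1 z ^ 2 := by
  have h := Finset.sum_sq_le_sq_sum_of_nonneg (s := Finset.univ) (f := fun i => |(z i).im|)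
    (fun _ _ => abs_nonneg _)
  simpa [im1] using h

lemma norm_gs_le {n : ℕ} {τ : Fin n → ℝ} {κ T : ℝ} (hT : 0 ≤ T) (h1 : ∀ i, κ ≤ τ i)
    (h2 : ∀ i, τ i ≤ T) {z : Fin n → ℂ} {s : ℝ} (hz : im1 z ≤ s) :
    ‖gs τ z‖ ≤ Real.exp (T * s ^ 2) * Real.exp (-κ * ∑ i, (z i).re ^ 2) := by
  unfold gs
  rw [Complex.norm_exp, ← Real.exp_add, Real.exp_le_exp]
  have h3 : (-∑ i, (τ i : ℂ) * z i ^ 2).re = ∑ i, (τ i * (z i).im ^ 2 - τ i * (z i).re ^ 2) := by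
    rw [Complex.neg_re, Complex.re_sum, ← Finset.sum_neg_distrib]
    refine Finset.sum_congr rfl fun i _ => ?_
    rw [Complex.re_ofReal_mul, sq, Complex.mul_re]
    ring
  rw [h3, Finset.sum_sub_distrib]
  have h4 : ∑ i, τ i * (z i).im ^ 2 ≤ T * s ^ 2 := by
    calc ∑ i, τ i * (z i).im ^ 2 ≤ ∑ i, T * (z i).im ^ 2 :=
          Finset.sum_le_sum fun i _ => mul_le_mul_of_nonneg_right (h2 i) (sq_nonneg _)
      _ = T * ∑ i, (z i).im ^ 2 := by rw [Finset.mul_sum]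
      _ ≤ T * s ^ 2 := by
        refine mul_le_mul_of_nonneg_left ((sum_im_sq_le z).trans ?_) hT
        exact pow_le_pow_left₀ (im1_nonneg z) hz 2
  have h5 : κ * ∑ i, (z i).re ^ 2 ≤ ∑ i, τ i * (z i).re ^ 2 := by
    rw [Finset.mul_sum]
    exact Finset.sum_le_sum fun i _ => mul_le_mul_of_nonneg_right (h1 i) (sq_nonneg _)
  linarith

lemma gaussDecay_gs {n : ℕ} (β : ℝ) {τ : Fin n → ℝ} (hτ : ∀ i, 0 < τ i) :
    GaussDecay β (gs τ) := fun s _ => by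
  obtain ⟨T, hT⟩ : ∃ T, ∀ i, τ i ≤ T := ⟨∑ i, τ i, fun i =>
    Finset.single_le_sum (f := τ) (fun i _ => (hτ i).le) (Finset.mem_univ i)⟩
  obtain ⟨κ, hκ, h⟩ : ∃ κ > 0, ∀ i, κ ≤ τ i := by
    rcases n with _ | n
    · exact ⟨1, one_pos, fun i => i.elim0⟩
    · obtain ⟨i, -, hi⟩ := Finset.exists_min_image Finset.univ τ Finset.univ_nonempty
      exact ⟨τ i, hτ i, fun j => hi j (Finset.mem_univ j)⟩
  exact ⟨_, κ, (Real.exp_pos _).le, hκ, fun z hz =>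
    norm_gs_le (le_max_right T 0) h (fun i => (hT i).trans (le_max_left T 0)) hz⟩

/-- A bounded operator on `L²(ω)` from its action on Fourier transforms. -/
lemma exists_clm_of_fl {n : ℕ} [NeZero n] {β : ℝ} (hβ : 0 < β) (a : E n → ℂ) (b : E n → Fin n → ℂ)
    (hb : ∀ ξ, b ξ ∈ tube n β) {A : ℝ}
    (h : ∀ f : WSpace n β, ∃ g : WSpace n β, ‖g‖ ≤ A * ‖f‖ ∧
      ∀ ξ, fl g (toC ξ) = a ξ * fl f (b ξ)) :
    ∃ T : WSpace n β →L[ℂ] WSpace n β, (∀ f, ‖T f‖ ≤ A * ‖f‖) ∧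
      ∀ f ξ, fl (T f) (toC ξ) = a ξ * fl f (b ξ) := by
  choose T hT1 hT2 using h
  have hz := fun ξ : E n => toC_mem_tube hβ ξ
  -- Linearity of the chosen map is automatic, since an element is determined by its transform at
  -- real frequencies.
  let T' : WSpace n β →ₗ[ℂ] WSpace n β :=
    { toFun := T
      map_add' := fun f g => by
        refine ext_of_fl hβ fun ξ => ?_
        rw [hT2, ← flCLM_apply hβ (hb ξ), ← flCLM_apply hβ (hz ξ), map_add, map_add, flCLM_apply,
          flCLM_apply, flCLM_apply, flCLM_apply, hT2, hT2, mul_add]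
      map_smul' := fun r f => by
        refine ext_of_fl hβ fun ξ => ?_
        rw [hT2, ← flCLM_apply hβ (hb ξ), ← flCLM_apply hβ (hz ξ), RingHom.id_apply, map_smul,
          map_smul, flCLM_apply, flCLM_apply, hT2, smul_eq_mul, smul_eq_mul]
        ring }
  exact ⟨T'.mkContinuous A hT1, hT1, hT2⟩

lemma subGauss_fl {n : ℕ} [NeZero n] {β : ℝ} (hβ : 0 < β) (f : WSpace n β) :
    SubGauss β (fl f) :=
  subGauss_of_bounded fun _ hs => ⟨_, fun _ hz => norm_fl_le hβ hs hz f⟩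

/-- Bounded analytic functions on the tube are Fourier multipliers. -/
lemma exists_mulOp {n : ℕ} [NeZero n] {β : ℝ} (hβ : 0 < β) {m : (Fin n → ℂ) → ℂ}
    (hm : DifferentiableOn ℂ m (tube n β)) {M : ℝ} (hM : ∀ z ∈ tube n β, ‖m z‖ ≤ M) :
    ∃ T : WSpace n β →L[ℂ] WSpace n β, (∀ f, ‖T f‖ ≤ 2 * M * ‖f‖) ∧
      ∀ f ξ, fl (T f) (toC ξ) = m (toC ξ) * fl f (toC ξ) := by
  refine exists_clm_of_fl hβ (fun ξ => m (toC ξ)) toC (toC_mem_tube hβ) fun f => ?_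
  have hM0 : 0 ≤ M := (norm_nonneg _).trans (hM 0 (by rw [mem_tube]; simp [im1, hβ]))
  -- The product m f̂ need not have Gaussian decay. The factor exp(-δ∑z_i²) supplies it and costs at
  -- most e^{δ(β/2)²} on the tube.
  have hex : ∀ δ : ℝ, 0 < δ → ∃ g : WSpace n β,
      ‖g‖ ≤ Real.exp (δ * (β / 2) ^ 2) * M * ‖f‖ ∧
      ∀ ξ, fl g (toC ξ) = m (toC ξ) * (fl f (toC ξ) * gs (fun _ => δ) (toC ξ)) := fun δ hδ => by
    have hmS : SubGauss β m := subGauss_of_bounded fun s hs => ⟨M, fun z hz => hM z (hz.trans_lt hs)⟩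
    have hd := ((gaussDecay_gs β (τ := fun _ : Fin n => δ) fun _ => hδ).mul_subGauss
      (subGauss_fl hβ f)).mul_subGauss hmS
    have hdiff := hm.mul ((differentiableOn_fl hβ (Lp.memLp f)).mul
      (differentiable_gs (fun _ : Fin n => δ)).differentiableOn)
    obtain ⟨g, hg1, hg2, -⟩ := exists_of_lineEnergy hβ hdiff hd
      (A := Real.exp (δ * (β / 2) ^ 2) * M * ‖f‖) (by positivity) fun σ h0 hσ => by
        have hσ' : |σ| < β / 2 := by rwa [abs_of_pos h0]
        calc ∑ i, lineEnergy (m * (fl f * gs fun _ : Fin n => δ)) i σ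
            ≤ ∑ i, ENNReal.ofReal ((Real.exp (δ * (β / 2) ^ 2) * M) ^ 2) * lineEnergy (fl f) i σ := by
              refine Finset.sum_le_sum fun i _ => lineEnergy_mono (fun z hz => ?_) i hσ'
              have h1 := norm_gs_le (τ := fun _ : Fin n => δ) hδ.le (fun _ => hδ.le)
                (fun _ => le_rfl) (mem_tube.1 hz).le
              have h3 : ‖gs (fun _ : Fin n => δ) z‖ ≤ Real.exp (δ * (β / 2) ^ 2) := by
                simpa using h1
              simp only [Pi.mul_apply, norm_mul]
              calc ‖m z‖ * (‖fl f z‖ * ‖gs (fun _ : Fin n => δ) z‖)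
                  ≤ M * (‖fl f z‖ * Real.exp (δ * (β / 2) ^ 2)) := by
                    gcongr
                    exact hM z hz
                _ = _ := by ring
          _ ≤ ENNReal.ofReal ((Real.exp (δ * (β / 2) ^ 2) * M) ^ 2)
                * ENNReal.ofReal (2 * ‖f‖ ^ 2) := by
              rw [← Finset.mul_sum]
              gcongr
              exact sum_lineEnergy_fl_le hβ f (fun _ => σ) fun _ => hσ'
          _ = _ := by
              rw [← ENNReal.ofReal_mul (by positivity)]
              congr 1
              ring
    exact ⟨g, hg1, fun ξ => by rw [hg2]; rfl⟩
  choose! g hg1 hg2 using hex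
  have hδ : Tendsto (fun δ : ℝ => δ) (𝓝[>] 0) (𝓝 0) := tendsto_nhdsWithin_of_tendsto_nhds tendsto_id
  -- The factor 2 is only slack: e^{δ(β/2)²} tends to 1, so it is eventually at most 2.
  have hbd : ∀ᶠ δ in 𝓝[>] (0 : ℝ), ‖g δ‖ ≤ 2 * M * ‖f‖ := by
    have h1 : Tendsto (fun δ : ℝ => Real.exp (δ * (β / 2) ^ 2)) (𝓝[>] 0) (𝓝 1) := by
      have h2 : Tendsto (fun δ : ℝ => Real.exp (δ * (β / 2) ^ 2)) (𝓝[>] 0)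
          (𝓝 (Real.exp (0 * (β / 2) ^ 2))) :=
        (Real.continuous_exp.tendsto _).comp (hδ.mul_const _)
      simpa using h2
    filter_upwards [h1.eventually_le_const (show (1 : ℝ) < 2 by norm_num), self_mem_nhdsWithin]
      with δ h2 h3
    refine (hg1 δ h3).trans ?_
    gcongr
  have hlim : ∀ ξ : E n, Tendsto (fun δ => flCLM hβ (toC_mem_tube hβ ξ) (g δ)) (𝓝[>] 0)
      (𝓝 (m (toC ξ) * fl f (toC ξ))) := fun ξ => by
    have h1 : Tendsto (fun δ : ℝ => gs (fun _ : Fin n => δ) (toC ξ)) (𝓝[>] 0) (𝓝 1) := by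
      have h2 : Continuous fun δ : ℝ => gs (fun _ : Fin n => δ) (toC ξ) := by
        unfold gs
        fun_prop
      have h3 : Tendsto (fun δ : ℝ => gs (fun _ : Fin n => δ) (toC ξ)) (𝓝[>] 0)
          (𝓝 (gs (fun _ : Fin n => 0) (toC ξ))) := (h2.tendsto 0).comp hδ
      simpa [gs] using h3
    have h4 := ((h1.const_mul (fl f (toC ξ))).const_mul (m (toC ξ)))
    rw [mul_one] at h4
    refine h4.congr' ?_
    filter_upwards [self_mem_nhdsWithin] with δ h5
    rw [flCLM_apply, hg2 δ h5]
  obtain ⟨h, h1, h2⟩ := exists_of_tendsto_functionals _ _ g hbd hlim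
  exact ⟨h, h1, h2⟩

/-- Linear change of variables with determinant ∏ a_i; it supplies the Jacobian of e^{-tC} in the
energy estimates. -/
lemma lintegral_comp_diag {n : ℕ} {a : Fin n → ℝ} (ha : ∀ i, 0 < a i) {h : E n → ENNReal}
    (hh : Measurable h) :
    ∫⁻ ξ : E n, h (WithLp.toLp 2 fun i => a i * ξ i) = ENNReal.ofReal (∏ i, a i)⁻¹ * ∫⁻ ξ, h ξ := by
  classical
  have hdet : Matrix.det (Matrix.diagonal a) ≠ 0 := by
    rw [Matrix.det_diagonal]
    exact Finset.prod_ne_zero_iff.2 fun i _ => (ha i).ne'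
  have hp : 0 < ∏ i, a i := Finset.prod_pos fun i _ => ha i
  have h1 := Real.smul_map_diagonal_volume_pi hdet
  rw [Matrix.det_diagonal, abs_of_pos hp] at h1
  set F : (Fin n → ℝ) → ENNReal := fun y => h (WithLp.toLp 2 y)
  have hF : Measurable F := hh.comp (by fun_prop)
  have hL : Measurable (Matrix.toLin' (Matrix.diagonal a)) :=
    (LinearMap.continuous_of_finiteDimensional _).measurable
  have h2 : ∫⁻ y : Fin n → ℝ, F y = ENNReal.ofReal (∏ i, a i) * ∫⁻ y : Fin n → ℝ, F (fun i => a i * y i) := by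
    conv_lhs => rw [← h1]
    rw [lintegral_smul_measure, lintegral_map hF hL, smul_eq_mul]
    congr 1
    refine lintegral_congr fun y => ?_
    congr 1
    ext i
    simp [Matrix.mulVec_diagonal]
  have h3 := (EuclideanSpace.volume_preserving_symm_measurableEquiv_toLp (Fin n))
  have h4 : ∫⁻ ξ : E n, h ξ = ∫⁻ y : Fin n → ℝ, F y := by
    rw [← h3.lintegral_comp hF]
    rfl
  have h5 : ∫⁻ ξ : E n, h (WithLp.toLp 2 fun i => a i * ξ i)
      = ∫⁻ y : Fin n → ℝ, F (fun i => a i * y i) := by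
    rw [← h3.lintegral_comp (f := fun y : Fin n → ℝ => F (fun i => a i * y i)) (hF.comp (by fun_prop))]
    rfl
  rw [h5, h4, h2, ← mul_assoc, ← ENNReal.ofReal_mul (inv_nonneg.2 hp.le), inv_mul_cancel₀ hp.ne',
    ENNReal.ofReal_one, one_mul]

/-! ### The differential expression and its symbol -/

/-- The `i`-th partial derivative. -/
def pd {n : ℕ} (i : Fin n) (φ : E n → ℂ) (x : E n) : ℂ :=
  fderiv ℝ φ x (EuclideanSpace.single i 1)

lemma laplacian_eq_sum_pd {n : ℕ} {φ : E n → ℂ} (hφ : ContDiff ℝ 2 φ) (x : E n) :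
    (Δ φ) x = ∑ i, pd i (pd i φ) x := by
  rw [InnerProductSpace.laplacian_eq_iteratedFDeriv_orthonormalBasis φ
    (EuclideanSpace.basisFun (Fin n) ℝ)]
  refine Finset.sum_congr rfl fun i _ => ?_
  have h1 : DifferentiableAt ℝ (fderiv ℝ φ) x :=
    (hφ.fderiv_right (m := 1) (by norm_num)).differentiable one_ne_zero x
  rw [iteratedFDeriv_two_apply]
  unfold pd
  rw [fderiv_clm_apply h1 (differentiableAt_const _)]
  simp

lemma fpExpr_eq {n : ℕ} (c : Fin n → ℝ) {φ : E n → ℂ} (hφ : ContDiff ℝ 2 φ) (x : E n) :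
    fpExpr c φ x = ∑ i, pd i (pd i φ) x + ∑ i, (c i : ℂ) * ((x i : ℂ) * pd i φ x + φ x) := by
  simp only [fpExpr, laplacian_eq_sum_pd hφ, mul_add, Finset.sum_add_distrib, ← Finset.sum_mul,
    ← add_assoc]
  push_cast
  simp only [mul_assoc, pd]

lemma contDiff_pd {n : ℕ} {φ : E n → ℂ} {k : ℕ} (hφ : ContDiff ℝ (k + 1 : ℕ) φ) (i : Fin n) :
    ContDiff ℝ k (pd i φ) := by
  have h : ContDiff ℝ k (fderiv ℝ φ) := hφ.fderiv_right (by norm_cast)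
  exact h.clm_apply contDiff_const

lemma fderiv_kern {n : ℕ} (z : Fin n → ℂ) (x v : E n) :
    DifferentiableAt ℝ (kern z) x ∧
      fderiv ℝ (kern z) x v = kern z x * (-(Complex.I * ∑ i, (v i : ℂ) * z i)) := by
  have h1 : ∀ i, HasFDerivAt (fun x : E n => (x i : ℂ))
      (Complex.ofRealCLM ∘L (EuclideanSpace.proj i : E n →L[ℝ] ℝ)) x := fun i =>
    (Complex.ofRealCLM ∘L (EuclideanSpace.proj i : E n →L[ℝ] ℝ)).hasFDerivAt
  have h2 := ((HasFDerivAt.fun_sum (u := Finset.univ) fun i _ =>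
    (h1 i).mul_const (z i)).const_mul Complex.I).neg.cexp
  refine ⟨h2.differentiableAt, ?_⟩
  have h3 := h2.fderiv
  change fderiv ℝ (kern z) x = _ at h3
  rw [h3]
  simp only [kern, smul_apply, neg_apply, sum_apply, ContinuousLinearMap.comp_apply,
    smul_eq_mul, Complex.ofRealCLM_apply]
  congr 3
  exact Finset.sum_congr rfl fun i _ => mul_comm _ _

lemma integral_pd_mul_kern {n : ℕ} {h : E n → ℂ} (hd : Differentiable ℝ h) (i : Fin n)
    (z : Fin n → ℂ) (h1 : Integrable fun x => h x * kern z x)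
    (h2 : Integrable fun x => pd i h x * kern z x) :
    ∫ x, pd i h x * kern z x = Complex.I * z i * ∫ x, h x * kern z x := by
  have h3 : ∀ x, fderiv ℝ (kern z) x (EuclideanSpace.single i 1) = -(Complex.I * z i) * kern z x :=
    fun x => by
      rw [(fderiv_kern z x _).2, Finset.sum_eq_single i]
      · simp; ring
      · intro j _ hj
        simp [hj]
      · simp
  have h4 : (fun x => h x * fderiv ℝ (kern z) x (EuclideanSpace.single i 1))
      = fun x => -(Complex.I * z i) * (h x * kern z x) := by
    ext x
    rw [h3]
    ring
  have h5 := integral_mul_fderiv_eq_neg_fderiv_mul_of_integrable (μ := volume) (𝕜 := ℂ)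
    (f := h) (g := kern z) (v := EuclideanSpace.single i 1) h2 (h4 ▸ h1.const_mul _) h1
    (fun x _ => hd x) (fun x _ => (fderiv_kern z x 0).1)
  rw [h4, integral_const_mul] at h5
  have h6 : ∫ x, pd i h x * kern z x
      = ∫ x, fderiv ℝ h x (EuclideanSpace.single i 1) * kern z x := rfl
  rw [h6]
  linear_combination h5

lemma hasGrowth_coord_mul_kern {n : ℕ} {β : ℝ} {z : Fin n → ℂ} (hz : z ∈ tube n β) (i : Fin n) :
    HasGrowth β fun x => (x i : ℂ) * kern z x := by
  refine ⟨(Continuous.mul (by fun_prop) (continuous_kern z)), im1 z, hz, 1, 1, zero_le_one,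
    fun x => ?_⟩
  rw [norm_mul, one_mul, Complex.norm_real]
  have h1 := norm_kern_le (le_refl (im1 z)) x
  have h2 := PiLp.norm_apply_le x i
  calc ‖x i‖ * ‖kern z x‖ ≤ (1 + ‖x‖) * growth (im1 z) 0 x := by gcongr; linarith
    _ = _ := by unfold growth; ring

/-- Twice continuously differentiable functions that lie in `L²(ω)` with their first and
second derivatives. -/
structure WSobolev {n : ℕ} (β : ℝ) (φ : E n → ℂ) : Prop where
  contDiff : ContDiff ℝ 2 φ
  memLp : MemLp φ 2 (weightMeasure n β)
  memLp_pd : ∀ i, MemLp (pd i φ) 2 (weightMeasure n β)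
  memLp_pd_pd : ∀ i, MemLp (pd i (pd i φ)) 2 (weightMeasure n β)

lemma pd_coord_mul {n : ℕ} {φ : E n → ℂ} (hφ : Differentiable ℝ φ) (i : Fin n) (x : E n) :
    pd i (fun x => (x i : ℂ) * φ x) x = (x i : ℂ) * pd i φ x + φ x := by
  have h1 : HasFDerivAt (fun x : E n => (x i : ℂ))
      (Complex.ofRealCLM ∘L (EuclideanSpace.proj i : E n →L[ℝ] ℝ)) x :=
    (Complex.ofRealCLM ∘L (EuclideanSpace.proj i : E n →L[ℝ] ℝ)).hasFDerivAt
  unfold pd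
  rw [(h1.fun_mul (hφ x).hasFDerivAt).fderiv]
  simp

/-- The symbol of the Fokker-Planck operator: `f̂ ↦ -|ξ|² f̂ - Cξ·∇f̂`. -/
def fpSymbol {n : ℕ} (c : Fin n → ℝ) (f : E n → ℂ) (ξ : E n) : ℂ :=
  -(∑ i, (ξ i : ℂ) ^ 2) * fl f (toC ξ) - dfl f (toC ξ) (fun i => (c i : ℂ) * (ξ i : ℂ))

lemma WSobolev.integrable_terms {n : ℕ} [NeZero n] {β : ℝ} (hβ : 0 < β) {φ : E n → ℂ}
    (h : WSobolev β φ) {z : Fin n → ℂ} (hz : z ∈ tube n β) (i : Fin n) :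
    Integrable (fun x => pd i (pd i φ) x * kern z x) ∧
      Integrable (fun x => ((x i : ℂ) * pd i φ x + φ x) * kern z x) ∧
      Integrable (fun x => (x i : ℂ) * φ x * kern z x) := by
  refine ⟨integrable_mul_of_growth hβ (hasGrowth_kern hz) (h.memLp_pd_pd i), ?_, ?_⟩
  · refine ((integrable_mul_of_growth hβ (hasGrowth_coord_mul_kern hz i) (h.memLp_pd i)).add
      (integrable_mul_of_growth hβ (hasGrowth_kern hz) h.memLp)).congr
      (Eventually.of_forall fun x => ?_)
    simp only [Pi.add_apply]
    ring
  · refine (integrable_mul_of_growth hβ (hasGrowth_coord_mul_kern hz i) h.memLp).congr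
      (Eventually.of_forall fun x => ?_)
    simp only
    ring

/-- The trace term completes c_i x_i∂_iφ to c_i ∂_i(x_iφ). Integration by parts then replaces ∂_i by
iξ_i, and multiplication by x_i becomes a derivative of the transform. -/
lemma WSobolev.fl_fpExpr {n : ℕ} [NeZero n] {β : ℝ} (hβ : 0 < β) {φ : E n → ℂ}
    (h : WSobolev β φ) (c : Fin n → ℝ) (ξ : E n) :
    fl (fpExpr c φ) (toC ξ) = fpSymbol c φ ξ := by
  have hz := toC_mem_tube hβ ξ
  have hφd : Differentiable ℝ φ := h.contDiff.differentiable (by norm_num)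
  have hpd : ∀ i, Differentiable ℝ (pd i φ) := fun i =>
    (contDiff_pd (k := 1) (by exact_mod_cast h.contDiff) i).differentiable (by norm_num)
  have hI := fun i => integrable_mul_of_growth hβ (hasGrowth_kern hz) (h.memLp_pd i)
  have h0 := integrable_mul_of_growth hβ (hasGrowth_kern hz) h.memLp
  have h1 : fl (fpExpr c φ) (toC ξ) = (∑ i, ∫ x, pd i (pd i φ) x * kern (toC ξ) x)
      + ∑ i, (c i : ℂ) * ∫ x, ((x i : ℂ) * pd i φ x + φ x) * kern (toC ξ) x := by
    simp_rw [← integral_const_mul]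
    rw [← integral_finsetSum _ fun i _ => (h.integrable_terms hβ hz i).1,
      ← integral_finsetSum _ fun i _ => (h.integrable_terms hβ hz i).2.1.const_mul _,
      ← integral_add (integrable_finsetSum _ fun i _ => (h.integrable_terms hβ hz i).1)
        (integrable_finsetSum _ fun i _ => (h.integrable_terms hβ hz i).2.1.const_mul _)]
    refine integral_congr_ae (Eventually.of_forall fun x => ?_)
    simp only [fpExpr_eq c h.contDiff, add_mul, Finset.sum_mul, mul_assoc]
  have h2 : ∀ i, ∫ x, pd i (pd i φ) x * kern (toC ξ) x = -((ξ i : ℂ) ^ 2 * fl φ (toC ξ)) :=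
    fun i => by
      rw [integral_pd_mul_kern (hpd i) i _ (hI i) (h.integrable_terms hβ hz i).1,
        integral_pd_mul_kern hφd i _ h0 (hI i)]
      simp only [toC, fl]
      linear_combination (ξ i : ℂ) ^ 2 * (∫ x, φ x * kern (toC ξ) x) * Complex.I_sq
  have h3 : ∀ i, ∫ x, ((x i : ℂ) * pd i φ x + φ x) * kern (toC ξ) x
      = Complex.I * (ξ i : ℂ) * ∫ x, (x i : ℂ) * φ x * kern (toC ξ) x := fun i => by
    have hd : Differentiable ℝ fun x : E n => (x i : ℂ) * φ x := by
      refine Differentiable.mul ?_ hφd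
      exact (Complex.ofRealCLM ∘L (EuclideanSpace.proj i : E n →L[ℝ] ℝ)).differentiable
    have := integral_pd_mul_kern hd i (toC ξ) (h.integrable_terms hβ hz i).2.2
      (by simpa only [pd_coord_mul hφd] using (h.integrable_terms hβ hz i).2.1)
    simpa only [pd_coord_mul hφd, toC] using this
  have h4 : dfl φ (toC ξ) (fun i => (c i : ℂ) * (ξ i : ℂ))
      = -∑ i, (c i : ℂ) * (Complex.I * (ξ i : ℂ) * ∫ x, (x i : ℂ) * φ x * kern (toC ξ) x) := by
    simp_rw [← integral_const_mul]
    rw [← integral_finsetSum _ fun i _ => ((h.integrable_terms hβ hz i).2.2.const_mul _).const_mul _,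
      ← integral_neg]
    refine integral_congr_ae (Eventually.of_forall fun x => ?_)
    simp only [dkern, Finset.mul_sum, ← Finset.sum_neg_distrib]
    exact Finset.sum_congr rfl fun i _ => by ring
  rw [h1, fpSymbol, h4]
  simp only [h2, h3, Finset.sum_neg_distrib, ← Finset.sum_mul]
  ring

lemma WSobolev.of_testFun {n : ℕ} (β : ℝ) {φ : E n → ℂ} (hφ : φ ∈ testFun n) :
    WSobolev β φ := by
  have hs : ∀ {ψ : E n → ℂ}, ψ ∈ testFun n → ∀ i, pd i ψ ∈ testFun n := fun {ψ} hψ i =>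
    ⟨(hψ.1.fderiv_right (m := ∞) (by simp)).clm_apply contDiff_const,
      hψ.2.fderiv_apply (𝕜 := ℝ) (EuclideanSpace.single i 1)⟩
  exact ⟨hφ.1.of_le two_le_smooth, memLp_of_testFun β hφ, fun i => memLp_of_testFun β (hs hφ i),
    fun i => memLp_of_testFun β (hs (hs hφ i) i)⟩

/-- `g = 𝓛 f` in terms of Fourier transforms. -/
def FPRel {n : ℕ} {β : ℝ} (c : Fin n → ℝ) (f g : WSpace n β) : Prop :=
  ∀ ξ : E n, fpSymbol c f ξ = fl g (toC ξ)

lemma fpSymbol_congr {n : ℕ} (c : Fin n → ℝ) {f g : E n → ℂ} (h : f =ᵐ[volume] g) (ξ : E n) :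
    fpSymbol c f ξ = fpSymbol c g ξ := by
  unfold fpSymbol dfl
  rw [fl_congr h]
  congr 1
  exact integral_congr_ae (h.mono fun x hx => by simp only [hx])

lemma fpRel_test {n : ℕ} [NeZero n] {β : ℝ} (hβ : 0 < β) (c : Fin n → ℝ) (φ : testFun n) :
    FPRel c (testIncl n β φ) (fpTest β c φ) := fun ξ => by
  have h1 : testIncl n β φ =ᵐ[volume] φ.1 :=
    (ae_weight_iff β).1 (memLp_of_testFun β φ.2).coeFn_toLp
  have h2 : fpTest β c φ =ᵐ[volume] fpExpr c φ.1 :=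
    (ae_weight_iff β).1 (memLp_fpExpr β c φ.2).coeFn_toLp
  rw [fpSymbol_congr c h1, fl_congr h2]
  exact ((WSobolev.of_testFun β φ.2).fl_fpExpr hβ c ξ).symm

/-! ### Dilations and the explicit Fokker-Planck semigroup -/

/-- The dilation `exp (-tC) z`. -/
def dil {n : ℕ} (c : Fin n → ℝ) (t : ℝ) (z : Fin n → ℂ) : Fin n → ℂ :=
  fun i => ((Real.exp (-(c i * t)) : ℝ) : ℂ) * z i

/-- The dilation `exp (-tC) ξ` of `ℝⁿ`. -/
def dilE {n : ℕ} (c : Fin n → ℝ) (t : ℝ) (ξ : E n) : E n :=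
  WithLp.toLp 2 fun i => Real.exp (-(c i * t)) * ξ i

lemma dil_toC {n : ℕ} (c : Fin n → ℝ) (t : ℝ) (ξ : E n) : dil c t (toC ξ) = toC (dilE c t ξ) := by
  ext i
  simp [dil, toC, dilE]

lemma dilE_zero {n : ℕ} (c : Fin n → ℝ) (ξ : E n) : dilE c 0 ξ = ξ := by
  ext i
  simp [dilE]

lemma dilE_add {n : ℕ} (c : Fin n → ℝ) (s t : ℝ) (ξ : E n) :
    dilE c (s + t) ξ = dilE c t (dilE c s ξ) := by
  ext i
  simp only [dilE]
  rw [← mul_assoc, ← Real.exp_add]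
  congr 2
  ring

lemma dilE_apply {n : ℕ} (c : Fin n → ℝ) (t : ℝ) (ξ : E n) (i : Fin n) :
    dilE c t ξ i = Real.exp (-(c i * t)) * ξ i := rfl

lemma dil_line {n : ℕ} (c : Fin n → ℝ) (t : ℝ) (i : Fin n) (ζ : ℂ) (ξ : E n) :
    dil c t (line i ζ ξ) = line i (((Real.exp (-(c i * t)) : ℝ) : ℂ) * ζ) (dilE c t ξ) := by
  ext j
  by_cases h : j = i
  · subst h
    simp only [dil, line, sc, dilE, Pi.add_apply, Pi.single_eq_same, Complex.ofReal_mul]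
    ring
  · simp only [dil, line, sc, dilE, Pi.add_apply, Pi.single_eq_of_ne h, add_zero,
      Complex.ofReal_mul]
    ring

lemma im1_dil_le {n : ℕ} {c : Fin n → ℝ} {t a : ℝ} (h : ∀ i, Real.exp (-(c i * t)) ≤ a)
    (z : Fin n → ℂ) : im1 (dil c t z) ≤ a * im1 z := by
  unfold im1 dil
  rw [Finset.mul_sum]
  refine Finset.sum_le_sum fun i _ => ?_
  rw [Complex.im_ofReal_mul, abs_mul, abs_of_pos (Real.exp_pos _)]
  exact mul_le_mul_of_nonneg_right (h i) (abs_nonneg _)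

lemma exp_neg_mul_le_one {a t : ℝ} (ha : 0 < a) (ht : 0 ≤ t) : Real.exp (-(a * t)) ≤ 1 := by
  rw [Real.exp_le_one_iff]
  have := mul_nonneg ha.le ht
  linarith

lemma im1_dil_le_im1 {n : ℕ} {c : Fin n → ℝ} (hc : ∀ i, 0 < c i) {t : ℝ} (ht : 0 ≤ t)
    (z : Fin n → ℂ) : im1 (dil c t z) ≤ im1 z := by
  have := im1_dil_le (c := c) (t := t) (a := 1) (fun i => exp_neg_mul_le_one (hc i) ht) z
  rwa [one_mul] at this

lemma dil_mem_tube {n : ℕ} {β : ℝ} {c : Fin n → ℝ} (hc : ∀ i, 0 < c i) {t : ℝ} (ht : 0 ≤ t)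
    {z : Fin n → ℂ} (hz : z ∈ tube n β) : dil c t z ∈ tube n β :=
  (im1_dil_le_im1 hc ht z).trans_lt hz

lemma differentiable_dil {n : ℕ} (c : Fin n → ℝ) (t : ℝ) : Differentiable ℂ (dil c t) := by
  unfold dil
  fun_prop

/-- The numbers `(1 - exp (-2 cᵢ t)) / (2 cᵢ)`. -/
def tau {n : ℕ} (c : Fin n → ℝ) (t : ℝ) (i : Fin n) : ℝ := (1 - Real.exp (-(2 * c i * t))) / (2 * c i)

lemma tau_zero {n : ℕ} (c : Fin n → ℝ) (i : Fin n) : tau c 0 i = 0 := by simp [tau]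

lemma tau_le {n : ℕ} {c : Fin n → ℝ} (hc : ∀ i, 0 < c i) (t : ℝ) (i : Fin n) :
    tau c t i ≤ ∑ j, 1 / (2 * c j) := by
  have h1 : tau c t i ≤ 1 / (2 * c i) := by
    unfold tau
    have := hc i
    gcongr
    linarith [Real.exp_pos (-(2 * c i * t))]
  refine h1.trans (Finset.single_le_sum (f := fun j => 1 / (2 * c j)) (fun j _ => ?_)
    (Finset.mem_univ i))
  have := hc j
  positivity

lemma tau_mono {n : ℕ} {c : Fin n → ℝ} (hc : ∀ i, 0 < c i) {s t : ℝ} (h : s ≤ t) (i : Fin n) :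
    tau c s i ≤ tau c t i := by
  unfold tau
  have := hc i
  gcongr

lemma tau_pos {n : ℕ} {c : Fin n → ℝ} (hc : ∀ i, 0 < c i) {t : ℝ} (ht : 0 < t) (i : Fin n) :
    0 < tau c t i := by
  have := hc i
  refine div_pos (sub_pos.2 (Real.exp_lt_one_iff.2 ?_)) (by positivity)
  have : 0 < 2 * c i * t := by positivity
  linarith

lemma tau_nonneg {n : ℕ} {c : Fin n → ℝ} (hc : ∀ i, 0 < c i) {t : ℝ} (ht : 0 ≤ t) (i : Fin n) :
    0 ≤ tau c t i := by
  rw [← tau_zero c i]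
  exact tau_mono hc ht i

lemma gs_tau_zero {n : ℕ} (c : Fin n → ℝ) (z : Fin n → ℂ) : gs (tau c 0) z = 1 := by
  simp [gs, tau_zero]

/-- The cocycle identity τ_i(s+t) = τ_i(s) + e^{-2c_i s} τ_i(t), from which the semigroup law
follows. -/
lemma gs_tau_add {n : ℕ} {c : Fin n → ℝ} (hc : ∀ i, 0 < c i) (s t : ℝ) (z : Fin n → ℂ) :
    gs (tau c (s + t)) z = gs (tau c s) z * gs (tau c t) (dil c s z) := by
  unfold gs
  rw [← Complex.exp_add, ← neg_add, ← Finset.sum_add_distrib]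
  congr 2
  refine Finset.sum_congr rfl fun i _ => ?_
  have h1 : tau c (s + t) i = tau c s i + tau c t i * Real.exp (-(c i * s)) ^ 2 := by
    have h2 : Real.exp (-(2 * c i * (s + t)))
        = Real.exp (-(2 * c i * t)) * Real.exp (-(c i * s)) ^ 2 := by
      rw [← Real.exp_nat_mul, ← Real.exp_add]
      congr 1
      push_cast
      ring
    have h3 : Real.exp (-(2 * c i * s)) = Real.exp (-(c i * s)) ^ 2 := by
      rw [← Real.exp_nat_mul]
      congr 1
      push_cast
      ring
    have := (hc i).ne'
    unfold tau
    rw [h2, h3]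
    field_simp
    ring
  rw [h1]
  simp only [dil]
  push_cast
  ring

/-- The dilation maps the line of height σ in direction e_i onto the lower line of height e^{-c_i
t}σ; the factor e^{t tr C} is the Jacobian. -/
lemma lineEnergy_comp_dil {n : ℕ} {β : ℝ} {c : Fin n → ℝ} (hc : ∀ i, 0 < c i) {u : (Fin n → ℂ) → ℂ}
    (hu : ContinuousOn u (tube n β)) (i : Fin n) {σ t : ℝ} (ht : 0 ≤ t) (hσ : |σ| < β / 2) :
    lineEnergy (fun z => u (dil c t z)) i σ
      = ENNReal.ofReal (Real.exp (t * ∑ i, c i)) * lineEnergy u i (Real.exp (-(c i * t)) * σ) := by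
  have hprod : (∏ i, Real.exp (-(c i * t)))⁻¹ = Real.exp (t * ∑ i, c i) := by
    rw [← Real.exp_sum, ← Real.exp_neg, Finset.sum_neg_distrib, neg_neg, ← Finset.sum_mul, mul_comm]
  have key : ∀ ρ : ℝ, |ρ| < β / 2 → ∫⁻ ξ, ‖u (dil c t (line i (ρ * Complex.I) ξ))‖ₑ ^ 2
      = ENNReal.ofReal (Real.exp (t * ∑ i, c i)) *
        ∫⁻ ξ, ‖u (line i ((Real.exp (-(c i * t)) * ρ : ℝ) * Complex.I) ξ)‖ₑ ^ 2 := fun ρ hρ => by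
    have h1 : |Real.exp (-(c i * t)) * ρ| < β / 2 := by
      rw [abs_mul, abs_of_pos (Real.exp_pos _)]
      exact (mul_le_of_le_one_left (abs_nonneg _) (exp_neg_mul_le_one (hc i) ht)).trans_lt hρ
    have h2 : Continuous fun ξ => u (line i ((Real.exp (-(c i * t)) * ρ : ℝ) * Complex.I) ξ) :=
      continuous_comp_line hu i (by
        rw [Complex.im_ofReal_mul, Complex.I_im, mul_one]
        exact h1)
    rw [← hprod, ← lintegral_comp_diag (fun i => Real.exp_pos (-(c i * t)))
      (h2.measurable.enorm.pow_const 2)]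
    refine lintegral_congr fun ξ => ?_
    rw [dil_line, ← mul_assoc, ← Complex.ofReal_mul]
    rfl
  unfold lineEnergy
  rw [key σ hσ, key (-σ) (by rwa [abs_neg]), mul_add]
  simp only [mul_neg]

/-- A bound for the norm of the Fokker-Planck semigroup at time `t`. -/
def semiBound {n : ℕ} (β : ℝ) (c : Fin n → ℝ) (t : ℝ) : ℝ :=
  Real.exp ((∑ j, 1 / (2 * c j)) * (β / 2) ^ 2) * Real.exp (t * (∑ i, c i) / 2)

lemma sum_inv_nonneg {n : ℕ} {c : Fin n → ℝ} (hc : ∀ i, 0 < c i) : 0 ≤ ∑ j, 1 / (2 * c j) :=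
  Finset.sum_nonneg fun j _ => by
    have := hc j
    positivity

lemma gaussDecay_semi {n : ℕ} [NeZero n] {β : ℝ} (hβ : 0 < β) {c : Fin n → ℝ} (hc : ∀ i, 0 < c i)
    {t : ℝ} (ht : 0 < t) (f : WSpace n β) :
    DifferentiableOn ℂ (fun z => fl f (dil c t z) * gs (tau c t) z) (tube n β) ∧
    GaussDecay β (fun z => fl f (dil c t z) * gs (tau c t) z) := by
  constructor
  · refine DifferentiableOn.mul ?_ (differentiable_gs _).differentiableOn
    exact (differentiableOn_fl hβ (Lp.memLp f)).comp (differentiable_dil c t).differentiableOn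
      fun z hz => dil_mem_tube hc ht.le hz
  · refine (gaussDecay_gs β (tau_pos hc ht)).mul_subGauss (subGauss_of_bounded fun s hs => ?_)
    exact ⟨_, fun z hz => norm_fl_le hβ hs ((im1_dil_le_im1 hc ht.le z).trans hz) f⟩

/-- The Gaussian factor is bounded on the tube, and the dilated transform has energies at smaller
heights, hence bounded by ‖f‖ up to the Jacobian. This estimate stays bounded as t → 0, as strong
continuity requires. -/
lemma exists_semi {n : ℕ} [NeZero n] {β : ℝ} (hβ : 0 < β) {c : Fin n → ℝ} (hc : ∀ i, 0 < c i)
    {t : ℝ} (ht : 0 ≤ t) :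
    ∃ T : WSpace n β →L[ℂ] WSpace n β, (∀ f, ‖T f‖ ≤ semiBound β c t * ‖f‖) ∧
      ∀ f ξ, fl (T f) (toC ξ) = gs (tau c t) (toC ξ) * fl f (toC (dilE c t ξ)) := by
  refine exists_clm_of_fl hβ _ (fun ξ => toC (dilE c t ξ)) (fun ξ => toC_mem_tube hβ _) fun f => ?_
  have hS := sum_inv_nonneg hc
  have hC : 0 ≤ ∑ i, c i := Finset.sum_nonneg fun i _ => (hc i).le
  -- At t = 0 all τ_i vanish and there is no Gaussian decay, so the identity is treated separately.
  rcases ht.eq_or_lt with rfl | ht'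
  · refine ⟨f, ?_, fun ξ => by rw [gs_tau_zero, one_mul, dilE_zero]⟩
    refine le_mul_of_one_le_left (norm_nonneg f) ?_
    have h1 : 1 ≤ Real.exp ((∑ j, 1 / (2 * c j)) * (β / 2) ^ 2) := Real.one_le_exp (by positivity)
    simpa [semiBound] using h1
  obtain ⟨hdiff, hd⟩ := gaussDecay_semi hβ hc ht' f
  obtain ⟨g, hg1, hg2, -⟩ := exists_of_lineEnergy hβ hdiff hd (A := semiBound β c t * ‖f‖)
    (by unfold semiBound; positivity) fun σ h0 hσ => by
      have hσ' : |σ| < β / 2 := by rwa [abs_of_pos h0]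
      set B := Real.exp ((∑ j, 1 / (2 * c j)) * (β / 2) ^ 2)
      calc ∑ i, lineEnergy (fun z => fl f (dil c t z) * gs (tau c t) z) i σ
          ≤ ∑ i, ENNReal.ofReal (B ^ 2) * lineEnergy (fun z => fl f (dil c t z)) i σ := by
            refine Finset.sum_le_sum fun i _ => lineEnergy_mono (fun z hz => ?_) i hσ'
            have h1 := norm_gs_le (τ := tau c t) (κ := 0) hS (tau_nonneg hc ht) (tau_le hc t)
              (mem_tube.1 hz).le
            rw [norm_mul, mul_comm]
            refine mul_le_mul_of_nonneg_right ?_ (norm_nonneg _)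
            simpa [B] using h1
        _ = ENNReal.ofReal (B ^ 2) * (ENNReal.ofReal (Real.exp (t * ∑ i, c i)) *
              ∑ i, lineEnergy (fl f) i (Real.exp (-(c i * t)) * σ)) := by
            rw [Finset.mul_sum, Finset.mul_sum]
            refine Finset.sum_congr rfl fun i _ => ?_
            rw [lineEnergy_comp_dil hc (differentiableOn_fl hβ (Lp.memLp f)).continuousOn i ht hσ']
        _ ≤ ENNReal.ofReal (B ^ 2) * (ENNReal.ofReal (Real.exp (t * ∑ i, c i)) *
              ENNReal.ofReal (2 * ‖f‖ ^ 2)) := by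
            gcongr
            refine sum_lineEnergy_fl_le hβ f _ fun i => ?_
            rw [abs_mul, abs_of_pos (Real.exp_pos _)]
            exact (mul_le_of_le_one_left (abs_nonneg _) (exp_neg_mul_le_one (hc i) ht)).trans_lt hσ'
        _ = _ := by
            rw [← ENNReal.ofReal_mul (Real.exp_pos _).le, ← ENNReal.ofReal_mul (by positivity)]
            congr 1
            have h2 : Real.exp (t * ∑ i, c i) = Real.exp (t * (∑ i, c i) / 2) ^ 2 := by
              rw [← Real.exp_nat_mul]
              congr 1
              push_cast
              ring
            rw [h2, semiBound]
            ring
  exact ⟨g, hg1, fun ξ => by rw [hg2, dil_toC, mul_comm]⟩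

/-- The Fokker-Planck semigroup `exp (t𝓛)`. -/
def fpSemi {n : ℕ} [NeZero n] {β : ℝ} (hβ : 0 < β) {c : Fin n → ℝ} (hc : ∀ i, 0 < c i)
    (t : ℝ≥0) : WSpace n β →L[ℂ] WSpace n β := (exists_semi hβ hc t.2).choose

lemma norm_fpSemi_le {n : ℕ} [NeZero n] {β : ℝ} (hβ : 0 < β) {c : Fin n → ℝ} (hc : ∀ i, 0 < c i)
    (t : ℝ≥0) (f : WSpace n β) : ‖fpSemi hβ hc t f‖ ≤ semiBound β c t * ‖f‖ :=
  (exists_semi hβ hc t.2).choose_spec.1 f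

lemma fl_fpSemi {n : ℕ} [NeZero n] {β : ℝ} (hβ : 0 < β) {c : Fin n → ℝ} (hc : ∀ i, 0 < c i)
    (t : ℝ≥0) (f : WSpace n β) (ξ : E n) :
    fl (fpSemi hβ hc t f) (toC ξ) = gs (tau c t) (toC ξ) * fl f (toC (dilE c t ξ)) :=
  (exists_semi hβ hc t.2).choose_spec.2 f ξ

lemma fpSemi_zero {n : ℕ} [NeZero n] {β : ℝ} (hβ : 0 < β) {c : Fin n → ℝ} (hc : ∀ i, 0 < c i) :
    fpSemi hβ hc 0 = ContinuousLinearMap.id ℂ (WSpace n β) := by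
  ext1 f
  refine ext_of_fl hβ fun ξ => ?_
  rw [fl_fpSemi, NNReal.coe_zero, gs_tau_zero, dilE_zero, one_mul]
  rfl

lemma fpSemi_add {n : ℕ} [NeZero n] {β : ℝ} (hβ : 0 < β) {c : Fin n → ℝ} (hc : ∀ i, 0 < c i)
    (s t : ℝ≥0) : fpSemi hβ hc (s + t) = (fpSemi hβ hc s).comp (fpSemi hβ hc t) := by
  ext1 f
  refine ext_of_fl hβ fun ξ => ?_
  rw [ContinuousLinearMap.comp_apply, fl_fpSemi, fl_fpSemi, fl_fpSemi, NNReal.coe_add,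
    gs_tau_add hc, dilE_add, dil_toC, mul_assoc]

lemma semiBound_mono {n : ℕ} (β : ℝ) {c : Fin n → ℝ} (hc : ∀ i, 0 < c i) {s t : ℝ} (h : s ≤ t) :
    semiBound β c s ≤ semiBound β c t := by
  have hC : 0 ≤ ∑ i, c i := Finset.sum_nonneg fun i _ => (hc i).le
  unfold semiBound
  gcongr

/-! ### Time derivative, strong continuity and generator -/

lemma hasDerivAt_dilE {n : ℕ} (c : Fin n → ℝ) (ξ : E n) (r : ℝ) :
    HasDerivAt (fun r => toC (dilE c r ξ))
      (-(fun i => (c i : ℂ) * (dilE c r ξ i : ℂ)) : Fin n → ℂ) r := by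
  refine hasDerivAt_pi.2 fun i => ?_
  have h1 : HasDerivAt (fun r => Real.exp (-(c i * r)) * ξ i)
      (Real.exp (-(c i * r)) * -(c i * 1) * ξ i) r :=
    ((((hasDerivAt_id r).const_mul (c i)).neg).exp).mul_const (ξ i)
  have h2 := h1.ofReal_comp
  refine h2.congr_deriv ?_
  rw [Pi.neg_apply, dilE_apply]
  push_cast
  ring

lemma hasDerivAt_gs_tau {n : ℕ} {c : Fin n → ℝ} (hc : ∀ i, 0 < c i) (ξ : E n) (r : ℝ) :
    HasDerivAt (fun r => gs (tau c r) (toC ξ))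
      (gs (tau c r) (toC ξ) * -∑ i, (dilE c r ξ i : ℂ) ^ 2) r := by
  have h1 : ∀ i, HasDerivAt (fun r => tau c r i) (Real.exp (-(c i * r)) ^ 2) r := fun i => by
    have h2 := (((((hasDerivAt_id r).const_mul (2 * c i)).neg).exp).const_sub 1).div_const (2 * c i)
    have := (hc i).ne'
    have h3 : Real.exp (-(c i * r)) ^ 2 = Real.exp (-(2 * c i * r)) := by
      rw [← Real.exp_nat_mul]
      congr 1
      push_cast
      ring
    refine h2.congr_deriv ?_
    rw [h3]
    simp only [id, Pi.neg_apply]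
    field_simp
  have h4 := (HasDerivAt.fun_sum (u := Finset.univ) fun i _ =>
    (h1 i).ofReal_comp.mul_const (toC ξ i ^ 2)).neg.cexp
  refine h4.congr_deriv ?_
  rw [gs]
  congr 2
  refine Finset.sum_congr rfl fun i _ => ?_
  rw [dilE_apply, toC]
  push_cast
  ring

/-- The method of characteristics: τ_i' = e^{-2c_i r} produces the term -|e^{-rC}ξ|², and the chain
rule along r ↦ e^{-rC}ξ produces the transport term, both at the dilated frequency. -/
lemma hasDerivAt_semi {n : ℕ} [NeZero n] {β : ℝ} (hβ : 0 < β) {c : Fin n → ℝ} (hc : ∀ i, 0 < c i)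
    (f : WSpace n β) (ξ : E n) (r : ℝ) :
    HasDerivAt (fun r => gs (tau c r) (toC ξ) * fl f (toC (dilE c r ξ)))
      (gs (tau c r) (toC ξ) * fpSymbol c f (dilE c r ξ)) r := by
  obtain ⟨D, hD, hDv⟩ := hasFDerivAt_fl hβ (Lp.memLp f) (toC_mem_tube hβ (dilE c r ξ))
  have h1 := (hD.restrictScalars ℝ).comp_hasDerivAt r (hasDerivAt_dilE c ξ r)
  have h2 := (hasDerivAt_gs_tau hc ξ r).mul h1
  refine h2.congr_deriv ?_
  have h3 : (D.restrictScalars ℝ) (-(fun i => (c i : ℂ) * (dilE c r ξ i : ℂ)) : Fin n → ℂ)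
      = -dfl f (toC (dilE c r ξ)) (fun i => (c i : ℂ) * (dilE c r ξ i : ℂ)) := by
    rw [ContinuousLinearMap.coe_restrictScalars', map_neg, hDv]
  rw [h3, fpSymbol]
  simp only [Function.comp_apply]
  ring

lemma fl_fpSemi_of_nonneg {n : ℕ} [NeZero n] {β : ℝ} (hβ : 0 < β) {c : Fin n → ℝ}
    (hc : ∀ i, 0 < c i) {r : ℝ} (hr : 0 ≤ r) (f : WSpace n β) (ξ : E n) :
    fl (fpSemi hβ hc r.toNNReal f) (toC ξ) = gs (tau c r) (toC ξ) * fl f (toC (dilE c r ξ)) := by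
  rw [fl_fpSemi, Real.coe_toNNReal r hr]

/-- At each frequency the fundamental theorem of calculus identifies the left side with the weak
integral of e^{r𝓛}g - g' over [0, t]. Taking g' = 0 serves strong continuity and stationarity; g' =
g serves the generator. -/
lemma norm_fpSemi_sub_le {n : ℕ} [NeZero n] {β : ℝ} (hβ : 0 < β) {c : Fin n → ℝ}
    (hc : ∀ i, 0 < c i) {f g : WSpace n β} (h : FPRel c f g) (g' : WSpace n β) (t : ℝ≥0) {A : ℝ}
    (hA : ∀ r ≤ t, ‖fpSemi hβ hc r g - g'‖ ≤ A) :
    ‖fpSemi hβ hc t f - f - ((t : ℝ) : ℂ) • g'‖ ≤ t * A := by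
  have hz := fun ξ : E n => toC_mem_tube hβ ξ
  have hcont : ∀ ξ, Continuous fun r => gs (tau c r) (toC ξ) * fl g (toC (dilE c r ξ)) := fun ξ =>
    continuous_iff_continuousAt.2 fun r => (hasDerivAt_semi hβ hc g ξ r).continuousAt
  have hval : ∀ ξ, ∀ r ∈ Set.Icc (0 : ℝ) t, flCLM hβ (hz ξ) (fpSemi hβ hc r.toNNReal g - g')
      = gs (tau c r) (toC ξ) * fl g (toC (dilE c r ξ)) - fl g' (toC ξ) := fun ξ r hr => by
    rw [map_sub, flCLM_apply, flCLM_apply, fl_fpSemi_of_nonneg hβ hc hr.1]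
  obtain ⟨u, hu1, hu2⟩ := exists_of_integral_functionals (fun ξ : E n => flCLM hβ (hz ξ)) t.2
    (fun r => fpSemi hβ hc r.toNNReal g - g') (A := A)
    (fun r hr => hA _ (Real.toNNReal_le_iff_le_coe.2 hr.2))
    (fun ξ => (((hcont ξ).sub continuous_const).continuousOn).congr (hval ξ))
  have : fpSemi hβ hc t f - f - ((t : ℝ) : ℂ) • g' = u := by
    refine ext_of_fl hβ fun ξ => ?_
    have h1 := intervalIntegral.integral_eq_sub_of_hasDerivAt (a := 0) (b := t)
      (fun r _ => hasDerivAt_semi hβ hc f ξ r) (by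
        simp only [h (dilE c _ ξ)]
        exact (hcont ξ).intervalIntegrable _ _)
    simp only [h (dilE c _ ξ), gs_tau_zero, dilE_zero, one_mul] at h1
    have h2 : fl u (toC ξ) = ∫ r in (0 : ℝ)..t, (gs (tau c r) (toC ξ) * fl g (toC (dilE c r ξ))
        - fl g' (toC ξ)) := by
      rw [← flCLM_apply hβ (hz ξ), hu2]
      refine intervalIntegral.integral_congr fun r hr => ?_
      rw [Set.uIcc_of_le t.2] at hr
      exact hval ξ r hr
    rw [h2, intervalIntegral.integral_sub ((hcont ξ).intervalIntegrable _ _)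
      intervalIntegrable_const, h1, intervalIntegral.integral_const, ← flCLM_apply hβ (hz ξ),
      map_sub, map_sub, map_smul, flCLM_apply, flCLM_apply, flCLM_apply, fl_fpSemi]
    simp
  rw [this]
  exact hu1

lemma fpSemi_apply_eq_self {n : ℕ} [NeZero n] {β : ℝ} (hβ : 0 < β) {c : Fin n → ℝ}
    (hc : ∀ i, 0 < c i) {f : WSpace n β} (h : FPRel c f 0) (t : ℝ≥0) : fpSemi hβ hc t f = f := by
  have h1 := norm_fpSemi_sub_le hβ hc h 0 t (A := 0) (fun r _ => by simp)
  rw [smul_zero, sub_zero, mul_zero] at h1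
  exact sub_eq_zero.1 (norm_le_zero_iff.1 h1)

lemma denseRange_testIncl (n : ℕ) [NeZero n] (β : ℝ) : DenseRange (testIncl n β) := by
  refine (Lp.dense_hasCompactSupport_contDiff (F := ℂ) (μ := weightMeasure n β) (p := 2)
    ENNReal.ofNat_ne_top).mono ?_
  rintro f ⟨g, hfg, hg1, hg2⟩
  refine ⟨⟨g, hg2, hg1⟩, ?_⟩
  exact Lp.ext ((memLp_of_testFun β (φ := g) ⟨hg2, hg1⟩).coeFn_toLp.trans hfg.symm)

/-- The norms are bounded for t ≤ 1, so density of test functions suffices; on these the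
displacement is O(t). -/
lemma fpSemi_tendsto {n : ℕ} [NeZero n] {β : ℝ} (hβ : 0 < β) {c : Fin n → ℝ}
    (hc : ∀ i, 0 < c i) (f : WSpace n β) :
    Tendsto (fun t => fpSemi hβ hc t f) (𝓝 0) (𝓝 f) := by
  set K := semiBound β c 1 with hK
  have hK0 : 0 < K := by rw [hK]; unfold semiBound; positivity
  have hb : ∀ t : ℝ≥0, t ≤ 1 → ∀ g : WSpace n β, ‖fpSemi hβ hc t g‖ ≤ K * ‖g‖ := fun t ht g =>
    (norm_fpSemi_le hβ hc t g).trans (mul_le_mul_of_nonneg_right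
      (semiBound_mono β hc (by exact_mod_cast ht)) (norm_nonneg g))
  rw [Metric.tendsto_nhds]
  intro ε hε
  obtain ⟨φ, hφ⟩ := (denseRange_testIncl n β).exists_dist_lt f
    (show 0 < ε / (2 * (K + 1)) by positivity)
  rw [dist_eq_norm] at hφ
  set u := testIncl n β φ
  set v := fpTest β c φ
  have h1 : Tendsto (fun t : ℝ≥0 => (t : ℝ) * (K * ‖v‖)) (𝓝 0) (𝓝 0) := by
    have h2 : Tendsto (fun t : ℝ≥0 => (t : ℝ) * (K * ‖v‖)) (𝓝 0) (𝓝 (((0 : ℝ≥0) : ℝ) * (K * ‖v‖))) :=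
      (NNReal.continuous_coe.tendsto 0).mul_const _
    simpa using h2
  filter_upwards [h1.eventually_lt_const (half_pos hε), Iic_mem_nhds (show (0 : ℝ≥0) < 1 by norm_num)]
    with t ht1 ht2
  have h3 := norm_fpSemi_sub_le hβ hc (fpRel_test hβ c φ) 0 t (A := K * ‖v‖) fun r hr => by
    rw [sub_zero]
    exact hb r (hr.trans ht2) v
  rw [smul_zero, sub_zero] at h3
  have h4 := hb t ht2 (f - u)
  rw [map_sub] at h4
  rw [dist_eq_norm]
  calc ‖fpSemi hβ hc t f - f‖
      = ‖(fpSemi hβ hc t f - fpSemi hβ hc t u) + (fpSemi hβ hc t u - u) - (f - u)‖ := by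
        congr 1; abel
    _ ≤ ‖fpSemi hβ hc t f - fpSemi hβ hc t u‖ + ‖fpSemi hβ hc t u - u‖ + ‖f - u‖ :=
        (norm_sub_le _ _).trans (add_le_add_left (norm_add_le _ _) _)
    _ ≤ K * ‖f - u‖ + t * (K * ‖v‖) + ‖f - u‖ := by gcongr
    _ = (K + 1) * ‖f - u‖ + t * (K * ‖v‖) := by ring
    _ < (K + 1) * (ε / (2 * (K + 1))) + ε / 2 := by
        refine add_lt_add ?_ ht1
        exact mul_lt_mul_of_pos_left hφ (by positivity)
    _ = ε := by field_simp; ring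

lemma isC0Semigroup_fpSemi {n : ℕ} [NeZero n] {β : ℝ} (hβ : 0 < β) {c : Fin n → ℝ}
    (hc : ∀ i, 0 < c i) : IsC0Semigroup (fpSemi hβ hc) :=
  ⟨fpSemi_zero hβ hc, fpSemi_add hβ hc, fpSemi_tendsto hβ hc⟩

lemma tendsto_coe_nhdsGT_zero : Tendsto (fun t : ℝ≥0 => (t : ℝ)) (𝓝[>] 0) (𝓝[>] 0) := by
  refine tendsto_nhdsWithin_iff.2 ⟨?_, ?_⟩
  · have := NNReal.continuous_coe.tendsto 0
    rw [NNReal.coe_zero] at this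
    exact this.mono_left nhdsWithin_le_nhds
  · filter_upwards [self_mem_nhdsWithin] with t ht
    exact NNReal.coe_pos.2 ht

/-- The generator of the Fokker-Planck semigroup in terms of Fourier transforms. -/
lemma fpRel_iff_tendsto {n : ℕ} [NeZero n] {β : ℝ} (hβ : 0 < β) {c : Fin n → ℝ}
    (hc : ∀ i, 0 < c i) (f g : WSpace n β) :
    FPRel c f g ↔ Tendsto (fun t : ℝ≥0 => (((t : ℝ)⁻¹ : ℝ) : ℂ) • (fpSemi hβ hc t f - f))
      (𝓝[>] 0) (𝓝 g) := by
  constructor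
  · intro h
    rw [Metric.tendsto_nhds]
    intro ε hε
    have h1 := (Metric.tendsto_nhds.1 (fpSemi_tendsto hβ hc g)) (ε / 2) (half_pos hε)
    obtain ⟨δ, hδ, hδ2⟩ := Metric.eventually_nhds_iff.1 h1
    have h2 : ∀ᶠ t : ℝ≥0 in 𝓝[>] 0, dist t 0 < δ :=
      nhdsWithin_le_nhds (Metric.ball_mem_nhds 0 hδ)
    filter_upwards [h2, self_mem_nhdsWithin] with t ht ht0
    have ht0' : (0 : ℝ) < t := NNReal.coe_pos.2 ht0
    have h3 := norm_fpSemi_sub_le hβ hc h g t (A := ε / 2) fun r hr => by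
      have : dist r 0 < δ := by
        refine lt_of_le_of_lt ?_ ht
        rw [NNReal.dist_eq, NNReal.dist_eq, NNReal.coe_zero, sub_zero, sub_zero, NNReal.abs_eq,
          NNReal.abs_eq]
        exact_mod_cast hr
      have := hδ2 this
      rw [dist_eq_norm] at this
      exact this.le
    have h4 : (((t : ℝ)⁻¹ : ℝ) : ℂ) • (fpSemi hβ hc t f - f) - g
        = (((t : ℝ)⁻¹ : ℝ) : ℂ) • (fpSemi hβ hc t f - f - ((t : ℝ) : ℂ) • g) := by
      rw [smul_sub _ (fpSemi hβ hc t f - f), smul_smul, ← Complex.ofReal_mul,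
        inv_mul_cancel₀ ht0'.ne', Complex.ofReal_one, one_smul]
    rw [dist_eq_norm, h4, norm_smul, Complex.norm_real, Real.norm_of_nonneg (by positivity),
      inv_mul_lt_iff₀ ht0']
    nlinarith
  -- Evaluation at a frequency is a bounded functional, so the strong difference quotient converges
  -- to the derivative of the explicit formula at t = 0, which is the symbol.
  · intro h ξ
    have hz := toC_mem_tube hβ ξ
    have h1 := ((flCLM hβ hz).continuous.tendsto g).comp h
    have h2 := (hasDerivAt_semi hβ hc f ξ 0).tendsto_slope_zero.mono_left
      (nhdsWithin_mono (0 : ℝ) (fun x (hx : 0 < x) => (hx.ne' : x ∈ ({0}ᶜ : Set ℝ))))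
    have h3 := h2.comp tendsto_coe_nhdsGT_zero
    simp only [gs_tau_zero, dilE_zero, one_mul, zero_add] at h3
    refine tendsto_nhds_unique h3 (h1.congr fun t => ?_)
    simp only [Function.comp_apply, map_smul, map_sub, flCLM_apply, fl_fpSemi]
    rw [Complex.real_smul, smul_eq_mul]

/-! ### Exponential decay at zero mass -/

/-- The `L²(ω)` norm of functions whose transforms have a Gaussian bound on the tube. -/
def gaussConst (n : ℕ) (κ : ℝ) : ℝ :=
  Real.sqrt (n * ∫ ξ : E n, Real.exp (-(4 * κ * Real.pi ^ 2) * ‖ξ‖ ^ 2))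

lemma gaussDecay_of_bound {n : ℕ} {β : ℝ} {u : (Fin n → ℂ) → ℂ} {K κ : ℝ} (hK : 0 ≤ K)
    (hκ : 0 < κ) (h : ∀ z ∈ tube n β, ‖u z‖ ≤ K * Real.exp (-κ * ∑ i, (z i).re ^ 2)) :
    GaussDecay β u := fun _ hs => ⟨K, κ, hK, hκ, fun z hz => h z (lt_of_le_of_lt hz hs)⟩

lemma exists_of_gaussBound {n : ℕ} [NeZero n] {β : ℝ} (hβ : 0 < β) {u : (Fin n → ℂ) → ℂ}
    (hu : DifferentiableOn ℂ u (tube n β)) {K κ : ℝ} (hK : 0 ≤ K) (hκ : 0 < κ)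
    (h : ∀ z ∈ tube n β, ‖u z‖ ≤ K * Real.exp (-κ * ∑ i, (z i).re ^ 2)) :
    ∃ g : WSpace n β, ‖g‖ ≤ gaussConst n κ * K ∧ (∀ ξ, fl g (toC ξ) = u (toC ξ)) ∧
      g =ᵐ[volume] 𝓕⁻ (fun ξ => u (sc ξ)) := by
  have hG := integrable_exp_neg_sq (n := n) (κ := 4 * κ * Real.pi ^ 2) (by positivity)
  have hI : 0 ≤ ∫ ξ : E n, Real.exp (-(4 * κ * Real.pi ^ 2) * ‖ξ‖ ^ 2) :=
    integral_nonneg fun ξ => (Real.exp_pos _).le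
  refine exists_of_lineEnergy hβ hu (gaussDecay_of_bound hK hκ h)
    (mul_nonneg (Real.sqrt_nonneg _) hK) fun σ h0 hσ => ?_
  have key : ∀ i, ∀ ρ : ℝ, |ρ| < β / 2 → ∫⁻ ξ, ‖u (line i (ρ * Complex.I) ξ)‖ₑ ^ 2
      ≤ ENNReal.ofReal (K ^ 2 * ∫ ξ : E n, Real.exp (-(4 * κ * Real.pi ^ 2) * ‖ξ‖ ^ 2)) := by
    intro i ρ hρ
    rw [← integral_const_mul, ofReal_integral_eq_lintegral_ofReal (hG.const_mul _)
      (Eventually.of_forall fun ξ => by positivity)]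
    refine lintegral_mono fun ξ => ?_
    have h1 : line i (ρ * Complex.I) ξ ∈ tube n β := by
      rw [mem_tube, im1_line]
      simpa using hρ
    have h2 : 2 * Real.pi ^ 2 * ‖ξ‖ ^ 2 ≤ ∑ j, (line i (ρ * Complex.I) ξ j).re ^ 2 := by
      simpa using sum_re_sq_line_ge i (ρ * Complex.I) ξ
    have h3 : ‖u (line i (ρ * Complex.I) ξ)‖ ≤ K * Real.exp (-(2 * κ * Real.pi ^ 2) * ‖ξ‖ ^ 2) := by
      refine (h _ h1).trans (mul_le_mul_of_nonneg_left (Real.exp_le_exp.2 ?_) hK)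
      nlinarith
    rw [← ofReal_norm, ← ENNReal.ofReal_pow (norm_nonneg _)]
    refine ENNReal.ofReal_le_ofReal ((pow_le_pow_left₀ (norm_nonneg _) h3 2).trans_eq ?_)
    rw [mul_pow, ← Real.exp_nat_mul]
    congr 2
    push_cast
    ring
  have hσ' : |σ| < β / 2 := by rwa [abs_of_pos h0]
  calc ∑ i, lineEnergy u i σ ≤ ∑ _i : Fin n, ENNReal.ofReal
        (2 * (K ^ 2 * ∫ ξ : E n, Real.exp (-(4 * κ * Real.pi ^ 2) * ‖ξ‖ ^ 2))) := by
        refine Finset.sum_le_sum fun i _ => ?_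
        rw [two_mul, ENNReal.ofReal_add (by positivity) (by positivity)]
        exact add_le_add (key i σ hσ') (key i (-σ) (by rwa [abs_neg]))
    _ = ENNReal.ofReal (2 * (gaussConst n κ * K) ^ 2) := by
        rw [Finset.sum_const, Finset.card_univ, Fintype.card_fin, nsmul_eq_mul,
          ← ENNReal.ofReal_natCast, ← ENNReal.ofReal_mul (by positivity), gaussConst, mul_pow,
          Real.sq_sqrt (by positivity)]
        congr 1
        ring

/-- Imaginary parts are controlled by the tube, and |Re z_i| ≤ 1 + (Re z_i)²; half of the Gaussian
absorbs the quadratic term by y ≤ e^y. -/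
lemma sum_norm_mul_exp_le {n : ℕ} {β : ℝ} {z : Fin n → ℂ} (hz : z ∈ tube n β) {κ : ℝ}
    (hκ : 0 < κ) : (∑ i, ‖z i‖) * Real.exp (-κ * ∑ i, (z i).re ^ 2)
      ≤ (β / 2 + n + 2 / κ) * Real.exp (-(κ / 2) * ∑ i, (z i).re ^ 2) := by
  set R := ∑ i, (z i).re ^ 2 with hR
  have hR0 : 0 ≤ R := Finset.sum_nonneg fun i _ => sq_nonneg _
  have hz' : im1 z ≤ β / 2 := (mem_tube.1 hz).le
  have h0 : 0 ≤ β / 2 := (im1_nonneg z).trans hz'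
  have h1 : ∑ i, ‖z i‖ ≤ β / 2 + n + R := by
    calc ∑ i, ‖z i‖ ≤ ∑ i, (|(z i).im| + 1 + (z i).re ^ 2) := Finset.sum_le_sum fun i _ => by
          have h2 := Complex.norm_le_abs_re_add_abs_im (z i)
          have h3 : |(z i).re| ≤ 1 + (z i).re ^ 2 := by
            rw [← sq_abs]
            nlinarith [sq_nonneg (|(z i).re| - 1)]
          linarith
      _ = im1 z + n + R := by
          rw [Finset.sum_add_distrib, Finset.sum_add_distrib]
          simp [im1, hR]
      _ ≤ _ := by linarith
  have h4 : R ≤ 2 / κ * Real.exp (κ / 2 * R) := by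
    have := Real.add_one_le_exp (κ / 2 * R)
    calc R = 2 / κ * (κ / 2 * R) := by field_simp
      _ ≤ _ := by gcongr; linarith
  have h5 : 1 ≤ Real.exp (κ / 2 * R) := Real.one_le_exp (by positivity)
  have h6 : Real.exp (-(κ / 2) * R) = Real.exp (κ / 2 * R) * Real.exp (-κ * R) := by
    rw [← Real.exp_add]
    congr 1
    ring
  rw [h6, ← mul_assoc]
  refine mul_le_mul_of_nonneg_right (h1.trans ?_) (Real.exp_pos _).le
  calc β / 2 + n + R ≤ (β / 2 + n) * Real.exp (κ / 2 * R) + 2 / κ * Real.exp (κ / 2 * R) :=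
        add_le_add (le_mul_of_one_le_right (by positivity) h5) h4
    _ = _ := by ring

/-- The mean value inequality along the segment from 0 to w, which stays in the subtube |Im|₁ ≤ s.
-/
lemma norm_fl_le_of_fl_zero {n : ℕ} [NeZero n] {β s : ℝ} (hβ : 0 < β) (hs : s < β / 2)
    {f : WSpace n β} (hf : fl f 0 = 0) {w : Fin n → ℂ} (hw : im1 w ≤ s) :
    ‖fl f w‖ ≤ (∑ i, ‖w i‖) * growthConst n β s 1 * ‖f‖ := by
  have h1 : ∀ r ∈ Set.Icc (0 : ℝ) 1, im1 ((r : ℂ) • w) ≤ s := fun r hr => by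
    refine le_trans ?_ hw
    unfold im1
    refine Finset.sum_le_sum fun i _ => ?_
    rw [Pi.smul_apply, smul_eq_mul, Complex.im_ofReal_mul, abs_mul, abs_of_nonneg hr.1]
    exact mul_le_of_le_one_left (abs_nonneg _) hr.2
  have h2 : ∀ r ∈ Set.Icc (0 : ℝ) 1, HasDerivAt (fun r : ℝ => fl f ((r : ℂ) • w))
      (dfl f ((r : ℂ) • w) w) r := fun r hr => by
    obtain ⟨D, hD, hDv⟩ := hasFDerivAt_fl hβ (Lp.memLp f)
      (mem_tube.2 ((h1 r hr).trans_lt hs))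
    rw [← hDv]
    have h3 : HasDerivAt (fun r : ℝ => (r : ℂ) • w) ((1 : ℂ) • w) r :=
      (Complex.ofRealCLM.hasDerivAt).smul_const w
    rw [one_smul] at h3
    exact (hD.restrictScalars ℝ).comp_hasDerivAt r h3
  have h4 := norm_image_sub_le_of_norm_deriv_le_segment_01'
    (fun r hr => (h2 r hr).hasDerivWithinAt)
    (fun r hr => norm_dfl_le hβ hs (h1 r (Set.Ico_subset_Icc_self hr)) w f)
  simpa [hf] using h4

/-- Functions of mass zero decay exponentially along the Fokker-Planck semigroup. -/
lemma exists_norm_fpSemi_le_exp {n : ℕ} [NeZero n] {β : ℝ} (hβ : 0 < β) {c : Fin n → ℝ}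
    (hc : ∀ i, 0 < c i) {c₀ : ℝ} (hc₀ : 0 < c₀) (hle : ∀ i, c₀ ≤ c i) :
    ∃ K : ℝ, 0 < K ∧ ∀ (f : WSpace n β) (t : ℝ≥0), fl f 0 = 0 →
      ‖fpSemi hβ hc t f‖ ≤ K * ‖f‖ * Real.exp (-(t * c₀)) := by
  -- Since τ_i increases in time, its values at t = 1 give a Gaussian rate valid for all t ≥ 1.
  obtain ⟨κ, hκ, hκτ⟩ : ∃ κ > 0, ∀ i, κ ≤ tau c 1 i := by
    obtain ⟨i₀, hi₀⟩ := Finite.exists_min (tau c 1)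
    exact ⟨tau c 1 i₀, tau_pos hc one_pos i₀, hi₀⟩
  have hS := sum_inv_nonneg hc
  -- For t ≥ 1 the dilation maps the whole tube into this strictly smaller one, where derivatives of
  -- transforms are uniformly bounded.
  set s := Real.exp (-c₀) * (β / 2) with hs_def
  have hs : s < β / 2 := mul_lt_of_lt_one_left (by positivity)
    (Real.exp_lt_one_iff.2 (neg_lt_zero.2 hc₀))
  set G := Real.exp ((∑ j, 1 / (2 * c j)) * (β / 2) ^ 2) with hG
  set P := growthConst n β s 1 with hP
  have hP0 : 0 ≤ P := growthConst_nonneg _ _ _ _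
  set Q := G * P * (β / 2 + n + 2 / κ) with hQ
  have hQ0 : 0 ≤ Q := by positivity
  set K₁ := gaussConst n (κ / 2) * Q
  have hK₁ : 0 ≤ K₁ := mul_nonneg (Real.sqrt_nonneg _) hQ0
  set K₂ := semiBound β c 1 * Real.exp c₀ with hK₂
  have hK₂' : 0 < K₂ := by rw [hK₂]; unfold semiBound; positivity
  refine ⟨K₁ + K₂, by positivity, fun f t hf => ?_⟩
  -- For t ≤ 1 the crude operator bound suffices, at the price of a factor e^{c₀}.
  rcases le_or_gt (t : ℝ) 1 with ht | ht
  · calc ‖fpSemi hβ hc t f‖ ≤ semiBound β c 1 * ‖f‖ :=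
          (norm_fpSemi_le hβ hc t f).trans
            (mul_le_mul_of_nonneg_right (semiBound_mono β hc ht) (norm_nonneg f))
      _ ≤ semiBound β c 1 * ‖f‖ * (Real.exp c₀ * Real.exp (-(t * c₀))) := by
          refine le_mul_of_one_le_right ?_ ?_
          · unfold semiBound
            positivity
          · rw [← Real.exp_add]
            refine Real.one_le_exp ?_
            nlinarith
      _ = K₂ * ‖f‖ * Real.exp (-(t * c₀)) := by rw [hK₂]; ring
      _ ≤ _ := by
          gcongr
          linarith
  · have ht0 : (0 : ℝ) < t := one_pos.trans ht
    obtain ⟨hdiff, -⟩ := gaussDecay_semi hβ hc ht0 f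
    set a := Real.exp (-(t * c₀)) with ha
    have hexp : ∀ i, Real.exp (-(c i * t)) ≤ a := fun i => Real.exp_le_exp.2 (by
      have := mul_le_mul_of_nonneg_right (hle i) ht0.le
      linarith)
    have has : a ≤ Real.exp (-c₀) := Real.exp_le_exp.2 (by nlinarith)
    -- The decay factor a = e^{-tc₀} enters linearly, since the argument of f̂ is at most a∑|z_i|
    -- and f̂ vanishes at 0.
    obtain ⟨g, hg1, hg2, -⟩ := exists_of_gaussBound hβ hdiff (K := a * Q * ‖f‖) (κ := κ / 2)
      (by positivity) (by positivity) fun z hz => by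
        have hz' : im1 z ≤ β / 2 := (mem_tube.1 hz).le
        have h1 : im1 (dil c t z) ≤ s := (im1_dil_le hexp z).trans
          (mul_le_mul has hz' (im1_nonneg z) (Real.exp_pos _).le)
        have h2 := norm_fl_le_of_fl_zero hβ hs hf h1
        have h3 : ∑ i, ‖dil c t z i‖ ≤ a * ∑ i, ‖z i‖ := by
          rw [Finset.mul_sum]
          refine Finset.sum_le_sum fun i _ => ?_
          rw [dil, norm_mul, Complex.norm_real, Real.norm_of_nonneg (Real.exp_pos _).le]
          exact mul_le_mul_of_nonneg_right (hexp i) (norm_nonneg _)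
        have h4 := norm_gs_le (τ := tau c t) hS
          (fun i => (hκτ i).trans (tau_mono hc ht.le i)) (tau_le hc t) hz'
        have h5 := sum_norm_mul_exp_le hz hκ
        rw [norm_mul]
        calc ‖fl f (dil c t z)‖ * ‖gs (tau c t) z‖
            ≤ ((a * ∑ i, ‖z i‖) * P * ‖f‖) * (G * Real.exp (-κ * ∑ i, (z i).re ^ 2)) := by
              refine mul_le_mul (h2.trans ?_) h4 (norm_nonneg _) ?_
              · gcongr
              · have : 0 ≤ ∑ i, ‖z i‖ := Finset.sum_nonneg fun _ _ => norm_nonneg _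
                positivity
          _ = a * P * ‖f‖ * G * ((∑ i, ‖z i‖) * Real.exp (-κ * ∑ i, (z i).re ^ 2)) := by ring
          _ ≤ a * P * ‖f‖ * G * ((β / 2 + n + 2 / κ) *
                Real.exp (-(κ / 2) * ∑ i, (z i).re ^ 2)) :=
              mul_le_mul_of_nonneg_left h5 (by positivity)
          _ = _ := by rw [hQ]; ring
    have hgf : fpSemi hβ hc t f = g := ext_of_fl hβ fun ξ => by
      rw [fl_fpSemi, hg2, dil_toC, mul_comm]
    rw [hgf]
    calc ‖g‖ ≤ gaussConst n (κ / 2) * (a * Q * ‖f‖) := hg1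
      _ = K₁ * ‖f‖ * a := by ring
      _ ≤ _ := by
          gcongr
          linarith

/-! ### Smooth functions with Gaussian transforms -/

/-- Holomorphic functions on the tube with a Gaussian bound. -/
structure GaussBound {n : ℕ} (β : ℝ) (u : (Fin n → ℂ) → ℂ) : Prop where
  diff : DifferentiableOn ℂ u (tube n β)
  bound : ∃ K κ : ℝ, 0 ≤ K ∧ 0 < κ ∧
    ∀ z ∈ tube n β, ‖u z‖ ≤ K * Real.exp (-κ * ∑ i, (z i).re ^ 2)

lemma GaussBound.coord {n : ℕ} {β : ℝ} {u : (Fin n → ℂ) → ℂ} (h : GaussBound β u) (i : Fin n) :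
    GaussBound β fun z => Complex.I * z i * u z := by
  obtain ⟨K, κ, hK, hκ, hb⟩ := h.bound
  refine ⟨?_, K * (|β / 2| + n + 2 / κ), κ / 2, by positivity, by positivity, fun z hz => ?_⟩
  · have h1 : Differentiable ℂ fun z : Fin n → ℂ => Complex.I * z i := by fun_prop
    exact h1.differentiableOn.mul h.diff
  · rw [norm_mul, norm_mul, Complex.norm_I, one_mul]
    calc ‖z i‖ * ‖u z‖ ≤ (∑ j, ‖z j‖) * (K * Real.exp (-κ * ∑ i, (z i).re ^ 2)) :=
          mul_le_mul (Finset.single_le_sum (f := fun j => ‖z j‖) (fun _ _ => norm_nonneg _)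
            (Finset.mem_univ i)) (hb z hz) (norm_nonneg _)
            (Finset.sum_nonneg fun _ _ => norm_nonneg _)
      _ = K * ((∑ j, ‖z j‖) * Real.exp (-κ * ∑ i, (z i).re ^ 2)) := by ring
      _ ≤ K * ((β / 2 + n + 2 / κ) * Real.exp (-(κ / 2) * ∑ i, (z i).re ^ 2)) :=
          mul_le_mul_of_nonneg_left (sum_norm_mul_exp_le hz hκ) hK
      _ ≤ K * ((|β / 2| + n + 2 / κ) * Real.exp (-(κ / 2) * ∑ i, (z i).re ^ 2)) := by
          gcongr
          exact le_abs_self _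
      _ = _ := by ring

/-- The inverse Fourier transform of `u` restricted to real arguments. -/
def flInv {n : ℕ} (u : (Fin n → ℂ) → ℂ) : E n → ℂ := 𝓕⁻ fun ξ => u (sc ξ)

lemma GaussBound.exists_real {n : ℕ} [NeZero n] {β : ℝ} (hβ : 0 < β) {u : (Fin n → ℂ) → ℂ}
    (h : GaussBound β u) : Continuous (fun ξ : E n => u (sc ξ)) ∧
      ∃ K κ : ℝ, 0 ≤ K ∧ 0 < κ ∧ ∀ ξ : E n, ‖u (sc ξ)‖ ≤ K * Real.exp (-κ * ‖ξ‖ ^ 2) := by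
  obtain ⟨K, κ, hK, hκ, hb⟩ := h.bound
  have hβ' : 0 < β / 2 := by positivity
  obtain ⟨K', κ', hK', hκ', hb'⟩ := (gaussDecay_of_bound hK hκ hb).line hβ' 0
  constructor
  · have := continuous_comp_line (ζ := 0) h.diff.continuousOn 0 (by simpa using hβ')
    simpa only [line_zero] using this
  · refine ⟨K', κ', hK', hκ', fun ξ => ?_⟩
    have := hb' 0 0 (by simp) (by simp) ξ
    rwa [line_zero] at this

lemma GaussBound.memLp_flInv {n : ℕ} [NeZero n] {β : ℝ} (hβ : 0 < β) {u : (Fin n → ℂ) → ℂ}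
    (h : GaussBound β u) : MemLp (flInv u) 2 (weightMeasure n β) ∧
      ∀ ξ, fl (flInv u) (toC ξ) = u (toC ξ) := by
  obtain ⟨K, κ, hK, hκ, hb⟩ := h.bound
  obtain ⟨g, -, hg1, hg2⟩ := exists_of_gaussBound hβ h.diff hK hκ hb
  refine ⟨(memLp_congr_ae ((ae_weight_iff β).2 hg2)).1 (Lp.memLp g), fun ξ => ?_⟩
  rw [← hg1]
  exact fl_congr hg2.symm _

lemma integrable_pow_mul_of_gauss {n : ℕ} {v : E n → ℂ} (hv : Continuous v) {K κ : ℝ}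
    (hκ : 0 < κ) (h : ∀ ξ, ‖v ξ‖ ≤ K * Real.exp (-κ * ‖ξ‖ ^ 2)) (m : ℕ) :
    Integrable fun ξ => ‖ξ‖ ^ m * ‖v ξ‖ := by
  obtain ⟨C, hC, hb⟩ := pow_le_const_mul_exp m (ε := κ / 2) (by positivity)
  refine ((integrable_exp_neg_sq (n := n) (κ := κ / 2) (by positivity)).const_mul (C * K)).mono'
    (by fun_prop) (Eventually.of_forall fun ξ => ?_)
  rw [Real.norm_of_nonneg (by positivity)]
  have h1 : ‖ξ‖ ^ m ≤ C * Real.exp (κ / 2 * ‖ξ‖ ^ 2) := by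
    refine (pow_le_pow_left₀ (norm_nonneg ξ) ?_ m).trans (hb (‖ξ‖ ^ 2) (by positivity))
    nlinarith [sq_nonneg (‖ξ‖ - 1)]
  calc ‖ξ‖ ^ m * ‖v ξ‖ ≤ C * Real.exp (κ / 2 * ‖ξ‖ ^ 2) * (K * Real.exp (-κ * ‖ξ‖ ^ 2)) :=
        mul_le_mul h1 (h ξ) (norm_nonneg _) (by positivity)
    _ = C * K * (Real.exp (κ / 2 * ‖ξ‖ ^ 2) * Real.exp (-κ * ‖ξ‖ ^ 2)) := by ring
    _ = _ := by
      rw [← Real.exp_add]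
      congr 2
      ring

lemma flInv_eq {n : ℕ} (u : (Fin n → ℂ) → ℂ) :
    flInv u = fun x => 𝓕 (fun ξ : E n => u (sc ξ)) (-x) := by
  ext x
  exact Real.fourierInv_eq_fourier_neg _ x

/-- Gaussian decay makes all moments of the transform finite, so every derivative may be taken under
the integral. -/
lemma GaussBound.contDiff_flInv {n : ℕ} [NeZero n] {β : ℝ} (hβ : 0 < β) {u : (Fin n → ℂ) → ℂ}
    (h : GaussBound β u) : ContDiff ℝ ∞ (flInv u) := by
  obtain ⟨hc, K, κ, hK, hκ, hb⟩ := h.exists_real hβ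
  rw [flInv_eq]
  exact (Real.contDiff_fourier (N := ⊤) fun m _ =>
    integrable_pow_mul_of_gauss hc hκ hb m).comp contDiff_neg

/-- Since multiplication by i z_i preserves `GaussBound`, this can be iterated and puts derivatives
in L²(ω) without estimates in x. The inverse transform is differentiated as 𝓕 composed with x ↦ -x.
-/
lemma GaussBound.pd_flInv {n : ℕ} [NeZero n] {β : ℝ} (hβ : 0 < β) {u : (Fin n → ℂ) → ℂ}
    (h : GaussBound β u) (i : Fin n) :
    pd i (flInv u) = flInv fun z => Complex.I * z i * u z := by
  obtain ⟨hc, K, κ, hK, hκ, hb⟩ := h.exists_real hβ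
  have h0 := integrable_of_gauss hc hκ hb
  have h1 := integrable_pow_mul_of_gauss hc hκ hb 1
  simp only [pow_one] at h1
  ext x
  have h2 := (Real.hasFDerivAt_fourier h0 h1 (-x)).comp x (hasFDerivAt_id x).neg
  have h3 : Integrable (VectorFourier.fourierSMulRight (innerSL ℝ) fun ξ : E n => u (sc ξ)) := by
    refine (h1.const_mul (2 * Real.pi * ‖innerSL ℝ (E := E n)‖)).mono'
      h0.aestronglyMeasurable.fourierSMulRight (Eventually.of_forall fun ξ => ?_)
    exact (VectorFourier.norm_fourierSMulRight_le _ _ _).trans_eq (by ring)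
  have h4 : flInv u = 𝓕 (fun ξ : E n => u (sc ξ)) ∘ fun x => -x := flInv_eq u
  rw [pd, h4, h2.fderiv]
  simp only [ContinuousLinearMap.comp_apply, neg_apply, ContinuousLinearMap.id_apply, map_neg]
  rw [Real.fourier_continuousLinearMap_apply h3, flInv, Real.fourierInv_eq_fourier_neg,
    Real.fourier_eq', Real.fourier_eq', ← integral_neg]
  refine integral_congr_ae (Eventually.of_forall fun ξ => ?_)
  have h5 : innerSL ℝ ξ (EuclideanSpace.single i (1 : ℝ)) = ξ i := by
    rw [innerSL_apply_apply ℝ, inner_eq_sum]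
    simp
  beta_reduce
  rw [VectorFourier.fourierSMulRight_apply, h5, smul_eq_mul, smul_eq_mul, Complex.real_smul]
  simp only [sc]
  push_cast
  ring

/-! ### Product rules, cutoffs and dominated convergence -/

lemma pd_mem_testFun {n : ℕ} {ψ : E n → ℂ} (hψ : ψ ∈ testFun n) (i : Fin n) :
    pd i ψ ∈ testFun n :=
  ⟨(hψ.1.fderiv_right (m := ∞) (by simp)).clm_apply contDiff_const,
    hψ.2.fderiv_apply (𝕜 := ℝ) (EuclideanSpace.single i 1)⟩

lemma pd_mul {n : ℕ} {φ ψ : E n → ℂ} (hφ : Differentiable ℝ φ) (hψ : Differentiable ℝ ψ)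
    (i : Fin n) : pd i (fun x => φ x * ψ x) = fun x => φ x * pd i ψ x + pd i φ x * ψ x := by
  ext x
  unfold pd
  rw [((hφ x).hasFDerivAt.fun_mul (hψ x).hasFDerivAt).fderiv]
  simp
  ring

lemma pd_add {n : ℕ} {φ ψ : E n → ℂ} (hφ : Differentiable ℝ φ) (hψ : Differentiable ℝ ψ)
    (i : Fin n) : pd i (fun x => φ x + ψ x) = fun x => pd i φ x + pd i ψ x := by
  ext x
  unfold pd
  rw [((hφ x).hasFDerivAt.fun_add (hψ x).hasFDerivAt).fderiv]
  simp

lemma pd_const_mul_comp_smul {n : ℕ} (φ : E n → ℂ) (b : ℂ) (a : ℝ) (i : Fin n)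
    (hφ : Differentiable ℝ φ) :
    pd i (fun x => b * φ (a • x)) = fun x => b * a * pd i φ (a • x) := by
  ext x
  unfold pd
  have h1 : HasFDerivAt (fun x : E n => φ (a • x)) (a • fderiv ℝ φ (a • x)) x := by
    have := (hφ (a • x)).hasFDerivAt.comp x ((hasFDerivAt_id x).const_smul a)
    exact this.congr_fderiv (by ext y; simp)
  rw [(h1.const_mul b).fderiv]
  simp
  ring

lemma fpExpr_mul {n : ℕ} (c : Fin n → ℝ) {χ F : E n → ℂ} (hχ : ContDiff ℝ ∞ χ)
    (hF : ContDiff ℝ ∞ F) (x : E n) :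
    fpExpr c (fun x => χ x * F x) x = χ x * fpExpr c F x + 2 * ∑ i, pd i χ x * pd i F x
      + (∑ i, (pd i (pd i χ) x + (c i : ℂ) * ((x i : ℂ) * pd i χ x))) * F x := by
  have hd : ∀ {φ : E n → ℂ}, ContDiff ℝ ∞ φ → Differentiable ℝ φ := fun h =>
    h.differentiable (by simp)
  have hp : ∀ {φ : E n → ℂ}, ContDiff ℝ ∞ φ → ∀ i, ContDiff ℝ ∞ (pd i φ) := fun h i =>
    (h.fderiv_right (m := ∞) (by simp)).clm_apply contDiff_const
  have h1 : ∀ i, pd i (fun x => χ x * F x) = fun x => χ x * pd i F x + pd i χ x * F x := fun i =>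
    pd_mul (hd hχ) (hd hF) i
  have h2 : ∀ i, pd i (fun x => χ x * pd i F x + pd i χ x * F x) x
      = χ x * pd i (pd i F) x + 2 * (pd i χ x * pd i F x) + pd i (pd i χ) x * F x := fun i => by
    rw [pd_add ((hd hχ).fun_mul (hd (hp hF i))) ((hd (hp hχ i)).fun_mul (hd hF)),
      pd_mul (hd hχ) (hd (hp hF i)), pd_mul (hd (hp hχ i)) (hd hF)]
    ring
  rw [fpExpr_eq c ((hχ.mul hF).of_le two_le_smooth), fpExpr_eq c (hF.of_le two_le_smooth)]
  simp only [h1, h2, mul_add, Finset.sum_add_distrib, Finset.mul_sum, Finset.sum_mul, add_mul]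
  have h3 : ∀ i, (c i : ℂ) * ((x i : ℂ) * (χ x * pd i F x))
      = χ x * ((c i : ℂ) * ((x i : ℂ) * pd i F x)) := fun i => by ring
  have h4 : ∀ i, (c i : ℂ) * ((x i : ℂ) * (pd i χ x * F x))
      = (c i : ℂ) * ((x i : ℂ) * pd i χ x) * F x := fun i => by ring
  have h5 : ∀ i, (c i : ℂ) * (χ x * F x) = χ x * ((c i : ℂ) * F x) := fun i => by ring
  simp only [h3, h4, h5]
  ring

/-- Cutoff functions with derivatives bounded uniformly in the scale. -/
lemma exists_cutoff (n : ℕ) : ∃ (χ : ℕ → E n → ℂ) (K : ℝ), 0 ≤ K ∧ (∀ k, χ k ∈ testFun n) ∧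
    (∀ x, ∀ᶠ k in atTop, χ k =ᶠ[𝓝 x] fun _ => 1) ∧
    ∀ k x, ‖χ k x‖ ≤ K ∧ ∀ i, ‖pd i (χ k) x‖ ≤ K ∧ ‖pd i (pd i (χ k)) x‖ ≤ K ∧
      ‖(x i : ℂ) * pd i (χ k) x‖ ≤ K := by
  let b : ContDiffBump (0 : E n) := ⟨1, 2, one_pos, one_lt_two⟩
  let θ : E n → ℂ := fun x => (b x : ℂ)
  have hθ : θ ∈ testFun n :=
    ⟨Complex.ofRealCLM.contDiff.comp b.contDiff, b.hasCompactSupport.comp_left Complex.ofReal_zero⟩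
  have hb : ∀ {φ : E n → ℂ}, φ ∈ testFun n → ∃ K : ℝ, ∀ x, ‖φ x‖ ≤ K := fun {φ} hφ => by
    exact hφ.1.continuous.bounded_above_of_compact_support hφ.2
  have hx : ∀ i, ∃ K : ℝ, ∀ x : E n, ‖(x i : ℂ) * pd i θ x‖ ≤ K := fun i => by
    refine Continuous.bounded_above_of_compact_support ?_ ((pd_mem_testFun hθ i).2.mul_left)
    have := (pd_mem_testFun hθ i).1.continuous
    fun_prop
  obtain ⟨K₀, hK₀⟩ := hb hθ
  choose K₁ hK₁ using fun i => hb (pd_mem_testFun hθ i)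
  choose K₂ hK₂ using fun i => hb (pd_mem_testFun (pd_mem_testFun hθ i) i)
  choose K₃ hK₃ using hx
  have hn0 : 0 ≤ K₀ := (norm_nonneg _).trans (hK₀ 0)
  have hn1 : ∀ i, 0 ≤ K₁ i := fun i => (norm_nonneg _).trans (hK₁ i 0)
  have hn2 : ∀ i, 0 ≤ K₂ i := fun i => (norm_nonneg _).trans (hK₂ i 0)
  have hn3 : ∀ i, 0 ≤ K₃ i := fun i => (norm_nonneg _).trans (hK₃ i 0)
  set S := ∑ i, (K₁ i + K₂ i + K₃ i) with hS
  have hS' : ∀ i, K₁ i + K₂ i + K₃ i ≤ S := fun i =>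
    Finset.single_le_sum (f := fun i => K₁ i + K₂ i + K₃ i)
      (fun i _ => add_nonneg (add_nonneg (hn1 i) (hn2 i)) (hn3 i)) (Finset.mem_univ i)
  have hS0 : 0 ≤ S := Finset.sum_nonneg fun i _ =>
    add_nonneg (add_nonneg (hn1 i) (hn2 i)) (hn3 i)
  have ha : ∀ k : ℕ, 0 < ((k : ℝ) + 1)⁻¹ := fun k => by positivity
  have ha1 : ∀ k : ℕ, ((k : ℝ) + 1)⁻¹ ≤ 1 := fun k => inv_le_one_of_one_le₀ (by
    have : (0 : ℝ) ≤ k := k.cast_nonneg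
    linarith)
  have hd : ∀ {φ : E n → ℂ}, φ ∈ testFun n → Differentiable ℝ φ := fun h =>
    h.1.differentiable (by simp)
  have hp1 : ∀ (k : ℕ) i, pd i (fun x => θ (((k : ℝ) + 1)⁻¹ • x))
      = fun x => ((((k : ℝ) + 1)⁻¹ : ℝ) : ℂ) * pd i θ (((k : ℝ) + 1)⁻¹ • x) := fun k i => by
    have := pd_const_mul_comp_smul θ 1 ((k : ℝ) + 1)⁻¹ i (hd hθ)
    simpa only [one_mul] using this
  refine ⟨fun k x => θ (((k : ℝ) + 1)⁻¹ • x), K₀ + S, by positivity, fun k => ⟨?_, ?_⟩, fun x => ?_,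
    fun k x => ⟨?_, fun i => ⟨?_, ?_, ?_⟩⟩⟩
  · exact hθ.1.comp (contDiff_const_smul _)
  · exact hθ.2.comp_smul (ha k).ne'
  · obtain ⟨k₀, hk₀⟩ := exists_nat_gt ‖x‖
    filter_upwards [eventually_ge_atTop k₀] with k hk
    have h1 : ‖x‖ < (k : ℝ) + 1 := by
      have : (k₀ : ℝ) ≤ k := by exact_mod_cast hk
      linarith
    filter_upwards [(isOpen_lt continuous_norm continuous_const).mem_nhds h1] with y hy
    have h2 : b (((k : ℝ) + 1)⁻¹ • y) = 1 := by
      refine b.one_of_mem_closedBall ?_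
      rw [mem_closedBall_zero_iff, norm_smul, Real.norm_of_nonneg (ha k).le]
      change _ ≤ (1 : ℝ)
      rw [inv_mul_le_iff₀ (by positivity), mul_one]
      exact le_of_lt hy
    simp [θ, h2]
  · exact (hK₀ _).trans (le_add_of_nonneg_right hS0)
  · rw [hp1, norm_mul, Complex.norm_real, Real.norm_of_nonneg (ha k).le]
    have := mul_le_of_le_one_left (norm_nonneg (pd i θ (((k : ℝ) + 1)⁻¹ • x))) (ha1 k)
    linarith [hK₁ i (((k : ℝ) + 1)⁻¹ • x), hS' i, hn2 i, hn3 i]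
  · rw [hp1, pd_const_mul_comp_smul _ _ _ _ (hd (pd_mem_testFun hθ i)), norm_mul, norm_mul,
      Complex.norm_real, Real.norm_of_nonneg (ha k).le]
    have := mul_le_of_le_one_left (norm_nonneg (pd i (pd i θ) (((k : ℝ) + 1)⁻¹ • x)))
      (mul_le_one₀ (ha1 k) (ha k).le (ha1 k))
    linarith [hK₂ i (((k : ℝ) + 1)⁻¹ • x), hS' i, hn1 i, hn3 i]
  -- The operator x_i∂_i is invariant under scaling, so the unbounded drift coefficient does no harm
  -- to the commutator with the cutoff.
  · have h1 : (x i : ℂ) * pd i (fun x => θ (((k : ℝ) + 1)⁻¹ • x)) x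
        = (((((k : ℝ) + 1)⁻¹ • x) i : ℝ) : ℂ) * pd i θ (((k : ℝ) + 1)⁻¹ • x) := by
      rw [hp1, PiLp.smul_apply, smul_eq_mul, Complex.ofReal_mul]
      ring
    rw [h1]
    linarith [hK₃ i (((k : ℝ) + 1)⁻¹ • x), hS' i, hn1 i, hn2 i]

/-- Dominated convergence in `L²`. -/
lemma tendsto_toLp_of_dominated {α : Type*} [MeasurableSpace α] {μ : Measure α}
    {H : ℕ → α → ℂ} {h : α → ℂ} {B : α → ℝ} (hH : ∀ k, MemLp (H k) 2 μ) (hh : MemLp h 2 μ)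
    (hB : MemLp B 2 μ) (hb : ∀ k x, ‖H k x‖ ≤ B x) (hlim : ∀ x, ∀ᶠ k in atTop, H k x = h x) :
    Tendsto (fun k => (hH k).toLp (H k)) atTop (𝓝 (hh.toLp h)) := by
  rw [Lp.tendsto_Lp_iff_tendsto_eLpNorm'']
  have h1 : Tendsto (fun k => ∫⁻ x, ‖(H k - h) x‖ₑ ^ 2 ∂μ) atTop (𝓝 (∫⁻ _, 0 ∂μ)) := by
    refine tendsto_lintegral_of_dominated_convergence' (fun x => ‖(|B x| + ‖h x‖)‖ₑ ^ 2)
      (fun k => ((hH k).1.sub hh.1).enorm.pow_const 2) (fun k => Eventually.of_forall fun x => ?_)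
      ?_ (Eventually.of_forall fun x => ?_)
    · refine pow_le_pow_left₀ zero_le ?_ 2
      rw [enorm_le_iff_norm_le, Pi.sub_apply, Real.norm_of_nonneg (by positivity)]
      exact (norm_sub_le _ _).trans (add_le_add_left ((hb k x).trans (le_abs_self _)) _)
    · have h2 : MemLp (fun x => |B x| + ‖h x‖) 2 μ := hB.abs.add hh.norm
      exact ((memLp_two_iff h2.1).1 h2).ne
    · refine tendsto_const_nhds.congr' ((hlim x).mono fun k hk => ?_)
      simp [hk]
  rw [lintegral_zero] at h1
  simp only [← eLpNorm_two_sq] at h1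
  have h3 := h1.ennrpow_const (1 / 2)
  have h4 : ∀ a : ENNReal, (a ^ 2) ^ (1 / 2 : ℝ) = a := fun a => by
    rw [← ENNReal.rpow_natCast, ← ENNReal.rpow_mul]
    norm_num
  simp only [h4] at h3
  rwa [ENNReal.zero_rpow_of_pos (by norm_num)] at h3

/-! ### Identification of the closed operator -/

lemma mem_graph_fpMin {n : ℕ} [NeZero n] (β : ℝ) (c : Fin n → ℝ) (p : WSpace n β × WSpace n β) :
    p ∈ (fpMin β c).graph ↔ ∃ φ : testFun n, (testIncl n β φ, fpTest β c φ) = p := by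
  have key : ∀ φ : testFun n, ∀ h : testIncl n β φ ∈ (fpMin β c).domain,
      fpMin β c ⟨testIncl n β φ, h⟩ = fpTest β c φ := fun φ h => by
    change fpTest β c ((LinearEquiv.ofInjective (testIncl n β) (testIncl_injective n β)).symm
      ⟨testIncl n β φ, h⟩) = _
    congr 1
    rw [LinearEquiv.symm_apply_eq]
    exact Subtype.ext rfl
  rw [LinearPMap.mem_graph_iff]
  constructor
  · rintro ⟨⟨_, ⟨φ, rfl⟩⟩, h1, h2⟩
    exact ⟨φ, Prod.ext h1 ((key φ _).symm.trans h2)⟩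
  · rintro ⟨φ, rfl⟩
    exact ⟨⟨testIncl n β φ, ⟨φ, rfl⟩⟩, rfl, key φ _⟩

lemma isClosed_fpRel {n : ℕ} [NeZero n] {β : ℝ} (hβ : 0 < β) (c : Fin n → ℝ) :
    IsClosed {p : WSpace n β × WSpace n β | FPRel c p.1 p.2} := by
  simp only [FPRel, Set.ofPred_forall]
  refine isClosed_iInter fun ξ => ?_
  have hz := toC_mem_tube hβ ξ
  have h1 : Continuous fun p : WSpace n β × WSpace n β =>
      -(∑ i, (ξ i : ℂ) ^ 2) * flCLM hβ hz p.1
        - dflCLM hβ hz (fun i => (c i : ℂ) * (ξ i : ℂ)) p.1 := by fun_prop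
  have h2 : Continuous fun p : WSpace n β × WSpace n β => flCLM hβ hz p.2 := by fun_prop
  exact isClosed_eq h1 h2

lemma closure_graph_fpMin_le {n : ℕ} [NeZero n] {β : ℝ} (hβ : 0 < β) (c : Fin n → ℝ)
    {f g : WSpace n β} (h : (f, g) ∈ (fpMin β c).graph.topologicalClosure) : FPRel c f g := by
  refine closure_minimal (t := {p : WSpace n β × WSpace n β | FPRel c p.1 p.2}) ?_
    (isClosed_fpRel hβ c) h
  intro p hp
  obtain ⟨φ, rfl⟩ := (mem_graph_fpMin β c p).1 hp
  exact fpRel_test hβ c φ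

/-- If (0, g) is in the closure of the graph then `FPRel` forces ĝ = 0. -/
lemma isClosable_fpMin {n : ℕ} [NeZero n] {β : ℝ} (hβ : 0 < β) (c : Fin n → ℝ) :
    (fpMin β c).IsClosable := by
  refine ⟨(fpMin β c).graph.topologicalClosure.toLinearPMap,
    (Submodule.toLinearPMap_graph_eq _ ?_).symm⟩
  rintro ⟨f, g⟩ hp (rfl : f = 0)
  refine ext_of_fl (f := g) (g := 0) hβ fun ξ => ?_
  have hz := toC_mem_tube hβ ξ
  rw [← closure_graph_fpMin_le hβ c hp ξ, fpSymbol, ← flCLM_apply hβ hz, ← dflCLM_apply hβ hz,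
    map_zero, map_zero]
  simp

/-- From y² ≤ 4cosh y: the weight absorbs the factor x_i², but only into unweighted L². -/
lemma lintegral_coord_mul_lt_top {n : ℕ} {β : ℝ} (hβ : 0 < β) {h : E n → ℂ}
    (hh : MemLp h 2 (weightMeasure n β)) (i : Fin n) :
    ∫⁻ x, ‖(x i : ℂ) * h x‖ₑ ^ 2 < ⊤ := by
  have h1 := (memLp_two_iff hh.1).1 hh
  rw [lintegral_weightMeasure] at h1
  refine lt_of_le_of_lt (b := ENNReal.ofReal (4 / β ^ 2) *
    ∫⁻ x, ENNReal.ofReal (weight β x) * ‖h x‖ₑ ^ 2) ?_ (ENNReal.mul_lt_top ENNReal.ofReal_lt_top h1)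
  rw [← lintegral_const_mul' _ _ ENNReal.ofReal_ne_top]
  refine lintegral_mono fun x => ?_
  rw [enorm_mul, mul_pow, ← mul_assoc, ← ENNReal.ofReal_mul (by positivity)]
  gcongr
  rw [← ofReal_norm, ← ENNReal.ofReal_pow (norm_nonneg _), Complex.norm_real, Real.norm_eq_abs,
    sq_abs]
  refine ENNReal.ofReal_le_ofReal ?_
  have h2 : Real.cosh (β * x i) ≤ weight β x :=
    Finset.single_le_sum (f := fun i => Real.cosh (β * x i))
      (fun _ _ => (Real.cosh_pos _).le) (Finset.mem_univ i)
  have h3 : (β * x i) ^ 2 ≤ 4 * Real.cosh (β * x i) := by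
    have h4 := Real.quadratic_le_exp_of_nonneg (abs_nonneg (β * x i))
    have h5 := Real.exp_pos (-|β * x i|)
    have h6 := Real.cosh_eq |β * x i|
    rw [Real.cosh_abs] at h6
    have h7 := sq_abs (β * x i)
    nlinarith [abs_nonneg (β * x i)]
  calc x i ^ 2 = (β * x i) ^ 2 / β ^ 2 := by field_simp
    _ ≤ 4 * weight β x / β ^ 2 := by gcongr; linarith
    _ = _ := by ring

/-- The term x_i∂_iF is not known to lie in L²(ω), so `ext_of_fl` does not apply. It does lie in L¹
∩ L² for Lebesgue measure, which suffices for Fourier uniqueness. -/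
lemma WSobolev.fpExpr_ae_eq {n : ℕ} [NeZero n] {β : ℝ} (hβ : 0 < β) {F : E n → ℂ}
    (hF : WSobolev β F) (c : Fin n → ℝ) (g : WSpace n β)
    (h : ∀ ξ, fpSymbol c F ξ = fl g (toC ξ)) : fpExpr c F =ᵐ[volume] g := by
  have h0 : (0 : Fin n → ℂ) ∈ tube n β := by
    rw [mem_tube]
    simp [im1, hβ]
  have hg1 := integrable_of_memLp_weight hβ (Lp.memLp g)
  have hg2 := memLp_volume_of_memLp_weight (Lp.memLp g)
  have hE : fpExpr c F = fun x => ∑ i, pd i (pd i F) x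
      + ∑ i, (c i : ℂ) * ((x i : ℂ) * pd i F x + F x) := funext (fpExpr_eq c hF.contDiff)
  have hi : Integrable (fpExpr c F) := by
    rw [hE]
    refine (integrable_finsetSum _ fun i _ => ?_).add (integrable_finsetSum _ fun i _ => ?_)
    · simpa [kern] using (hF.integrable_terms hβ h0 i).1
    · simpa [kern] using ((hF.integrable_terms hβ h0 i).2.1).const_mul (c i : ℂ)
  have h2 : MemLp (fpExpr c F) 2 volume := by
    rw [hE]
    have h3 : ∀ i, MemLp (fun x : E n => (x i : ℂ) * pd i F x) 2 volume := fun i => by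
      have hm : AEStronglyMeasurable (fun x : E n => (x i : ℂ) * pd i F x) volume :=
        (Continuous.aestronglyMeasurable (by fun_prop)).mul
          ((aesm_weight_iff β).1 (hF.memLp_pd i).1)
      exact (memLp_two_iff hm).2 (lintegral_coord_mul_lt_top hβ (hF.memLp_pd i) i)
    have h4 : ∀ i, MemLp (fun x : E n => (c i : ℂ) * ((x i : ℂ) * pd i F x + F x)) 2 volume :=
      fun i => ((h3 i).add (memLp_volume_of_memLp_weight hF.memLp)).const_mul (c i : ℂ)
    have h5 : MemLp (fun x => ∑ i, pd i (pd i F) x) 2 volume :=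
      memLp_finsetSum _ fun i _ => memLp_volume_of_memLp_weight (hF.memLp_pd_pd i)
    have h6 : MemLp (fun x : E n => ∑ i, (c i : ℂ) * ((x i : ℂ) * pd i F x + F x)) 2 volume :=
      memLp_finsetSum _ fun i _ => h4 i
    exact h5.add h6
  have h3 := ae_eq_zero_of_fl_eq_zero (hi.sub hg1) (h2.sub hg2) fun ξ => by
    have hk : ∀ {f : E n → ℂ}, Integrable f → Integrable fun x => f x * kern (toC ξ) x :=
      fun hf => hf.mul_bdd (c := 1) (continuous_kern _).aestronglyMeasurable
        (Eventually.of_forall fun x => by rw [norm_kern]; simp [toC])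
    unfold fl
    simp only [Pi.sub_apply, sub_mul]
    rw [integral_sub (hk hi) (hk hg1), sub_eq_zero]
    exact (hF.fl_fpExpr hβ c ξ).trans (h ξ)
  filter_upwards [h3] with x hx
  exact sub_eq_zero.1 hx

/-- The cutoffs χ_k F approximate F. Commutator terms are dominated by F and its first derivatives,
with constants independent of k. -/
lemma mem_closure_graph_of_smooth {n : ℕ} [NeZero n] {β : ℝ} (c : Fin n → ℝ)
    {F : E n → ℂ} (hs : ContDiff ℝ ∞ F) (hF : WSobolev β F)
    (hL : MemLp (fpExpr c F) 2 (weightMeasure n β)) :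
    (hF.memLp.toLp F, hL.toLp (fpExpr c F)) ∈ (fpMin β c).graph.topologicalClosure := by
  obtain ⟨χ, K, hK, hχ, hone, hb⟩ := exists_cutoff n
  have hφ : ∀ k, (fun x => χ k x * F x) ∈ testFun n := fun k =>
    ⟨(hχ k).1.mul hs, (hχ k).2.mul_right⟩
  have h1 : Tendsto (fun k => testIncl n β ⟨_, hφ k⟩) atTop (𝓝 (hF.memLp.toLp F)) := by
    refine tendsto_toLp_of_dominated (fun k => memLp_of_testFun β (hφ k)) hF.memLp
      (hF.memLp.norm.const_mul K) (fun k x => ?_) fun x => ?_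
    · rw [norm_mul]
      exact mul_le_mul_of_nonneg_right (hb k x).1 (norm_nonneg _)
    · filter_upwards [hone x] with k hk
      rw [hk.eq_of_nhds, one_mul]
  have h2 : Tendsto (fun k => fpTest β c ⟨_, hφ k⟩) atTop (𝓝 (hL.toLp (fpExpr c F))) := by
    have hB : MemLp (fun x => K * ‖fpExpr c F x‖ + 2 * ∑ i, K * ‖pd i F x‖
        + (∑ i, (K + |c i| * K)) * ‖F x‖) 2 (weightMeasure n β) := by
      have hB1 : MemLp (fun x => ∑ i, K * ‖pd i F x‖) 2 (weightMeasure n β) :=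
        memLp_finsetSum _ fun i _ => (hF.memLp_pd i).norm.const_mul K
      exact ((hL.norm.const_mul K).add (hB1.const_mul 2)).add (hF.memLp.norm.const_mul _)
    refine tendsto_toLp_of_dominated (fun k => memLp_fpExpr β c (hφ k)) hL hB
      (fun k x => ?_) fun x => ?_
    · obtain ⟨hb0, hb1⟩ := hb k x
      have h3 : ‖∑ i, pd i (χ k) x * pd i F x‖ ≤ ∑ i, K * ‖pd i F x‖ :=
        norm_sum_le_of_le _ fun i _ => by
          rw [norm_mul]
          exact mul_le_mul_of_nonneg_right (hb1 i).1 (norm_nonneg _)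
      have h4 : ‖∑ i, (pd i (pd i (χ k)) x + (c i : ℂ) * ((x i : ℂ) * pd i (χ k) x))‖
          ≤ ∑ i, (K + |c i| * K) := norm_sum_le_of_le _ fun i _ => by
        refine (norm_add_le _ _).trans (add_le_add (hb1 i).2.1 ?_)
        rw [norm_mul, Complex.norm_real, Real.norm_eq_abs]
        exact mul_le_mul_of_nonneg_left (hb1 i).2.2 (abs_nonneg _)
      rw [fpExpr_mul c (hχ k).1 hs]
      refine (norm_add₃_le).trans (add_le_add (add_le_add ?_ ?_) ?_)
      · rw [norm_mul]
        exact mul_le_mul_of_nonneg_right hb0 (norm_nonneg _)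
      · rw [norm_mul, Complex.norm_ofNat]
        exact mul_le_mul_of_nonneg_left h3 zero_le_two
      · rw [norm_mul]
        exact mul_le_mul_of_nonneg_right h4 (norm_nonneg _)
    -- Near a fixed x the cutoff is eventually 1, so its derivatives vanish there and the sequence
    -- is eventually constant.
    · filter_upwards [hone x] with k hk
      have h3 : ∀ i, pd i (χ k) =ᶠ[𝓝 x] fun _ => 0 := fun i => by
        filter_upwards [hk.fderiv (𝕜 := ℝ)] with y hy
        rw [pd, hy]
        simp
      have h4 : ∀ i, pd i (pd i (χ k)) x = 0 := fun i => by
        rw [pd, (h3 i).fderiv_eq]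
        simp
      rw [fpExpr_mul c (hχ k).1 hs, hk.eq_of_nhds]
      simp [h4, fun i => (h3 i).eq_of_nhds]
  exact mem_closure_of_tendsto (h1.prodMk_nhds h2)
    (Eventually.of_forall fun k => (mem_graph_fpMin β c _).2 ⟨_, rfl⟩)

lemma GaussBound.wSobolev {n : ℕ} [NeZero n] {β : ℝ} (hβ : 0 < β) {u : (Fin n → ℂ) → ℂ}
    (h : GaussBound β u) : WSobolev β (flInv u) where
  contDiff := (h.contDiff_flInv hβ).of_le two_le_smooth
  memLp := (h.memLp_flInv hβ).1
  memLp_pd i := by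
    rw [h.pd_flInv hβ]
    exact ((h.coord i).memLp_flInv hβ).1
  memLp_pd_pd i := by
    rw [h.pd_flInv hβ, (h.coord i).pd_flInv hβ]
    exact (((h.coord i).coord i).memLp_flInv hβ).1

/-- Unlike `GaussDecay`, the bound holds up to the boundary of the tube, because for t > 0 the
dilation pushes the tube into a strictly smaller one. -/
lemma gaussBound_semi {n : ℕ} [NeZero n] {β : ℝ} (hβ : 0 < β) {c : Fin n → ℝ} (hc : ∀ i, 0 < c i)
    {t : ℝ} (ht : 0 < t) (f : WSpace n β) :
    GaussBound β fun z => fl f (dil c t z) * gs (tau c t) z := by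
  refine ⟨(gaussDecay_semi hβ hc ht f).1, ?_⟩
  obtain ⟨i₀, hi₀⟩ := Finite.exists_min c
  obtain ⟨i₁, hi₁⟩ := Finite.exists_min (tau c t)
  set s := Real.exp (-(c i₀ * t)) * (β / 2)
  have hs : s < β / 2 := mul_lt_of_lt_one_left (by positivity)
    (Real.exp_lt_one_iff.2 (neg_lt_zero.2 (mul_pos (hc i₀) ht)))
  have hG := growthConst_nonneg n β s 0
  refine ⟨growthConst n β s 0 * ‖f‖ * Real.exp ((∑ j, 1 / (2 * c j)) * (β / 2) ^ 2), tau c t i₁,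
    by positivity, tau_pos hc ht i₁, fun z hz => ?_⟩
  have hz' : im1 z ≤ β / 2 := (mem_tube.1 hz).le
  have h1 : im1 (dil c t z) ≤ s :=
    (im1_dil_le (a := Real.exp (-(c i₀ * t))) (fun i => Real.exp_le_exp.2 (by
      have := mul_le_mul_of_nonneg_right (hi₀ i) ht.le
      linarith)) z).trans (mul_le_mul_of_nonneg_left hz' (Real.exp_pos _).le)
  rw [norm_mul, mul_assoc]
  exact mul_le_mul (norm_fl_le hβ hs h1 f)
    (norm_gs_le (sum_inv_nonneg hc) hi₁ (tau_le hc t) hz') (norm_nonneg _) (by positivity)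

/-- A generator commutes with its semigroup, the operators e^{t𝓛} and e^{ε𝓛} commuting by the
semigroup law. -/
lemma FPRel.fpSemi {n : ℕ} [NeZero n] {β : ℝ} (hβ : 0 < β) {c : Fin n → ℝ} (hc : ∀ i, 0 < c i)
    {f g : WSpace n β} (h : FPRel c f g) (ε : ℝ≥0) :
    FPRel c (fpSemi hβ hc ε f) (fpSemi hβ hc ε g) := by
  rw [fpRel_iff_tendsto hβ hc] at h ⊢
  refine (((NonlocalFP.fpSemi hβ hc ε).continuous.tendsto g).comp h).congr fun t => ?_
  have h1 := DFunLike.congr_fun (fpSemi_add hβ hc t ε) f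
  have h2 := DFunLike.congr_fun (fpSemi_add hβ hc ε t) f
  rw [add_comm, h1] at h2
  simp only [ContinuousLinearMap.comp_apply] at h2
  simp only [Function.comp_apply, map_smul, map_sub, h2]

lemma mem_graph_fpOp {n : ℕ} [NeZero n] {β : ℝ} (hβ : 0 < β) {c : Fin n → ℝ} (hc : ∀ i, 0 < c i)
    (f g : WSpace n β) : (f, g) ∈ (fpOp β c).graph ↔ FPRel c f g := by
  rw [fpOp, ← (isClosable_fpMin hβ c).graph_closure_eq_closure_graph]
  refine ⟨closure_graph_fpMin_le hβ c, fun h => ?_⟩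
  -- Regularization: e^{ε𝓛}f is smooth and its image under the differential expression is e^{ε𝓛}g,
  -- so the cutoff argument applies; ε → 0 then uses closedness of the graph.
  have key : ∀ ε : ℝ≥0, 0 < ε → (fpSemi hβ hc ε f, fpSemi hβ hc ε g) ∈
      (fpMin β c).graph.topologicalClosure := fun ε hε => by
    have hu := gaussBound_semi hβ hc (NNReal.coe_pos.2 hε) f
    set u := fun z => fl f (dil c ε z) * gs (tau c ε) z
    have hF := hu.wSobolev hβ
    have h1 : fpSemi hβ hc ε f = hF.memLp.toLp (flInv u) := ext_of_fl hβ fun ξ => by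
      rw [fl_congr ((ae_weight_iff β).1 hF.memLp.coeFn_toLp), (hu.memLp_flInv hβ).2, fl_fpSemi,
        mul_comm]
      simp only [u, dil_toC]
    have h2 : fpExpr c (flInv u) =ᵐ[volume] fpSemi hβ hc ε g := by
      refine hF.fpExpr_ae_eq hβ c _ fun ξ => ?_
      rw [← h.fpSemi hβ hc ε ξ, h1]
      exact (fpSymbol_congr c ((ae_weight_iff β).1 hF.memLp.coeFn_toLp) ξ).symm
    have h3 : fpExpr c (flInv u) =ᵐ[weightMeasure n β] NonlocalFP.fpSemi hβ hc ε g :=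
      (ae_weight_iff β).2 h2
    have h4 : MemLp (fpExpr c (flInv u)) 2 (weightMeasure n β) :=
      (memLp_congr_ae h3).2 (Lp.memLp _)
    have h5 : fpSemi hβ hc ε g = h4.toLp (fpExpr c (flInv u)) :=
      Lp.ext (h3.symm.trans h4.coeFn_toLp.symm)
    rw [h1, h5]
    exact mem_closure_graph_of_smooth c (hu.contDiff_flInv hβ) hF h4
  have h1 := (fpSemi_tendsto hβ hc f).prodMk_nhds (fpSemi_tendsto hβ hc g)
  exact (fpMin β c).graph.isClosed_topologicalClosure.mem_of_tendsto
    (h1.mono_left (nhdsWithin_le_nhds (s := Set.Ioi 0)))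
    (by filter_upwards [self_mem_nhdsWithin] with ε hε using key ε hε)

/-! ### The kernel, log ψ̂ and the conjugating operators -/

section Kernel

variable {n : ℕ} {β : ℝ} {c : Fin n → ℝ} {ϑ : 𝓢'(E n, ℂ)} {ϑhat : (Fin n → ℂ) → ℂ}

lemma zero_mem_tube (n : ℕ) {β : ℝ} (hβ : 0 < β) : (0 : Fin n → ℂ) ∈ tube n β := by
  rw [mem_tube]
  simp [im1, hβ]

/-- Near 0 this is differentiability together with ϑ̂(0) = 0; away from 0 boundedness is enough. -/
lemma KernelConditions.exists_norm_le (hβ : 0 < β) (hϑ : KernelConditions β c ϑ ϑhat) :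
    ∃ K : ℝ, 0 ≤ K ∧ ∀ z ∈ tube n β, ‖ϑhat z‖ ≤ K * ‖z‖ := by
  obtain ⟨M, hM⟩ := hϑ.bounded
  have h0 := zero_mem_tube n hβ
  have hM0 : 0 ≤ M := (norm_nonneg _).trans (hM 0 h0)
  have h1 := (hϑ.analytic 0 h0).differentiableAt.hasFDerivAt.isBigO_sub
  simp only [hϑ.massless, sub_zero] at h1
  obtain ⟨K, hK⟩ := h1.bound
  obtain ⟨δ, hδ, hδ2⟩ := Metric.eventually_nhds_iff.1 hK
  refine ⟨|K| + M / δ, by positivity, fun z hz => ?_⟩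
  rw [add_mul]
  rcases lt_or_ge ‖z‖ δ with h | h
  · have h2 := hδ2 (by rwa [dist_zero_right] : dist z 0 < δ)
    have h3 : K * ‖z‖ ≤ |K| * ‖z‖ := mul_le_mul_of_nonneg_right (le_abs_self K) (norm_nonneg z)
    have h4 : 0 ≤ M / δ * ‖z‖ := by positivity
    linarith
  · have h2 : M ≤ M / δ * ‖z‖ := by
      rw [div_mul_eq_mul_div, le_div_iff₀ hδ]
      exact mul_le_mul_of_nonneg_left h hM0
    have h3 : 0 ≤ |K| * ‖z‖ := by positivity
    linarith [hM z hz]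

/-- The point `s^C ξ`. -/
def powE (c : Fin n → ℝ) (s : ℝ) (ξ : E n) : E n := WithLp.toLp 2 fun i => s ^ c i * ξ i

lemma toC_powE (c : Fin n → ℝ) (s : ℝ) (ξ : E n) :
    toC (powE c s ξ) = fun i => ((s ^ c i : ℝ) : ℂ) * toC ξ i := by
  ext i
  simp [toC, powE]

lemma powE_exp_mul (c : Fin n → ℝ) {s : ℝ} (hs : 0 ≤ s) (r : ℝ) (ξ : E n) :
    powE c (Real.exp (-r) * s) ξ = powE c s (dilE c r ξ) := by
  ext i
  simp only [powE, dilE]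
  rw [Real.mul_rpow (Real.exp_pos _).le hs, ← Real.exp_mul]
  have : -r * c i = -(c i * r) := by ring
  rw [this]
  ring

lemma KernelConditions.continuousOn_integrand (hβ : 0 < β) (hc : ∀ i, 0 < c i)
    (hϑ : KernelConditions β c ϑ ϑhat) (ξ : E n) :
    ContinuousOn (fun s : ℝ => ((1 / s : ℝ) : ℂ) * ϑhat (toC (powE c s ξ))) (Set.Ioi 0) := by
  have h1 : ContinuousOn (fun s : ℝ => ϑhat (toC (powE c s ξ))) (Set.Ioi 0) := by
    refine hϑ.analytic.continuousOn.comp ?_ fun s _ => toC_mem_tube hβ _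
    refine Continuous.continuousOn ?_
    simp only [toC_powE]
    have : ∀ i, Continuous fun s : ℝ => s ^ c i := fun i => Real.continuous_rpow_const (hc i).le
    fun_prop
  refine ContinuousOn.mul (Complex.continuous_ofReal.comp_continuousOn ?_) h1
  exact continuousOn_const.div continuousOn_id fun s hs => (ne_of_gt hs)

lemma logPsi_toC (c : Fin n → ℝ) (ϑhat : (Fin n → ℂ) → ℂ) (ξ : E n) :
    logPsi c ϑhat (toC ξ)
      = ∫ s in (0 : ℝ)..1, ((1 / s : ℝ) : ℂ) * ϑhat (toC (powE c s ξ)) := by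
  simp only [logPsi, toC_powE]

/-- The measure ds/s is invariant under s ↦ e^{-r}s, so the dilation of the argument becomes a
change of the upper limit. -/
lemma logPsi_dilE (c : Fin n → ℝ) (ϑhat : (Fin n → ℂ) → ℂ) (ξ : E n) (r : ℝ) :
    logPsi c ϑhat (toC (dilE c r ξ))
      = ∫ s in (0 : ℝ)..Real.exp (-r), ((1 / s : ℝ) : ℂ) * ϑhat (toC (powE c s ξ)) := by
  have h1 := intervalIntegral.smul_integral_comp_mul_left (a := 0) (b := 1)
    (fun s : ℝ => ((1 / s : ℝ) : ℂ) * ϑhat (toC (powE c s ξ))) (Real.exp (-r))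
  rw [mul_zero, mul_one] at h1
  rw [logPsi_toC, ← h1, ← intervalIntegral.integral_smul]
  refine intervalIntegral.integral_congr fun s hs => ?_
  rw [Set.uIcc_of_le zero_le_one] at hs
  rw [powE_exp_mul c hs.1, Complex.real_smul, ← mul_assoc, ← Complex.ofReal_mul]
  have : Real.exp (-r) ≠ 0 := (Real.exp_pos _).ne'
  congr 2
  -- At s = 0 both sides vanish by the convention 1/0 = 0.
  rcases eq_or_ne s 0 with h | h
  · simp [h]
  · field_simp

lemma KernelConditions.logPsi_zero (hϑ : KernelConditions β c ϑ ϑhat) :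
    logPsi c ϑhat 0 = 0 := by
  have : (fun _ : Fin n => (0 : ℂ)) = 0 := rfl
  simp [logPsi, this, hϑ.massless]

variable [NeZero n]

/-- The linear bound on ϑ̂ gives an integrand of size s^{c_min - 1} on (0, 1], integrable as c_min >
0. -/
lemma KernelConditions.intervalIntegrable (hβ : 0 < β) (hc : ∀ i, 0 < c i)
    (hϑ : KernelConditions β c ϑ ϑhat) (ξ : E n) :
    IntervalIntegrable (fun s : ℝ => ((1 / s : ℝ) : ℂ) * ϑhat (toC (powE c s ξ))) volume 0 1 := by
  obtain ⟨K, hK, hb⟩ := hϑ.exists_norm_le hβ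
  obtain ⟨i₀, hi₀⟩ := Finite.exists_min c
  have h1 : IntervalIntegrable (fun s : ℝ => K * ‖toC ξ‖ * s ^ (c i₀ - 1)) volume 0 1 :=
    (intervalIntegral.intervalIntegrable_rpow' (by linarith [hc i₀])).const_mul _
  rw [intervalIntegrable_iff_integrableOn_Ioc_of_le zero_le_one] at h1 ⊢
  refine h1.mono' (((hϑ.continuousOn_integrand hβ hc ξ).mono
    Set.Ioc_subset_Ioi_self).aestronglyMeasurable measurableSet_Ioc) ?_
  refine (ae_restrict_iff' measurableSet_Ioc).2 (Eventually.of_forall fun s hs => ?_)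
  have hs0 : 0 < s := hs.1
  have h2 : ‖toC (powE c s ξ)‖ ≤ s ^ c i₀ * ‖toC ξ‖ := by
    refine (pi_norm_le_iff_of_nonneg (by positivity)).2 fun i => ?_
    rw [toC_powE, norm_mul, Complex.norm_real, Real.norm_of_nonneg (by positivity)]
    exact mul_le_mul (Real.rpow_le_rpow_of_exponent_ge hs0 hs.2 (hi₀ i)) (norm_le_pi_norm _ i)
      (norm_nonneg _) (by positivity)
  rw [norm_mul, Complex.norm_real, Real.norm_of_nonneg (by positivity)]
  calc 1 / s * ‖ϑhat (toC (powE c s ξ))‖ ≤ 1 / s * (K * (s ^ c i₀ * ‖toC ξ‖)) :=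
        mul_le_mul_of_nonneg_left ((hb _ (toC_mem_tube hβ _)).trans
          (mul_le_mul_of_nonneg_left h2 hK)) (by positivity)
    _ = K * ‖toC ξ‖ * s ^ (c i₀ - 1) := by
      rw [Real.rpow_sub_one hs0.ne']
      ring

/-- `Cξ·∇ log ψ̂ (ξ) = ϑ̂(ξ)`. -/
lemma KernelConditions.hasDerivAt_logPsi (hβ : 0 < β) (hc : ∀ i, 0 < c i)
    (hϑ : KernelConditions β c ϑ ϑhat) (ξ : E n) :
    HasDerivAt (fun r => logPsi c ϑhat (toC (dilE c r ξ))) (-ϑhat (toC ξ)) 0 := by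
  simp only [logPsi_dilE]
  have hcont := hϑ.continuousOn_integrand hβ hc ξ
  have h1 : HasDerivAt (fun τ => ∫ s in (0 : ℝ)..τ, ((1 / s : ℝ) : ℂ) * ϑhat (toC (powE c s ξ)))
      (((1 / 1 : ℝ) : ℂ) * ϑhat (toC (powE c 1 ξ))) 1 :=
    intervalIntegral.integral_hasDerivAt_right (hϑ.intervalIntegrable hβ hc ξ)
      (hcont.stronglyMeasurableAtFilter isOpen_Ioi 1 (Set.mem_Ioi.2 one_pos))
      (hcont.continuousAt (Ioi_mem_nhds one_pos))
  have h2 : HasDerivAt (fun r : ℝ => Real.exp (-r)) (-1) 0 := by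
    simpa using (hasDerivAt_id (0 : ℝ)).neg.exp
  have h3 : powE c 1 ξ = ξ := by
    ext i
    simp [powE]
  have h4 : Real.exp (-(0 : ℝ)) = 1 := by simp
  have h5 := HasDerivAt.scomp_of_eq (0 : ℝ) h1 h2 h4.symm
  refine h5.congr_deriv ?_
  rw [h3]
  simp

/-- The operators `Ψ` and `Ψ⁻¹`. -/
lemma KernelConditions.exists_psi (hβ : 0 < β) (hϑ : KernelConditions β c ϑ ϑhat) :
    ∃ P Q : WSpace n β →L[ℂ] WSpace n β,
      (∀ f ξ, fl (P f) (toC ξ) = Complex.exp (logPsi c ϑhat (toC ξ)) * fl f (toC ξ)) ∧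
      (∀ f ξ, fl (Q f) (toC ξ) = Complex.exp (-logPsi c ϑhat (toC ξ)) * fl f (toC ξ)) ∧
      (∀ f, P (Q f) = f) ∧ ∀ f, Q (P f) = f := by
  obtain ⟨M, hM⟩ := hϑ.logPsi_re_bounded
  have hd := hϑ.logPsi_analytic.differentiableOn
  obtain ⟨P, -, hP⟩ := exists_mulOp hβ (m := fun z => Complex.exp (logPsi c ϑhat z)) hd.cexp
    (M := Real.exp M) fun z hz => by
      rw [Complex.norm_exp]
      exact Real.exp_le_exp.2 (abs_le.1 (hM z hz)).2
  obtain ⟨Q, -, hQ⟩ := exists_mulOp hβ (m := fun z => Complex.exp (-logPsi c ϑhat z)) hd.neg.cexp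
    (M := Real.exp M) fun z hz => by
      rw [Complex.norm_exp, Complex.neg_re]
      exact Real.exp_le_exp.2 (by linarith [(abs_le.1 (hM z hz)).1])
  refine ⟨P, Q, hP, hQ, fun f => ext_of_fl hβ fun ξ => ?_, fun f => ext_of_fl hβ fun ξ => ?_⟩
  · rw [hP, hQ, ← mul_assoc, ← Complex.exp_add, add_neg_cancel, Complex.exp_zero, one_mul]
  · rw [hQ, hP, ← mul_assoc, ← Complex.exp_add, neg_add_cancel, Complex.exp_zero, one_mul]

lemma hasDerivAt_fl_dilE (hβ : 0 < β) (c : Fin n → ℝ) (f : WSpace n β) (ξ : E n) :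
    HasDerivAt (fun r => fl f (toC (dilE c r ξ)))
      (-dfl f (toC ξ) fun i => (c i : ℂ) * (ξ i : ℂ)) 0 := by
  obtain ⟨D, hD, hDv⟩ := hasFDerivAt_fl hβ (Lp.memLp f) (toC_mem_tube hβ (dilE c 0 ξ))
  have h1 := (hD.restrictScalars ℝ).comp_hasDerivAt (0 : ℝ) (hasDerivAt_dilE c ξ 0)
  refine h1.congr_deriv ?_
  rw [ContinuousLinearMap.coe_restrictScalars', map_neg, hDv, dilE_zero]

/-- The intertwining 𝓛Ψ⁻¹ = Ψ⁻¹(𝓛 + Θ) at the level of symbols: the transport part is a derivation,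
and applied to -log ψ̂ it yields the multiplier ϑ̂. -/
lemma KernelConditions.fpSymbol_psi_inv (hβ : 0 < β) (hc : ∀ i, 0 < c i)
    (hϑ : KernelConditions β c ϑ ϑhat) {f h : WSpace n β}
    (hf : ∀ ξ, fl h (toC ξ) = Complex.exp (-logPsi c ϑhat (toC ξ)) * fl f (toC ξ)) (ξ : E n) :
    fpSymbol c h ξ = Complex.exp (-logPsi c ϑhat (toC ξ)) *
      (fpSymbol c f ξ + ϑhat (toC ξ) * fl f (toC ξ)) := by
  have h1 := hasDerivAt_fl_dilE hβ c h ξ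
  simp only [hf] at h1
  have h2 := (hϑ.hasDerivAt_logPsi hβ hc ξ).fun_neg.cexp.fun_mul (hasDerivAt_fl_dilE hβ c f ξ)
  have h3 := h1.unique h2
  rw [dilE_zero] at h3
  rw [fpSymbol, fpSymbol, hf]
  linear_combination h3

end Kernel

/-! ### The perturbed operator and the convolution -/

lemma mem_graph_perturbedOp {n : ℕ} [NeZero n] (β : ℝ) (c : Fin n → ℝ)
    (Θ : WSpace n β →L[ℂ] WSpace n β) (f g : WSpace n β) :
    (f, g) ∈ (perturbedOp β c Θ).graph ↔ (f, g - Θ f) ∈ (fpOp β c).graph := by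
  simp only [LinearPMap.mem_graph_iff]
  constructor
  · rintro ⟨⟨x, hx⟩, rfl, h2⟩
    refine ⟨⟨x, hx.1⟩, rfl, ?_⟩
    rw [eq_sub_iff_add_eq, ← h2]
    rfl
  · rintro ⟨⟨x, hx⟩, rfl, h2⟩
    refine ⟨⟨x, hx, trivial⟩, rfl, ?_⟩
    rw [eq_sub_iff_add_eq] at h2
    rw [← h2]
    rfl

lemma fourierInv_compSubConst {n : ℕ} [NeZero n] (φ : 𝓢(E n, ℂ)) (y ξ : E n) :
    (𝓕⁻ (φ.compSubConstCLM ℂ (-y)) : 𝓢(E n, ℂ)) ξ = kern (sc ξ) y * (𝓕⁻ φ : 𝓢(E n, ℂ)) ξ := by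
  rw [SchwartzMap.fourierInv_coe, SchwartzMap.fourierInv_coe, Real.fourierInv_eq',
    Real.fourierInv_eq', ← integral_const_mul]
  have h1 := integral_add_right_eq_self (μ := (volume : Measure (E n)))
    (fun v : E n => kern (sc ξ) y *
      (Complex.exp (((2 * Real.pi * inner ℝ v ξ : ℝ) : ℂ) * Complex.I) • φ v)) y
  rw [← h1]
  refine integral_congr_ae (Eventually.of_forall fun v => ?_)
  simp only [SchwartzMap.compSubConstCLM_apply, sub_neg_eq_add, smul_eq_mul]
  rw [← mul_assoc, ← line_zero (0 : Fin n), kern_line, mul_zero, mul_zero, neg_zero,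
    Complex.exp_zero, mul_one, ← Complex.exp_add, inner_add_left]
  congr 2
  push_cast
  ring

/-- Parseval and Fubini: a translation of φ multiplies its inverse transform by a character, and
integrating that character against f reproduces f̂. -/
lemma isConvolution_of_fl {n : ℕ} [NeZero n] {β : ℝ} (hβ : 0 < β) {c : Fin n → ℝ}
    {ϑ : 𝓢'(E n, ℂ)} {ϑhat : (Fin n → ℂ) → ℂ} (hϑ : KernelConditions β c ϑ ϑhat)
    {f g : WSpace n β} (h : ∀ ξ, fl g (toC ξ) = ϑhat (toC ξ) * fl f (toC ξ)) :
    IsConvolution ϑ f g := fun φ => by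
  obtain ⟨M, hM⟩ := hϑ.bounded
  have hf := integrable_of_memLp_weight hβ (Lp.memLp f)
  have hg := integrable_of_memLp_weight hβ (Lp.memLp g)
  set ψ : 𝓢(E n, ℂ) := 𝓕⁻ φ with hψ
  have hsc : ∀ ξ : E n, sc ξ ∈ tube n β := fun ξ => by
    rw [sc_eq_toC]
    exact toC_mem_tube hβ _
  have hcsc : Continuous (sc (n := n)) := by
    unfold sc
    fun_prop
  have hc1 : Continuous fun ξ : E n => ϑhat (sc ξ) :=
    hϑ.analytic.continuousOn.comp_continuous hcsc hsc
  have hi : Integrable fun ξ : E n => ϑhat (sc ξ) * ψ ξ :=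
    ψ.integrable.bdd_mul hc1.aestronglyMeasurable (Eventually.of_forall fun ξ => hM _ (hsc ξ))
  have h1 : ∀ y, ϑ (φ.compSubConstCLM ℂ (-y)) = ∫ ξ : E n, ϑhat (sc ξ) * (kern (sc ξ) y * ψ ξ) :=
    fun y => by
      have h2 := hϑ.fourier (𝓕⁻ (φ.compSubConstCLM ℂ (-y)))
      rw [TemperedDistribution.fourier_apply, FourierTransform.fourier_fourierInv_eq] at h2
      rw [h2]
      simp only [fourierInv_compSubConst]
      rfl
  have hφ : φ = 𝓕 (ψ : E n → ℂ) := by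
    rw [← SchwartzMap.fourier_coe, hψ, FourierTransform.fourier_fourierInv_eq]
  have hk : Continuous fun p : E n × E n => kern (sc p.2) p.1 := by
    unfold kern sc
    fun_prop
  calc ∫ x, g x * φ x = ∫ x, g x * 𝓕 (ψ : E n → ℂ) x := by rw [hφ]
    _ = ∫ ξ, 𝓕 (g : E n → ℂ) ξ * ψ ξ := (integral_fourier_mul_of_integrable hg ψ.integrable).symm
    _ = ∫ ξ, ∫ y, f y * (ϑhat (sc ξ) * (kern (sc ξ) y * ψ ξ)) := by
      refine integral_congr_ae (Eventually.of_forall fun ξ => ?_)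
      beta_reduce
      rw [← fl_sc, sc_eq_toC, h, ← sc_eq_toC, fl, ← integral_const_mul, ← integral_mul_const]
      refine integral_congr_ae (Eventually.of_forall fun y => ?_)
      beta_reduce
      ring
    _ = ∫ y, ∫ ξ, f y * (ϑhat (sc ξ) * (kern (sc ξ) y * ψ ξ)) := by
      refine (integral_integral_swap ?_).symm
      have h3 : Integrable (fun p : E n × E n => f p.1 * (ϑhat (sc p.2) * ψ p.2))
          (volume.prod volume) := hf.mul_prod hi
      refine (h3.bdd_mul (c := 1) hk.aestronglyMeasurable (Eventually.of_forall fun p => ?_)).congr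
        (Eventually.of_forall fun p => ?_)
      · rw [norm_kern]
        simp [sc]
      · simp only [Function.uncurry]
        ring
    _ = ∫ y, f y * ϑ (φ.compSubConstCLM ℂ (-y)) := by
      refine integral_congr_ae (Eventually.of_forall fun y => ?_)
      beta_reduce
      rw [h1, integral_const_mul]

/-! ### Mass and the Gaussian stationary state -/

lemma fourierInt_eq_fl {n : ℕ} (f : E n → ℂ) (ξ : E n) : fourierInt f ξ = fl f (toC ξ) := by
  refine integral_congr_ae (Eventually.of_forall fun x => ?_)
  simp only [kern, toC, inner_eq_sum]
  push_cast
  rfl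

lemma mass_eq_fl {n : ℕ} {β : ℝ} (f : WSpace n β) : mass f = fl f (toC 0) := by
  have h : toC (0 : E n) = 0 := by
    ext i
    simp [toC]
  simp [mass, fl, kern, h]

lemma fl_smul {n : ℕ} [NeZero n] {β : ℝ} (hβ : 0 < β) (a : ℂ) (f : WSpace n β) (ξ : E n) :
    fl (a • f : WSpace n β) (toC ξ) = a * fl f (toC ξ) := by
  have hz := toC_mem_tube hβ ξ
  rw [← flCLM_apply hβ hz, ← flCLM_apply hβ hz, map_smul, smul_eq_mul]

/-- The exponents 1/(2c_i) are the limits of τ_i(t) as t → ∞. -/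
lemma fourierInt_gaussian {n : ℕ} {c : Fin n → ℝ} (hc : ∀ i, 0 < c i) (ξ : E n) :
    fourierInt (gaussian c) ξ = gs (fun i => 1 / (2 * c i)) (toC ξ) := by
  have h1 := GaussianFourier.integral_cexp_neg_sum_mul_add (ι := Fin n)
    (b := fun i => ((c i / 2 : ℝ) : ℂ))
    (fun i => by rw [Complex.ofReal_re]; exact half_pos (hc i)) (fun i => -(Complex.I * ξ i))
  have h2 : ∀ i, ((Real.pi : ℂ) / ((c i / 2 : ℝ) : ℂ)) ^ (1 / 2 : ℂ)
      = ((Real.sqrt (c i / (2 * Real.pi)))⁻¹ : ℝ) := fun i => by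
    have h3 : (1 / 2 : ℂ) = ((1 / 2 : ℝ) : ℂ) := by push_cast; rfl
    have h4 : 0 ≤ Real.pi / (c i / 2) := div_nonneg Real.pi_pos.le (half_pos (hc i)).le
    rw [h3, ← Complex.ofReal_div, ← Complex.ofReal_cpow h4, ← Real.sqrt_eq_rpow, ← Real.sqrt_inv]
    congr 2
    rw [inv_div]
    field_simp
  have h5 : Real.sqrt (∏ i, c i / (2 * Real.pi)) = ∏ i, Real.sqrt (c i / (2 * Real.pi)) := by
    exact Real.sqrt_prod _ fun i _ => div_nonneg (hc i).le (by positivity)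
  have h6 : ∀ i, Real.sqrt (c i / (2 * Real.pi)) ≠ 0 := fun i =>
    (Real.sqrt_pos.2 (div_pos (hc i) (by positivity))).ne'
  have h7 : fourierInt (gaussian c) ξ = ((∏ i, Real.sqrt (c i / (2 * Real.pi)) : ℝ) : ℂ) *
      ∫ v : Fin n → ℝ, Complex.exp (-∑ i, ((c i / 2 : ℝ) : ℂ) * (v i : ℂ) ^ 2
        + ∑ i, -(Complex.I * ξ i) * (v i : ℂ)) := by
    rw [← (PiLp.volume_preserving_ofLp (Fin n)).integral_comp
      (MeasurableEquiv.toLp 2 (Fin n → ℝ)).symm.measurableEmbedding, ← integral_const_mul]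
    refine integral_congr_ae (Eventually.of_forall fun x => ?_)
    simp only [gaussian, h5, inner_eq_sum]
    rw [Complex.ofReal_mul, mul_assoc, Complex.ofReal_exp, ← Complex.exp_add]
    congr 2
    simp only [Finset.mul_sum, ← Finset.sum_neg_distrib, Complex.ofReal_sum]
    congr 1
    · refine Finset.sum_congr rfl fun i _ => ?_
      push_cast
      ring
    · refine Finset.sum_congr rfl fun i _ => ?_
      push_cast
      ring
  rw [h7, h1]
  simp only [h2, Finset.prod_mul_distrib, ← Complex.exp_sum]
  rw [← Complex.ofReal_prod, ← mul_assoc, ← Complex.ofReal_mul, ← Finset.prod_mul_distrib,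
    Finset.prod_eq_one fun i _ => mul_inv_cancel₀ (h6 i), Complex.ofReal_one, one_mul, gs,
    ← Finset.sum_neg_distrib]
  congr 1
  refine Finset.sum_congr rfl fun i _ => ?_
  have : (c i : ℂ) ≠ 0 := by exact_mod_cast (hc i).ne'
  rw [neg_sq, mul_pow, Complex.I_sq, toC]
  push_cast
  field_simp
  ring

/-- The Gaussian `μ₀` as an element of `L²(ω)`, stationary for the Fokker-Planck semigroup. -/
lemma exists_stationary {n : ℕ} [NeZero n] {β : ℝ} (hβ : 0 < β) {c : Fin n → ℝ}
    (hc : ∀ i, 0 < c i) : ∃ g : WSpace n β, FPRel c g 0 ∧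
      ∀ ξ, fl g (toC ξ) = gs (fun i => 1 / (2 * c i)) (toC ξ) := by
  obtain ⟨i₀, hi₀⟩ := Finite.exists_min fun i => 1 / (2 * c i)
  have hpos : ∀ i, 0 < 1 / (2 * c i) := fun i => by
    have := hc i
    positivity
  obtain ⟨g, -, hg, -⟩ := exists_of_gaussBound hβ
    (differentiable_gs (fun i => 1 / (2 * c i))).differentiableOn (Real.exp_pos _).le (hpos i₀)
    fun z hz => norm_gs_le (sum_inv_nonneg hc) hi₀
      (fun i => Finset.single_le_sum (f := fun j => 1 / (2 * c j)) (fun j _ => (hpos j).le)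
        (Finset.mem_univ i)) (mem_tube.1 hz).le
  refine ⟨g, ?_, hg⟩
  -- Invariance amounts to τ_i(t) + e^{-2c_i t}/(2c_i) = 1/(2c_i).
  have h1 : ∀ t, fpSemi hβ hc t g = g := fun t => ext_of_fl hβ fun ξ => by
    rw [fl_fpSemi, hg, hg, gs, gs, gs, ← Complex.exp_add, ← neg_add, ← Finset.sum_add_distrib]
    congr 2
    refine Finset.sum_congr rfl fun i _ => ?_
    have h2 : Real.exp (-(2 * c i * t)) = Real.exp (-(c i * t)) ^ 2 := by
      rw [← Real.exp_nat_mul]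
      congr 1
      push_cast
      ring
    have h3 : (c i : ℂ) ≠ 0 := by exact_mod_cast (hc i).ne'
    simp only [toC, dilE_apply, tau, h2]
    push_cast
    field_simp
    ring
  rw [fpRel_iff_tendsto hβ hc]
  simp only [h1, sub_self, smul_zero]
  exact tendsto_const_nhds

end NonlocalFP

end

/-! ### Proof of the theorem by conjugation -/

open NonlocalFP

theorem mainTheorem4 (n : ℕ) [NeZero n] (β : ℝ) (hβ : 0 < β)
    (c : Fin n → ℝ) (hc : ∀ i, 0 < c i) (hmono : Monotone c)
    (ϑ : 𝓢'(E n, ℂ)) (ϑhat : (Fin n → ℂ) → ℂ) (hϑ : KernelConditions β c ϑ ϑhat) :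
    -- the operator `Θ f = ϑ * f`, bounded on `𝓗`
    ∃ Θ : WSpace n β →L[ℂ] WSpace n β, (∀ f, IsConvolution ϑ f (Θ f)) ∧
    -- the semigroup `S t = e^{t(𝓛 + Θ)}`
    ∃ S : ℝ≥0 → WSpace n β →L[ℂ] WSpace n β,
      IsC0Semigroup S ∧ IsGenerator (perturbedOp β c Θ) S ∧
    -- the unique normalized stationary solution `f₀ = Ψ μ₀`
    ∃ f₀ : WSpace n β, IsPsiGaussian c ϑhat f₀ ∧
      (f₀, 0) ∈ (perturbedOp β c Θ).graph ∧ mass f₀ = 1 ∧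
      (∀ g : WSpace n β, (g, 0) ∈ (perturbedOp β c Θ).graph → mass g = 1 → g = f₀) ∧
    -- exponential convergence
    ∃ C : ℝ, 0 < C ∧ ∀ (φ : WSpace n β) (t : ℝ≥0),
      ‖S t φ - mass φ • f₀‖ ≤ C * ‖φ - mass φ • f₀‖ * Real.exp (-(t * c 0)) := by
  obtain ⟨M, hM⟩ := hϑ.bounded
  obtain ⟨Θ, -, hΘ⟩ := exists_mulOp hβ hϑ.analytic.differentiableOn hM
  obtain ⟨P, Q, hP, hQ, hPQ, hQP⟩ := hϑ.exists_psi hβ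
  obtain ⟨g₀, hg₀, hg₀'⟩ := exists_stationary hβ hc
  obtain ⟨K, hK, hdecay⟩ := exists_norm_fpSemi_le_exp hβ hc (hc 0) fun i => hmono (Fin.zero_le i)
  have hS := isC0Semigroup_fpSemi hβ hc
  -- This is 𝓛 + Θ = P𝓛Q including domains: the nonvanishing factor e^{-log ψ̂} cancels at every
  -- frequency.
  have hgraph : ∀ f g, (f, g) ∈ (perturbedOp β c Θ).graph ↔ FPRel c (Q f) (Q g) := fun f g => by
    rw [mem_graph_perturbedOp, mem_graph_fpOp hβ hc]
    refine forall_congr' fun ξ => ?_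
    rw [hϑ.fpSymbol_psi_inv hβ hc (hQ f), hQ, fl_sub hβ _ _ (toC_mem_tube hβ ξ), hΘ,
      mul_right_inj' (Complex.exp_ne_zero _), eq_sub_iff_add_eq]
  have hlog : logPsi c ϑhat (toC 0) = 0 := by
    have : toC (0 : E n) = 0 := by
      ext i
      simp [toC]
    rw [this, hϑ.logPsi_zero]
  have hmP : ∀ f, mass (P f) = mass f := fun f => by
    rw [mass_eq_fl, mass_eq_fl, hP, hlog, Complex.exp_zero, one_mul]
  have hmQ : ∀ f, mass (Q f) = mass f := fun f => by
    rw [← hmP, hPQ]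
  have hmg : mass g₀ = 1 := by
    rw [mass_eq_fl, hg₀']
    simp [gs, toC]
  have hms : ∀ (f : WSpace n β), fl (f - mass f • g₀ : WSpace n β) 0 = 0 := fun f => by
    have h0 : (0 : Fin n → ℂ) = toC 0 := by
      ext i
      simp [toC]
    rw [h0, fl_sub hβ _ _ (toC_mem_tube hβ 0), fl_smul hβ, ← mass_eq_fl, ← mass_eq_fl, hmg,
      mul_one, sub_self]
  have hfix : ∀ t, fpSemi hβ hc t g₀ = g₀ := fpSemi_apply_eq_self hβ hc hg₀
  -- The summand 1 in the constant only secures strict positivity.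
  refine ⟨Θ, fun f => isConvolution_of_fl hβ hϑ (hΘ f),
    fun t => P.comp ((fpSemi hβ hc t).comp Q), ⟨?_, fun s t => ?_, fun f => ?_⟩, fun f g => ?_,
    P g₀, fun ξ => ?_, ?_, ?_, fun g hg hm => ?_, ‖P‖ * K * ‖Q‖ + 1, by positivity, fun φ t => ?_⟩
  · ext1 f
    simp only [hS.zero, ContinuousLinearMap.comp_apply, ContinuousLinearMap.id_apply, hPQ]
  · ext1 f
    simp only [hS.add, ContinuousLinearMap.comp_apply, hQP]
  · have h1 := (P.continuous.tendsto _).comp (hS.continuous (Q f))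
    rw [hPQ] at h1
    exact h1
  · rw [hgraph, fpRel_iff_tendsto hβ hc]
    have key : ∀ t : ℝ≥0, P ((((t : ℝ)⁻¹ : ℝ) : ℂ) • (fpSemi hβ hc t (Q f) - Q f))
        = (((t : ℝ)⁻¹ : ℝ) : ℂ) • (P.comp ((fpSemi hβ hc t).comp Q) f - f) := fun t => by
      rw [map_smul, map_sub, hPQ]
      rfl
    constructor
    · intro h
      have h1 := (P.continuous.tendsto _).comp h
      rw [hPQ] at h1
      exact h1.congr key
    · intro h
      -- Applying Q = P⁻¹ undoes the conjugation of the difference quotient.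
      refine ((Q.continuous.tendsto _).comp h).congr fun t => ?_
      rw [Function.comp_apply, ← key, hQP]
  · rw [fourierInt_eq_fl, hP, fourierInt_gaussian hc, hg₀']
    rfl
  · rw [hgraph, hQP, map_zero]
    exact hg₀
  · rw [hmP, hmg]
  · rw [hgraph, map_zero] at hg
    have h1 : fl (Q g - g₀ : WSpace n β) 0 = 0 := by
      have := hms (Q g)
      rwa [hmQ, hm, one_smul] at this
    -- The difference of two stationary states of equal mass is fixed by the semigroup and yet
    -- decays, so it vanishes.
    have h2 : ∀ t : ℝ≥0, ‖Q g - g₀‖ ≤ K * ‖Q g - g₀‖ * Real.exp (-(t * c 0)) := fun t => by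
      have := hdecay _ t h1
      rwa [map_sub, fpSemi_apply_eq_self hβ hc hg, hfix] at this
    have h3 : Tendsto (fun t : ℝ≥0 => K * ‖Q g - g₀‖ * Real.exp (-((t : ℝ) * c 0))) atTop
        (𝓝 (K * ‖Q g - g₀‖ * 0)) :=
      (Real.tendsto_exp_neg_atTop_nhds_zero.comp
        (NNReal.tendsto_coe_atTop.2 tendsto_id |>.atTop_mul_const (hc 0))).const_mul _
    rw [mul_zero] at h3
    have h4 : ‖Q g - g₀‖ ≤ 0 := ge_of_tendsto' h3 h2
    rw [← hPQ g, sub_eq_zero.1 (norm_le_zero_iff.1 h4)]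
  · have h1 : P.comp ((fpSemi hβ hc t).comp Q) φ - mass φ • P g₀
        = P (fpSemi hβ hc t (Q φ - mass φ • g₀)) := by
      simp only [ContinuousLinearMap.comp_apply, map_sub, map_smul, hfix]
    have h2 : Q φ - mass φ • g₀ = Q (φ - mass φ • P g₀) := by
      rw [map_sub, map_smul, hQP]
    have h3 : fl (Q φ - mass φ • g₀ : WSpace n β) 0 = 0 := by
      have := hms (Q φ)
      rwa [hmQ] at this
    rw [h1]
    calc ‖P (fpSemi hβ hc t (Q φ - mass φ • g₀))‖
        ≤ ‖P‖ * (K * (‖Q‖ * ‖φ - mass φ • P g₀‖) * Real.exp (-(t * c 0))) := by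
          refine (P.le_opNorm _).trans (mul_le_mul_of_nonneg_left ?_ (norm_nonneg _))
          refine (hdecay _ t h3).trans ?_
          rw [h2]
          gcongr
          exact Q.le_opNorm _
      _ = ‖P‖ * K * ‖Q‖ * ‖φ - mass φ • P g₀‖ * Real.exp (-(t * c 0)) := by ring
      _ ≤ _ := by
          gcongr
          linarith
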